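/- Let $n\ge 2$. Let $e_{ij}$ be the $n\times n$ matrix units, let $\mathfrak h\subset\mathfrak{sl}_n(\mathbb C)$ be the diagonal traceless matrices, let $\langle x,y\rangle=\operatorname{tr}(xy)$, and let $\alpha_1,\dots,\alpha_{n-1}$ be the simple roots, $\alpha_i(h)=h_{ii}-h_{i+1,i+1}$. Consider the Cremmer--Gervais Belavin--Drinfeld triple $\Gamma_1=\{\alpha_2,\dots,\alpha_{n-1}\}$, $\Gamma_2=\{\alpha_1,\dots,\alpha_{n-2}\}$, $\gamma(\alpha_i)=\alpha_{i-1}$; extend $\gamma$ additively to the roots generated by $\Gamma_1$, and for positive roots write $\alpha\prec\beta$ if $\beta=\gamma^m(\alpha)$ for some $m\ge 1$. For the positive root $\alpha=\alpha_i+\dots+\alpha_{j-1}$, $i<j$, put $e_\alpha=e_{ij}$ and $e_{-\alpha}=e_{ji}$. Let $$r=r_0+\sum_{\alpha>0}e_{-\alpha}\otimes e_\alpha+\sum_{\alpha\prec\beta}\bigl(e_{-\alpha}\otimes e_\beta-e_\beta\otimes e_{-\alpha}\bigr)\in\mathfrak{sl}_n\otimes\mathfrak{sl}_n$$ be an R-matrix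 of the corresponding class, i.e. $r_0\in\mathfrak h\otimes\mathfrak h$ satisfies $(\gamma(\alpha)\otimes\mathrm{id}+\mathrm{id}\otimes\alpha)\,r_0=0$ for all $\alpha\in\Gamma_1$, and $(\langle h,\cdot\rangle\otimes\mathrm{id})(r_0+r_0^{21})=h$ for all $h\in\mathfrak h$, where $r_0^{21}$ is obtained from $r_0$ by switching the tensor factors. The Cremmer--Gervais bracket on $SL_n$ is the Poisson--Lie bracket $$\{f,g\}=\sum\bigl(L_af\cdot L_bg-R_af\cdot R_bg\bigr),\qquad r=\sum a\otimes b,$$ where $(L_\xi f)(X)=\frac{d}{dt}f(Xe^{t\xi})\big|_{t=0}$ and $(R_\xi f)(X)=\frac{d}{dt}f(e^{t\xi}X)\big|_{t=0}$. It is extended by the same formula to the space $\operatorname{Mat}_n$ of complex $n\times n$ matrices, where $\det X$ is a Casimir function. For a matrix $A$ let $A_I^J$ be its submatrix in rows $I$ and columns $J$. For $n\times n$ matrices $X,Y$ let $\mathcal X=[X_{[2,n]}\ 0]$ and $\mathcal Y=[0\ Y_{[1,n-1]}]$, where $X_{[2,n]}$ consists of the last $n-1$ rows of $X$, $Y_{[1,n-1]}$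 of the first $n-1$ rows of $Y$, and $0$ is a zero column; these are $(n-1)\times(n+1)$ matrices. Put $k=\lfloor\frac{n+1}2\rfloor$, $N=k(n-1)$, and let $M=N$ if $n$ is even, $M=N-n+1$ if $n$ is odd. Let $U(X,Y)$ be the $k(n-1)\times(k+1)(n+1)$ matrix of $k\times(k+1)$ blocks of size $(n-1)\times(n+1)$ whose $(i,i)$ blocks are $\mathcal Y$, whose $(i,i+1)$ blocks are $\mathcal X$, and whose other blocks are $0$. Define $$\theta_i(X)=\det X_{[n-i+1,n]}^{[n-i+1,n]}\ (1\le i\le n-1),$$ $$\varphi_p(X,Y)=\det U(X,Y)_{[N-p+1,N]}^{[k(n+1)-p+1,\,k(n+1)]}\ (1\le p\le N),$$ $$\psi_q(X,Y)=\det U(X,Y)_{[N-q+1,N]}^{[k(n+1)-q+2,\,k(n+1)+1]}\ (1\le q\le M).$$ **Theorem.** The functions $\theta_i(X)$, $1\le i\le n-1$, $\varphi_p(X,X)$, $1\le p\le N$, and $\psi_q(X,X)$, $1\le q\le M$, form a log-canonical family for the Cremmer--Gervais bracket on $SL_n$, and also for its extension to $\operatorname{Mat}_n$: for any two functions $f,g$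 of the family there is a constant $\omega\in\mathbb C$ such that $\{f,g\}=\omega fg$. -/

import Mathlib

open scoped TensorProduct

namespace CremmerGervais

noncomputable section

/-! ### The Lie algebra `sl_n` and its Cartan subalgebra -/

/-- The Lie algebra `sl_n(ℂ)` of traceless matrices. -/
abbrev sl (n : ℕ) : Type := LieAlgebra.SpecialLinear.sl (Fin n) ℂ

/-- The root vector `e_{ε_i - ε_j} = E_ij` of `sl_n`, for `i ≠ j` (and `0` for `i = j`, a value
that is never used). -/
def rootVector (n : ℕ) (i j : Fin n) : sl n :=
  if h : i = j then 0 else LieAlgebra.SpecialLinear.single i j h (1 : ℂ)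

/-- The Cartan subalgebra `𝔥` of diagonal traceless matrices. -/
def cartan (n : ℕ) : Submodule ℂ (sl n) where
  carrier := {ξ | ∀ i j, i ≠ j → ξ.val i j = 0}
  add_mem' := by
    intro a b ha hb i j hij
    simp [ha i j hij, hb i j hij]
  zero_mem' := by
    intro i j _
    simp
  smul_mem' := by
    intro c a ha i j hij
    simp [ha i j hij]

/-- The simple root `ε_a - ε_{a+1}` as a linear functional on `𝔥` (indices count from `0`,
so this is `α_{a+1}` in the numbering `α_1, …, α_{n-1}`). -/
def simpleRoot (n a : ℕ) (ha : a + 1 < n) : cartan n →ₗ[ℂ] ℂ where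
  toFun h := h.val.val ⟨a, by omega⟩ ⟨a, by omega⟩ - h.val.val ⟨a + 1, ha⟩ ⟨a + 1, ha⟩
  map_add' := by
    intro x y
    simp
    ring
  map_smul' := by
    intro c x
    simp
    ring

/-- The functional `⟨h, ·⟩` on `𝔥`, where `⟨x, y⟩ = tr (x y)` is the trace form (the Killing form of
`sl_n` is `2n` times the trace form). -/
def cartanPairing (n : ℕ) (h : cartan n) : cartan n →ₗ[ℂ] ℂ where
  toFun h' := Matrix.trace (h.val.val * h'.val.val)
  map_add' := by
    intro x y
    simp [mul_add]
  map_smul' := by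
    intro c x
    simp

/-! ### The Belavin--Drinfeld class of Cremmer--Gervais type -/

/-- The partial order `α ≺ β` on positive roots defined by the Belavin--Drinfeld triple
`Γ₁ = {α_2, …, α_{n-1}}`, `Γ₂ = {α_1, …, α_{n-2}}`, `γ (α_i) = α_{i-1}`. The pair `(i, j)`, `i < j`,
stands for the positive root `ε_i - ε_j = α_i + ⋯ + α_{j-1}`; the extension of `γ` to roots sends
`ε_i - ε_j` to `ε_{i-1} - ε_{j-1}` (when `i` is not the first index), and `α ≺ β` means
`β = γ^m (α)` for some `m ≥ 1`. -/
def RootPrec {n : ℕ} (α β : Fin n × Fin n) : Prop :=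
  ∃ m : ℕ, 1 ≤ m ∧ (α.1 : ℕ) = β.1 + m ∧ (α.2 : ℕ) = β.2 + m

/-- The positive roots `ε_i - ε_j`, `i < j`. -/
def posRoots (n : ℕ) : Finset (Fin n × Fin n) := Finset.univ.filter fun α => α.1 < α.2

/-- The Belavin--Drinfeld conditions on the Cartan part `r₀ ∈ 𝔥 ⊗ 𝔥` of an R-matrix:
* `(γ(α) ⊗ id + id ⊗ α) r₀ = 0` for all `α ∈ Γ₁`;
* `r₀ + r₀²¹` is the element `t₀ ∈ 𝔥 ⊗ 𝔥` dual to the invariant form, that is,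
  `(⟨h, ·⟩ ⊗ id) (r₀ + r₀²¹) = h` for all `h ∈ 𝔥`. -/
structure IsCartanPart (n : ℕ) (r₀ : cartan n ⊗[ℂ] cartan n) : Prop where
  gamma_eq : ∀ (a : ℕ) (ha : a + 1 + 1 < n),
    TensorProduct.lid ℂ (cartan n) ((simpleRoot n a (by omega)).rTensor (cartan n) r₀) +
      TensorProduct.rid ℂ (cartan n) ((simpleRoot n (a + 1) ha).lTensor (cartan n) r₀) = 0
  symm_eq : ∀ h : cartan n,
    TensorProduct.lid ℂ (cartan n)
      ((cartanPairing n h).rTensor (cartan n) (r₀ + TensorProduct.comm ℂ _ _ r₀)) = h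

/-- The root part `∑_{α > 0} e_{-α} ⊗ e_α + ∑_{α ≺ β} e_{-α} ∧ e_β` of the R-matrices in the
Cremmer--Gervais class, where `x ∧ y = x ⊗ y - y ⊗ x`. -/
def rootPart (n : ℕ) : sl n ⊗[ℂ] sl n :=
  (∑ α ∈ posRoots n, rootVector n α.2 α.1 ⊗ₜ[ℂ] rootVector n α.1 α.2) +
    open Classical in
    ∑ α ∈ posRoots n, ∑ β ∈ (posRoots n).filter (fun β => RootPrec α β),
      (rootVector n α.2 α.1 ⊗ₜ[ℂ] rootVector n β.1 β.2 -
        rootVector n β.1 β.2 ⊗ₜ[ℂ] rootVector n α.2 α.1)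

/-- `r ∈ sl_n ⊗ sl_n` is an R-matrix of the Belavin--Drinfeld class of Cremmer--Gervais type. -/
def IsRMatrix (n : ℕ) (r : sl n ⊗[ℂ] sl n) : Prop :=
  ∃ r₀ : cartan n ⊗[ℂ] cartan n, IsCartanPart n r₀ ∧
    r = TensorProduct.map (cartan n).subtype (cartan n).subtype r₀ + rootPart n

/-- The traceless diagonal matrix `E_ii - (1/n) I`. -/
def diagElt (n : ℕ) (hn : n ≠ 0) (i : Fin n) : cartan n :=
  ⟨⟨Matrix.diagonal fun j => (if j = i then 1 else 0) - (n : ℂ)⁻¹, by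
    have h : (n : ℂ) ≠ 0 := Nat.cast_ne_zero.mpr hn
    refine LinearMap.mem_ker.mpr ?_
    simp [Finset.sum_sub_distrib, h]⟩, by
    intro a b hab
    exact Matrix.diagonal_apply_ne _ hab⟩

theorem simpleRoot_diagElt (n : ℕ) (hn : n ≠ 0) (a : ℕ) (ha : a + 1 < n) (i : Fin n) :
    simpleRoot n a ha (diagElt n hn i) =
      (if a = (i : ℕ) then 1 else 0) - (if a + 1 = (i : ℕ) then 1 else 0) := by
  simp [simpleRoot, diagElt, Fin.ext_iff]

theorem cartanPairing_diagElt (n : ℕ) (hn : n ≠ 0) (h : cartan n) (i : Fin n) :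
    cartanPairing n h (diagElt n hn i) = h.val.val i i := by
  have ht : h.val.val.trace = 0 := h.val.property
  have ht2 : ∑ j, h.val.val j j = 0 := ht
  simp [cartanPairing, diagElt, Matrix.trace, Matrix.mul_diagonal, mul_sub,
    Finset.sum_sub_distrib, ← Finset.sum_mul, ht2]

theorem sum_diagElt (n : ℕ) (hn : n ≠ 0) (h : cartan n) :
    ∑ i, h.val.val i i • diagElt n hn i = h := by
  have ht : h.val.val.trace = 0 := h.val.property
  have ht2 : ∑ j, h.val.val j j = 0 := ht
  apply Subtype.ext
  apply Subtype.ext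
  ext a b
  have e : (∑ i, h.val.val i i • diagElt n hn i).val.val a b
      = ∑ i, h.val.val i i * (diagElt n hn i).val.val a b := by
    rw [AddSubmonoidClass.coe_finsetSum, AddSubmonoidClass.coe_finsetSum, Matrix.sum_apply]
    rfl
  rw [e]
  by_cases hab : a = b
  · subst hab
    simp [diagElt, mul_sub, Finset.sum_sub_distrib, ← Finset.sum_mul, ht2]
  · rw [h.property a b hab]
    simp [diagElt, hab]

/-- The coefficients of the Cartan part of the Cremmer--Gervais R-matrix. -/
def rho (n : ℕ) (i j : Fin n) : ℂ :=
  ((j : ℂ) - (i : ℂ) - 1 / 2) * (n : ℂ)⁻¹ + if (j : ℕ) ≤ i then 1 / 2 else - (1 / 2)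

theorem sum_diagElt_zero (n : ℕ) (hn : n ≠ 0) : ∑ i, diagElt n hn i = 0 := by
  have hn' : (n : ℂ) ≠ 0 := Nat.cast_ne_zero.mpr hn
  apply Subtype.ext
  apply Subtype.ext
  ext a b
  have e : (∑ i, diagElt n hn i).val.val a b = ∑ i, (diagElt n hn i).val.val a b := by
    rw [AddSubmonoidClass.coe_finsetSum, AddSubmonoidClass.coe_finsetSum, Matrix.sum_apply]
  rw [e]
  by_cases hab : a = b
  · subst hab
    simp [diagElt, Finset.sum_sub_distrib, hn']
  · simp [diagElt, hab]

/-- The Belavin--Drinfeld conditions on the Cartan part have a solution. -/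
theorem exists_isCartanPart (n : ℕ) (hn : n ≠ 0) :
    ∃ r₀ : cartan n ⊗[ℂ] cartan n, IsCartanPart n r₀ := by
  refine ⟨∑ i, ∑ j, rho n i j • (diagElt n hn i ⊗ₜ[ℂ] diagElt n hn j), ?_, ?_⟩
  · intro a ha
    have hs : ∀ b : ℕ, b < n → ∀ f : Fin n → ℂ, (hb : b < n) →
        ∑ i : Fin n, (if b = (i : ℕ) then 1 else 0) * f i = f ⟨b, hb⟩ := by
      intro b _ f hb
      rw [Finset.sum_eq_single ⟨b, hb⟩]
      · simp
      · intro c _ hc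
        rw [if_neg, zero_mul]
        rintro rfl
        exact hc rfl
      · simp
    simp only [map_sum, map_smul, LinearMap.rTensor_tmul, LinearMap.lTensor_tmul,
      TensorProduct.lid_tmul, TensorProduct.rid_tmul, simpleRoot_diagElt, smul_smul]
    rw [Finset.sum_comm, ← Finset.sum_add_distrib]
    refine Finset.sum_eq_zero fun j _ => ?_
    rw [← Finset.sum_smul, ← Finset.sum_smul, ← add_smul]
    convert zero_smul ℂ _
    have h1 := hs a (by omega) (fun i => rho n i j) (by omega)
    have h2 := hs (a + 1) (by omega) (fun i => rho n i j) (by omega)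
    have h3 := hs (a + 1) (by omega) (fun i => rho n j i) (by omega)
    have h4 := hs (a + 1 + 1) (by omega) (fun i => rho n j i) (by omega)
    simp only [mul_comm (rho n _ _), sub_mul, Finset.sum_sub_distrib, h1, h2, h3, h4]
    simp only [rho]
    push_cast
    rcases lt_trichotomy (j : ℕ) (a + 1) with h | h | h
    · rw [if_pos (by omega), if_pos (by omega), if_neg (by omega), if_neg (by omega)]
      ring
    · rw [if_neg (by omega), if_pos (by omega), if_pos (by omega), if_neg (by omega)]
      ring
    · rw [if_neg (by omega), if_neg (by omega), if_pos (by omega), if_pos (by omega)]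
      ring
  · intro h
    have hr : ∀ i j, rho n i j + rho n j i = (if i = j then 1 else 0) - (n : ℂ)⁻¹ := by
      intro i j
      simp only [rho, Fin.ext_iff]
      rcases lt_trichotomy (i : ℕ) j with h | h | h
      · rw [if_neg (by omega), if_pos (by omega), if_neg (by omega)]
        ring
      · rw [if_pos (by omega), if_pos (by omega), if_pos h]
        ring
      · rw [if_pos (by omega), if_neg (by omega), if_neg (by omega)]
        ring
    have e : (∑ i, ∑ j, rho n i j • (diagElt n hn i ⊗ₜ[ℂ] diagElt n hn j)) +
        TensorProduct.comm ℂ _ _ (∑ i, ∑ j, rho n i j • (diagElt n hn i ⊗ₜ[ℂ] diagElt n hn j))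
        = ∑ i, ∑ j, ((if i = j then 1 else 0) - (n : ℂ)⁻¹) •
          (diagElt n hn i ⊗ₜ[ℂ] diagElt n hn j) := by
      simp only [map_sum, map_smul, TensorProduct.comm_tmul]
      rw [Finset.sum_comm (f := fun i j => rho n i j • (diagElt n hn j ⊗ₜ[ℂ] diagElt n hn i)),
        ← Finset.sum_add_distrib]
      refine Finset.sum_congr rfl fun i _ => ?_
      rw [← Finset.sum_add_distrib]
      refine Finset.sum_congr rfl fun j _ => ?_
      rw [← add_smul, hr]
    rw [e]
    simp only [map_sum, map_smul, LinearMap.rTensor_tmul, TensorProduct.lid_tmul,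
      cartanPairing_diagElt]
    conv_rhs => rw [← sum_diagElt n hn h]
    refine Finset.sum_congr rfl fun i _ => ?_
    simp only [sub_smul, Finset.sum_sub_distrib, ite_smul, one_smul, zero_smul,
      Finset.sum_ite_eq, Finset.mem_univ, if_true]
    rw [← Finset.smul_sum, ← Finset.smul_sum, sum_diagElt_zero, smul_zero, smul_zero, sub_zero]

/-- The Belavin--Drinfeld class of Cremmer--Gervais type is not empty. -/
theorem exists_isRMatrix (n : ℕ) (hn : n ≠ 0) : ∃ r, IsRMatrix n r := by
  obtain ⟨r₀, h⟩ := exists_isCartanPart n hn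
  exact ⟨_, r₀, h, rfl⟩

/-! ### Regular functions on `Mat_n` and `SL_n` and the Poisson--Lie bracket -/

/-- The ring `𝒪(Mat_n)` of polynomials in the matrix entries. -/
abbrev CoordMat (n : ℕ) : Type := MvPolynomial (Fin n × Fin n) ℂ

/-- The matrix `X = (x_ij)` of coordinate functions. -/
abbrev genericMatrix (n : ℕ) : Matrix (Fin n) (Fin n) (CoordMat n) :=
  Matrix.mvPolynomialX (Fin n) (Fin n) ℂ

/-- The ideal of `SL_n` in `𝒪(Mat_n)`. -/
abbrev idealSL (n : ℕ) : Ideal (CoordMat n) := Ideal.span {(genericMatrix n).det - 1}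

/-- The ring `𝒪(SL_n)`. -/
abbrev CoordSL (n : ℕ) : Type := CoordMat n ⧸ idealSL n

/-- Restriction of regular functions from `Mat_n` to `SL_n`. -/
def restrictSL (n : ℕ) : CoordMat n →ₐ[ℂ] CoordSL n := Ideal.Quotient.mkₐ ℂ (idealSL n)

/-- A matrix `ξ ∈ sl_n`, viewed as a matrix with constant polynomial entries. -/
def constMatrix (n : ℕ) (ξ : sl n) : Matrix (Fin n) (Fin n) (CoordMat n) :=
  ξ.val.map MvPolynomial.C

/-- The left-invariant vector field `(L_ξ f)(X) = d/dt f (X exp (t ξ)) |_{t = 0}` on `Mat_n`: the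
derivation that sends the matrix of coordinates `X` to `X ξ`. -/
def leftInvMat (n : ℕ) : sl n →ₗ[ℂ] Derivation ℂ (CoordMat n) (CoordMat n) where
  toFun ξ := MvPolynomial.mkDerivation ℂ fun p =>
    (genericMatrix n * constMatrix n ξ) p.1 p.2
  map_add' := by
    intro x y
    apply MvPolynomial.derivation_ext
    intro p
    simp [constMatrix, Matrix.mul_apply, mul_add, Finset.sum_add_distrib]
  map_smul' := by
    intro c x
    apply MvPolynomial.derivation_ext
    intro p
    simp [constMatrix, Matrix.mul_apply, Finset.smul_sum, MvPolynomial.smul_eq_C_mul, mul_left_comm]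

/-- The right-invariant vector field `(R_ξ f)(X) = d/dt f (exp (t ξ) X) |_{t = 0}` on `Mat_n`: the
derivation that sends the matrix of coordinates `X` to `ξ X`. -/
def rightInvMat (n : ℕ) : sl n →ₗ[ℂ] Derivation ℂ (CoordMat n) (CoordMat n) where
  toFun ξ := MvPolynomial.mkDerivation ℂ fun p =>
    (constMatrix n ξ * genericMatrix n) p.1 p.2
  map_add' := by
    intro x y
    apply MvPolynomial.derivation_ext
    intro p
    simp [constMatrix, Matrix.mul_apply, add_mul, Finset.sum_add_distrib]
  map_smul' := by
    intro c x
    apply MvPolynomial.derivation_ext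
    intro p
    simp [constMatrix, Matrix.mul_apply, Finset.smul_sum, MvPolynomial.smul_eq_C_mul, mul_assoc]


theorem derivation_prod {A : Type*} [CommRing A] [Algebra ℂ A] (d : Derivation ℂ A A)
    {ι : Type*} [DecidableEq ι] (s : Finset ι) (f : ι → A) :
    d (∏ i ∈ s, f i) = ∑ i ∈ s, ∏ j ∈ s, if j = i then d (f j) else f j := by
  induction s using Finset.induction_on with
  | empty => simp
  | insert a s ha ih =>
    rw [Finset.prod_insert ha, Derivation.leibniz, ih, Finset.sum_insert ha,
      Finset.prod_insert ha, if_pos rfl, smul_eq_mul, smul_eq_mul, add_comm, Finset.mul_sum]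
    congr 1
    · rw [mul_comm]
      congr 1
      refine Finset.prod_congr rfl fun j hj => ?_
      rw [if_neg]
      rintro rfl
      exact ha hj
    · refine Finset.sum_congr rfl fun i hi => ?_
      rw [Finset.prod_insert ha, if_neg]
      rintro rfl
      exact ha hi

theorem derivation_det {A : Type*} [CommRing A] [Algebra ℂ A] (d : Derivation ℂ A A)
    {n : ℕ} (X : Matrix (Fin n) (Fin n) A) :
    d X.det = ∑ i, (X.updateCol i fun k => d (X k i)).det := by
  simp only [Matrix.det_apply, Units.smul_def, map_sum]
  rw [Finset.sum_comm]
  refine Finset.sum_congr rfl fun σ _ => ?_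
  rw [map_zsmul, derivation_prod, Finset.smul_sum]
  refine Finset.sum_congr rfl fun i _ => ?_
  congr 1
  refine Finset.prod_congr rfl fun j _ => ?_
  rw [Matrix.updateCol_apply]
  split_ifs with h
  · rw [h]
  · rfl

theorem derivation_det_right {A : Type*} [CommRing A] [Algebra ℂ A]
    (d : Derivation ℂ A A) {n : ℕ} (X M : Matrix (Fin n) (Fin n) A)
    (h : ∀ i j, d (X i j) = (X * M) i j) : d X.det = M.trace * X.det := by
  rw [derivation_det, Matrix.trace, Finset.sum_mul]
  refine Finset.sum_congr rfl fun i _ => ?_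
  have := Matrix.det_updateCol_sum X i (fun k => M k i)
  rw [Matrix.diag_apply, ← smul_eq_mul, ← this]
  congr 2
  funext k
  rw [h, Matrix.mul_apply]
  exact Finset.sum_congr rfl fun j _ => mul_comm _ _

theorem derivation_det_left {A : Type*} [CommRing A] [Algebra ℂ A]
    (d : Derivation ℂ A A) {n : ℕ} (X M : Matrix (Fin n) (Fin n) A)
    (h : ∀ i j, d (X i j) = (M * X) i j) : d X.det = M.trace * X.det := by
  rw [← Matrix.det_transpose X, ← Matrix.trace_transpose M]
  refine derivation_det_right d X.transpose M.transpose fun i j => ?_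
  rw [← Matrix.transpose_mul, Matrix.transpose_apply, Matrix.transpose_apply, h]

theorem trace_constMatrix (n : ℕ) (ξ : sl n) : (constMatrix n ξ).trace = 0 := by
  have h : ξ.val.trace = 0 := ξ.property
  have h2 : (constMatrix n ξ).trace = MvPolynomial.C ξ.val.trace := by
    simp [constMatrix, Matrix.trace]
  rw [h2, h, map_zero]

/-- The determinant is annihilated by the left-invariant vector fields of elements of `sl_n`. -/
theorem leftInvMat_det (n : ℕ) (ξ : sl n) : leftInvMat n ξ (genericMatrix n).det = 0 := by
  rw [derivation_det_right _ _ (constMatrix n ξ), trace_constMatrix, zero_mul]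
  intro i j
  exact MvPolynomial.mkDerivation_X _ _ _

/-- The determinant is annihilated by the right-invariant vector fields of elements of `sl_n`. -/
theorem rightInvMat_det (n : ℕ) (ξ : sl n) : rightInvMat n ξ (genericMatrix n).det = 0 := by
  rw [derivation_det_left _ _ (constMatrix n ξ), trace_constMatrix, zero_mul]
  intro i j
  exact MvPolynomial.mkDerivation_X _ _ _

theorem restrictSL_derivation (n : ℕ) (d : Derivation ℂ (CoordMat n) (CoordMat n))
    (hd : d (genericMatrix n).det = 0) (x : CoordMat n) (hx : restrictSL n x = 0) :
    restrictSL n (d x) = 0 := by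
  have hx' : x ∈ idealSL n := Ideal.Quotient.eq_zero_iff_mem.mp hx
  obtain ⟨y, rfl⟩ := Ideal.mem_span_singleton'.mp hx'
  refine Ideal.Quotient.eq_zero_iff_mem.mpr ?_
  rw [Derivation.leibniz, map_sub, hd, Derivation.map_one_eq_zero, sub_zero, smul_zero, zero_add,
    smul_eq_mul]
  exact Ideal.mul_mem_right _ _ (Ideal.subset_span rfl)

theorem restrictSL_surjective (n : ℕ) : Function.Surjective (restrictSL n) :=
  Ideal.Quotient.mkₐ_surjective ℂ (idealSL n)

/-- The left-invariant vector field `L_ξ` on `SL_n`, that is, the derivation of `𝒪(SL_n)` induced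
by the left-invariant vector field `L_ξ` on `Mat_n`. -/
def leftInvSL (n : ℕ) : sl n →ₗ[ℂ] Derivation ℂ (CoordSL n) (CoordSL n) where
  toFun ξ := Derivation.liftOfSurjective (restrictSL_surjective n)
    (restrictSL_derivation n (leftInvMat n ξ) (leftInvMat_det n ξ))
  map_add' := by
    intro x y
    apply Derivation.ext
    intro f
    obtain ⟨f, rfl⟩ := restrictSL_surjective n f
    simp
  map_smul' := by
    intro c x
    apply Derivation.ext
    intro f
    obtain ⟨f, rfl⟩ := restrictSL_surjective n f
    simp

/-- The right-invariant vector field `R_ξ` on `SL_n`, that is, the derivation of `𝒪(SL_n)` induced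
by the right-invariant vector field `R_ξ` on `Mat_n`. -/
def rightInvSL (n : ℕ) : sl n →ₗ[ℂ] Derivation ℂ (CoordSL n) (CoordSL n) where
  toFun ξ := Derivation.liftOfSurjective (restrictSL_surjective n)
    (restrictSL_derivation n (rightInvMat n ξ) (rightInvMat_det n ξ))
  map_add' := by
    intro x y
    apply Derivation.ext
    intro f
    obtain ⟨f, rfl⟩ := restrictSL_surjective n f
    simp
  map_smul' := by
    intro c x
    apply Derivation.ext
    intro f
    obtain ⟨f, rfl⟩ := restrictSL_surjective n f
    simp

/-- For a family of derivations `D_ξ` of `A` that is linear in `ξ ∈ sl_n`, and `f, g ∈ A`, the linear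
map `sl_n ⊗ sl_n → A` that sends `ξ ⊗ η` to `D_ξ f * D_η g`. -/
def contraction {n : ℕ} {A : Type*} [CommRing A] [Algebra ℂ A]
    (D : sl n →ₗ[ℂ] Derivation ℂ A A) (f g : A) : sl n ⊗[ℂ] sl n →ₗ[ℂ] A :=
  TensorProduct.lift <| LinearMap.mk₂ ℂ (fun ξ η => D ξ f * D η g)
    (by intro x y z; simp [add_mul]) (by intro c x y; simp)
    (by intro x y z; simp [mul_add]) (by intro c x y; simp)

/-- The Poisson--Lie bracket on `SL_n` defined by `r = ∑ a ⊗ b ∈ sl_n ⊗ sl_n`: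
`{f, g}_r = ∑ (L_a f * L_b g - R_a f * R_b g)`. -/
def bracketSL (n : ℕ) (r : sl n ⊗[ℂ] sl n) (f g : CoordSL n) : CoordSL n :=
  contraction (leftInvSL n) f g r - contraction (rightInvSL n) f g r

/-- The extension of the bracket `{·, ·}_r` from `SL_n` to `Mat_n`, given by the same formula
(the determinant is a Casimir function of it). -/
def bracketMat (n : ℕ) (r : sl n ⊗[ℂ] sl n) (f g : CoordMat n) : CoordMat n :=
  contraction (leftInvMat n) f g r - contraction (rightInvMat n) f g r

/-- A set `S` of functions is log-canonical with respect to the bracket `br` if the bracket of any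
two of its elements is a constant multiple of their product. -/
def IsLogCanonical {A : Type*} [CommRing A] [Algebra ℂ A] (br : A → A → A) (S : Set A) : Prop :=
  ∀ f ∈ S, ∀ g ∈ S, ∃ ω : ℂ, br f g = ω • (f * g)

/-! ### The matrix `U(X, Y)` and the three families of minors -/

section Minors

variable {R : Type*} [CommRing R] {n : ℕ}

/-- The `(n-1) × (n+1)` matrix `𝒳 = [X_{[2,n]} 0]`. -/
def calX (X : Matrix (Fin n) (Fin n) R) : Matrix (Fin (n - 1)) (Fin (n + 1)) R :=
  Matrix.of fun i j => if h : (j : ℕ) < n then X ⟨i + 1, by omega⟩ ⟨j, h⟩ else 0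

/-- The `(n-1) × (n+1)` matrix `𝒴 = [0 Y_{[1,n-1]}]`. -/
def calY (Y : Matrix (Fin n) (Fin n) R) : Matrix (Fin (n - 1)) (Fin (n + 1)) R :=
  Matrix.of fun i j =>
    if h : (j : ℕ) = 0 then 0 else Y ⟨i, by omega⟩ ⟨j - 1, by omega⟩

/-- The number `k = ⌊(n+1)/2⌋` of block rows of `U(X, Y)`. -/
def kOf (n : ℕ) : ℕ := (n + 1) / 2

/-- The number `N = k (n-1)` of rows of `U(X, Y)`. -/
def NOf (n : ℕ) : ℕ := kOf n * (n - 1)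

/-- `M = N` if `n` is even and `M = N - n + 1` if `n` is odd. -/
def MOf (n : ℕ) : ℕ := if Even n then NOf n else NOf n - (n - 1)

/-- The matrix `U(X, Y)` with `k × (k+1)` blocks of size `(n-1) × (n+1)`: the blocks on the diagonal
are `𝒴`, the blocks immediately to the right of the diagonal are `𝒳`, all others are `0`. -/
def blockU (X Y : Matrix (Fin n) (Fin n) R) :
    Matrix (Fin (kOf n) × Fin (n - 1)) (Fin (kOf n + 1) × Fin (n + 1)) R :=
  Matrix.of fun a b =>
    if (b.1 : ℕ) = a.1 then calY Y a.2 b.2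
    else if (b.1 : ℕ) = a.1 + 1 then calX X a.2 b.2
    else 0

/-- The matrix `U(X, Y)` with rows and columns numbered consecutively (from `0`), block after
block. -/
def matU (X Y : Matrix (Fin n) (Fin n) R) :
    Matrix (Fin (NOf n)) (Fin ((kOf n + 1) * (n + 1))) R :=
  (blockU X Y).reindex finProdFinEquiv finProdFinEquiv

/-- The minor of `A` of size `p` in the consecutive rows `a + 1, …, a + p` and the consecutive columns
`b + 1, …, b + p` (in the numbering from `1`). -/
def minor {m l : ℕ} (A : Matrix (Fin m) (Fin l) R) (a b p : ℕ) (ha : a + p ≤ m)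
    (hb : b + p ≤ l) : R :=
  (A.submatrix (fun s : Fin p => (⟨a + s, by omega⟩ : Fin m))
    (fun s : Fin p => (⟨b + s, by omega⟩ : Fin l))).det

theorem NOf_le (n : ℕ) : NOf n ≤ kOf n * (n + 1) :=
  Nat.mul_le_mul_left _ (by omega)

theorem MOf_le (n : ℕ) : MOf n ≤ NOf n := by
  unfold MOf
  split_ifs <;> omega

/-- `θ_i(X)`: the minor of `X` in rows and columns `[n-i+1, n]`. -/
def theta (X : Matrix (Fin n) (Fin n) R) (i : ℕ) (hi : i ≤ n) : R :=
  minor X (n - i) (n - i) i (by omega) (by omega)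

/-- `φ_p(X, Y)`: the minor of `U(X, Y)` in rows `[N-p+1, N]` and columns
`[k(n+1)-p+1, k(n+1)]`. -/
def phi (X Y : Matrix (Fin n) (Fin n) R) (p : ℕ) (hp : p ≤ NOf n) : R :=
  minor (matU X Y) (NOf n - p) (kOf n * (n + 1) - p) p (by omega) (by
    have h1 := NOf_le n
    have h2 : (kOf n + 1) * (n + 1) = kOf n * (n + 1) + (n + 1) := by ring
    omega)

/-- `ψ_q(X, Y)`: the minor of `U(X, Y)` in rows `[N-q+1, N]` and columns
`[k(n+1)-q+2, k(n+1)+1]`. -/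
def psi (X Y : Matrix (Fin n) (Fin n) R) (q : ℕ) (hq : q ≤ NOf n) : R :=
  minor (matU X Y) (NOf n - q) (kOf n * (n + 1) - q + 1) q (by omega) (by
    have h1 := NOf_le n
    have h2 : (kOf n + 1) * (n + 1) = kOf n * (n + 1) + (n + 1) := by ring
    omega)

end Minors

/-- The family of the functions `θ_i(X)`, `i ∈ [n-1]`, `φ_p(X, X)`, `p ∈ [N]`, and `ψ_q(X, X)`,
`q ∈ [M]`, as elements of `𝒪(Mat_n)`. -/
inductive IsMember (n : ℕ) : CoordMat n → Prop
  | theta (i : ℕ) (h1 : 1 ≤ i) (h2 : i ≤ n - 1) :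
      IsMember n (theta (genericMatrix n) i (by omega))
  | phi (p : ℕ) (h1 : 1 ≤ p) (h2 : p ≤ NOf n) :
      IsMember n (phi (genericMatrix n) (genericMatrix n) p h2)
  | psi (q : ℕ) (h1 : 1 ≤ q) (h2 : q ≤ MOf n) :
      IsMember n (psi (genericMatrix n) (genericMatrix n) q (h2.trans (MOf_le n)))

/-- The family of functions above, as a set. -/
def family (n : ℕ) : Set (CoordMat n) := {f | IsMember n f}

end

end CremmerGervais

/-! Let `grad f` be the transposed matrix of partial derivatives. The left fields see only `grad f *
X`, the right fields only `X * grad f`. Since `γ` moves a matrix unit along its diagonal, the root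
part of `r`, completed by a suitable diagonal term, is a bilinear form `cgForm` built from sums of
entries along diagonal rays. The Belavin–Drinfeld conditions make the rest of the Cartan part affine
in each index, so it sees only the traces and index-weighted traces of the gradients. These are
multiples of `f` and `g` by homogeneity (`sum_residue_mem`). The whole computation therefore takes
place modulo `ℂ · f g`.

The gradient of a minor of `U(X, X)` is a sum `PX + PY` of contributions of the blocks `𝒳` and `𝒴`.
Replacing a column of the minor by another of its columns gives zero. Since the columns of `X` sit
one place further right in `𝒴` than in `𝒳`, this says that above the diagonal `PY * X` is minus `PX
* X` shifted by one along the diagonal (`HalfData`). Ray sums then telescope (`raySum_upper`), and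
`cgForm` becomes a trace plus the local expression `reducedForm`. The same holds for rows after
reversing the order of indices, and the two traces cancel by cyclicity (`bracketMat_sub_mem`). For
`θ_i` one may take `PY = 0`, and triangularity finishes the computation
(`bracketMat_mem_of_triangular`).

For two minors of `U`, a difference of two mixed traces and a boundary term remain. To evaluate
them, `U` is regarded as a window of a bi-infinite block Toeplitz matrix, and `U_d` is the window
with columns shifted by `d` blocks. For gradients `G`, `G'` and each `d`, the trace of `G U_d G'
U_{-d}` is expanded over pairs of columns and over pairs of rows, and both expansions are split by
the order of the blocks (`colSum_eq_rowSum`). Summed over `d`, the increasing parts differ by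
exactly the two mixed traces (`sum_colSumLT_sub_rowSumLT`). A shifted column or row is usually again
a column or row of the minor, so the remaining parts vanish or are multiples of `f g`. The only
exception is the first column of the last block, and its contribution cancels the boundary term
(`trace_sub_trace_add_boundaryTerm_mem`). This needs the window of `f` to end no earlier than that
of `g`, which antisymmetry of the bracket allows one to assume. -/

namespace CremmerGervais

noncomputable section

/-! ### The bilinear form of the root part and its symmetries. -/

section CGForm

variable {R : Type*} [CommRing R] {n : ℕ}

/-- The extension of a square matrix by zero to a function on `ℕ × ℕ`. -/
def extend (A : Matrix (Fin n) (Fin n) R) (i j : ℕ) : R :=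
  if h : i < n ∧ j < n then A ⟨i, h.1⟩ ⟨j, h.2⟩ else 0

theorem extend_val (A : Matrix (Fin n) (Fin n) R) (i j : Fin n) :
    extend A (i : ℕ) (j : ℕ) = A i j := by
  simp [extend]

theorem extend_of_le_right (A : Matrix (Fin n) (Fin n) R) {i j : ℕ} (h : n ≤ j) :
    extend A i j = 0 := by
  rw [extend, dif_neg (by omega)]

theorem extend_add (A B : Matrix (Fin n) (Fin n) R) (i j : ℕ) :
    extend (A + B) i j = extend A i j + extend B i j := by
  unfold extend
  split_ifs <;> simp

/-- The sum of the entries of `A` on the diagonal ray starting at `(i, j)`. -/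
def raySum (A : Matrix (Fin n) (Fin n) R) (i j : ℕ) : R :=
  ∑ s ∈ Finset.range n, extend A (i + s) (j + s)

/-- The bilinear form given by the root part of the Cremmer--Gervais R-matrix together with the
form `∑_{l ≤ i} a_ii b_ll` on the diagonal. -/
def cgForm (A B : Matrix (Fin n) (Fin n) R) : R :=
  (∑ k : Fin n, ∑ l : Fin n, if l ≤ k then raySum A l k * B k l else 0) -
    ∑ i : Fin n, ∑ j : Fin n, if j < i then A i j * (raySum B j i - B j i) else 0

theorem sum_ite_eq_extend (A : Matrix (Fin n) (Fin n) R) (p q : ℕ) :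
    ∑ i : Fin n, ∑ j : Fin n, (if (i : ℕ) = p ∧ (j : ℕ) = q then A i j else 0) = extend A p q := by
  by_cases h : p < n ∧ q < n
  · rw [extend, dif_pos h, Finset.sum_eq_single ⟨p, h.1⟩, Finset.sum_eq_single ⟨q, h.2⟩]
    · simp
    · intro b _ hb
      rw [if_neg]
      rintro ⟨-, h2⟩
      exact hb (Fin.ext h2)
    · simp
    · intro b _ hb
      refine Finset.sum_eq_zero fun c _ => if_neg ?_
      rintro ⟨h2, -⟩
      exact hb (Fin.ext h2)
    · simp
  · rw [extend, dif_neg h]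
    refine Finset.sum_eq_zero fun b _ => Finset.sum_eq_zero fun c _ => if_neg ?_
    rintro ⟨h2, h3⟩
    exact h ⟨h2 ▸ b.2, h3 ▸ c.2⟩

theorem raySum_eq (A : Matrix (Fin n) (Fin n) R) (l k : ℕ) :
    raySum A l k =
      ∑ i : Fin n, ∑ j : Fin n, if (i : ℕ) + k = j + l ∧ l ≤ i then A i j else 0 := by
  unfold raySum
  simp_rw [← sum_ite_eq_extend]
  rw [Finset.sum_comm]
  refine Finset.sum_congr rfl fun i _ => ?_
  rw [Finset.sum_comm]
  refine Finset.sum_congr rfl fun j _ => ?_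
  by_cases h : (i : ℕ) + k = j + l ∧ l ≤ i
  · rw [if_pos h, Finset.sum_eq_single ((i : ℕ) - l), if_pos (by omega)]
    · intro b _ hb
      rw [if_neg (by omega)]
    · intro h2
      exact absurd (Finset.mem_range.mpr (by omega)) h2
  · rw [if_neg h]
    exact Finset.sum_eq_zero fun s _ => if_neg (by omega)

theorem sum_comm_pairs {α β γ δ : Type*} [Fintype α] [Fintype β] [Fintype γ] [Fintype δ]
    (G : α → β → γ → δ → R) :
    ∑ i, ∑ j, ∑ k, ∑ l, G i j k l = ∑ k, ∑ l, ∑ i, ∑ j, G i j k l := by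
  calc ∑ i, ∑ j, ∑ k, ∑ l, G i j k l
      = ∑ x : α × β, ∑ y : γ × δ, G x.1 x.2 y.1 y.2 := by
        simp_rw [Fintype.sum_prod_type]
    _ = _ := by
        rw [Finset.sum_comm]
        simp_rw [Fintype.sum_prod_type]

/-- The two factors play visibly different roles in the definition. In this expansion the
coefficient of each monomial `A i j * B k l` is explicit, so symmetries of the form become
statements about inequalities between four indices. -/
theorem cgForm_eq_sum (A B : Matrix (Fin n) (Fin n) R) :
    cgForm A B = ∑ i : Fin n, ∑ j : Fin n, ∑ k : Fin n, ∑ l : Fin n,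
      ((if (i : ℕ) + k = j + l ∧ l ≤ i ∧ l ≤ k then A i j * B k l else 0) -
        if (i : ℕ) + k = j + l ∧ j < i ∧ j < k then A i j * B k l else 0) := by
  unfold cgForm
  simp only [Finset.sum_sub_distrib]
  congr 1
  · have h : ∀ k l : Fin n, (if l ≤ k then raySum A l k * B k l else 0) =
        ∑ i : Fin n, ∑ j : Fin n,
          if (i : ℕ) + k = j + l ∧ l ≤ i ∧ l ≤ k then A i j * B k l else 0 := by
      intro k l
      rw [raySum_eq]
      split_ifs with h
      · simp only [Finset.sum_mul, ite_mul, zero_mul, Fin.le_def] at h ⊢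
        simp only [h, and_true]
      · simp [h]
    simp_rw [h]
    exact sum_comm_pairs _
  · have h : ∀ i j : Fin n, (if j < i then A i j * (raySum B j i - B j i) else 0) =
        ∑ k : Fin n, ∑ l : Fin n,
          if (i : ℕ) + k = j + l ∧ j < i ∧ j < k then A i j * B k l else 0 := by
      intro i j
      have hB : B j i = ∑ k : Fin n, ∑ l : Fin n,
          if (k : ℕ) = j ∧ (l : ℕ) = i then B k l else 0 := by
        rw [sum_ite_eq_extend, extend_val]
      split_ifs with h
      · conv_lhs => rw [hB, raySum_eq, ← Finset.sum_sub_distrib]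
        rw [Finset.mul_sum]
        refine Finset.sum_congr rfl fun k _ => ?_
        rw [← Finset.sum_sub_distrib, Finset.mul_sum]
        refine Finset.sum_congr rfl fun l _ => ?_
        simp only [Fin.lt_def] at h ⊢
        by_cases h1 : (k : ℕ) + i = l + j ∧ j ≤ k
        · rw [if_pos (by omega)]
          -- Subtracting `B j i` removes the starting point of the ray; this is what makes `j < k`
          -- strict.
          by_cases h2 : (k : ℕ) = j ∧ (l : ℕ) = i
          · rw [if_pos h2, if_neg (by omega), sub_self, mul_zero]
          · rw [if_neg h2, if_pos (by omega), sub_zero]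
        · rw [if_neg (by omega), if_neg (by omega), if_neg (by omega), sub_zero, mul_zero]
      · simp [h]
    simp_rw [h]

/-- When `i + k = j + l`, the inequality `l ≤ i` is equivalent to `k ≤ j`, so reversing the indices
and exchanging the factors preserves both coefficients. It allows the results about columns to be
applied to rows. -/
theorem cgForm_rev (A B : Matrix (Fin n) (Fin n) R) :
    cgForm (B.submatrix Fin.rev Fin.rev) (A.submatrix Fin.rev Fin.rev) = cgForm A B := by
  rw [cgForm_eq_sum, cgForm_eq_sum]
  have e : ∀ F : Fin n → R, ∑ i, F i = ∑ i, F (Fin.rev i) := fun F =>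
    (Equiv.sum_comp Fin.revPerm F).symm
  have c : ∀ F : Fin n → Fin n → Fin n → Fin n → R,
      ∑ i, ∑ j, ∑ k, ∑ l, F i j k l = ∑ i, ∑ j, ∑ k, ∑ l, F (Fin.rev k) (Fin.rev l)
        (Fin.rev i) (Fin.rev j) := by
    intro F
    rw [sum_comm_pairs F, e]
    refine Finset.sum_congr rfl fun i _ => ?_
    rw [e]
    refine Finset.sum_congr rfl fun j _ => ?_
    rw [e]
    refine Finset.sum_congr rfl fun k _ => ?_
    rw [e]
  rw [c]
  refine Finset.sum_congr rfl fun i _ => Finset.sum_congr rfl fun j _ =>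
    Finset.sum_congr rfl fun k _ => Finset.sum_congr rfl fun l _ => ?_
  simp only [Matrix.submatrix_apply, Fin.rev_rev, Fin.val_rev, Fin.le_def, Fin.lt_def]
  rw [mul_comm (B k l)]
  have hi := i.2
  have hj := j.2
  have hk := k.2
  have hl := l.2
  congr 1
  · exact if_congr (by omega) rfl rfl
  · exact if_congr (by omega) rfl rfl

/-- In the sum of the two coefficients only `l = min i k` and `j = min i k` survive. Together with
`i + k = j + l` this forces `{j, l} = {i, k}`, and the two possible matchings are the two trace
terms. -/
theorem cgForm_add_swap (A B : Matrix (Fin n) (Fin n) R) :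
    cgForm A B + cgForm B A = (A * B).trace + A.trace * B.trace := by
  have e1 : (A * B).trace = ∑ i : Fin n, ∑ j : Fin n, ∑ k : Fin n, ∑ l : Fin n,
      if l = i ∧ k = j then A i j * B k l else 0 := by
    simp [Matrix.trace, Matrix.mul_apply, ite_and]
  have e2 : A.trace * B.trace = ∑ i : Fin n, ∑ j : Fin n, ∑ k : Fin n, ∑ l : Fin n,
      if j = i ∧ l = k then A i j * B k l else 0 := by
    simp [Matrix.trace, Finset.sum_mul_sum, ite_and]
  rw [e1, e2, cgForm_eq_sum, cgForm_eq_sum, sum_comm_pairs (fun i j k l : Fin n =>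
    ((if (i : ℕ) + k = j + l ∧ l ≤ i ∧ l ≤ k then B i j * A k l else 0) - _))]
  simp only [← Finset.sum_add_distrib]
  refine Finset.sum_congr rfl fun i _ => Finset.sum_congr rfl fun j _ =>
    Finset.sum_congr rfl fun k _ => Finset.sum_congr rfl fun l _ => ?_
  simp only [Fin.lt_def, Fin.le_def, Fin.ext_iff, mul_comm (B k l)]
  by_cases h : (i : ℕ) + k = j + l
  · rcases lt_trichotomy (l : ℕ) i with h1 | h1 | h1 <;>
      rcases lt_trichotomy (l : ℕ) k with h2 | h2 | h2 <;>
      split_ifs <;> first | omega | ring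
  · rw [if_neg (by omega), if_neg (by omega), if_neg (by omega), if_neg (by omega),
      if_neg (by omega), if_neg (by omega)]
    ring

end CGForm

/-! ### Telescoping of ray sums for gradients of invariant functions. -/

section HalfData

variable {R : Type*} [CommRing R] [Algebra ℂ R] {n : ℕ}

/-- The relations between the parts `Z`, `Y` of a gradient `Z + Y` of `f` that follow from the
invariance of `f` under the unipotent subgroup of column operations. -/
structure HalfData (f : R) (Z Y : Matrix (Fin n) (Fin n) R) (μ : ℕ → ℂ) : Prop where
  upper : ∀ i j : Fin n, i < j → Y i j = -extend Z (i + 1) (j + 1)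
  diag : ∀ i : Fin n, Y i i = μ i • f - extend Z (i + 1) (i + 1)
  corner : ∃ ζ : ℂ, extend Z 0 0 = ζ • f
  trace : ∃ τ : ℂ, Z.trace = τ • f

namespace HalfData

variable {f g : R} {Z Y Z' Y' : Matrix (Fin n) (Fin n) R} {μ μ' : ℕ → ℂ}

theorem extend_upper (h : HalfData f Z Y μ) {i j : ℕ} (hij : i < j) :
    extend Y i j = -extend Z (i + 1) (j + 1) := by
  by_cases hj : j < n
  · exact (extend_val Y ⟨i, by omega⟩ ⟨j, hj⟩).trans (h.upper ⟨i, by omega⟩ ⟨j, hj⟩ hij)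
  · rw [extend_of_le_right _ (by omega), extend_of_le_right _ (by omega), neg_zero]

theorem extend_diag (h : HalfData f Z Y μ) {i : ℕ} (hi : i < n) :
    extend Y i i = μ i • f - extend Z (i + 1) (i + 1) :=
  (extend_val Y ⟨i, hi⟩ ⟨i, hi⟩).trans (h.diag ⟨i, hi⟩)

/-- By `upper`, the entries of `Z + Y` on the ray are consecutive differences of entries of `Z`, and
`Z` is extended by zero beyond the end of the ray. -/
theorem raySum_upper (h : HalfData f Z Y μ) {i j : ℕ} (hij : i < j) :
    raySum (Z + Y) i j = extend Z i j := by
  have e : ∀ s, extend (Z + Y) (i + s) (j + s) =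
      extend Z (i + s) (j + s) - extend Z (i + (s + 1)) (j + (s + 1)) := by
    intro s
    rw [extend_add, h.extend_upper (by omega), ← sub_eq_add_neg]
    rfl
  unfold raySum
  simp_rw [e]
  rw [Finset.sum_range_sub' (fun s => extend Z (i + s) (j + s)),
    extend_of_le_right Z (j := j + n) (by omega)]
  simp

/-- The sums of `μ` over the tails of `[0, n)`. -/
def tail (n : ℕ) (μ : ℕ → ℂ) (i : ℕ) : ℂ := ∑ s ∈ Finset.range (n - i), μ (i + s)

theorem tail_eq {i : ℕ} (hi : i < n) (μ : ℕ → ℂ) : tail n μ i = μ i + tail n μ (i + 1) := by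
  unfold tail
  obtain ⟨d, rfl⟩ : ∃ d, n = i + 1 + d := ⟨n - (i + 1), by omega⟩
  rw [show i + 1 + d - i = d + 1 by omega, show i + 1 + d - (i + 1) = d by omega,
    Finset.sum_range_succ', add_comm]
  simp [add_comm, add_left_comm]

theorem raySum_diag (h : HalfData f Z Y μ) {i : ℕ} (hi : i ≤ n) :
    raySum (Z + Y) i i = extend Z i i + tail n μ i • f := by
  unfold raySum tail
  have h1 : ∑ s ∈ Finset.range n, extend (Z + Y) (i + s) (i + s) =
      ∑ s ∈ Finset.range (n - i), extend (Z + Y) (i + s) (i + s) := by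
    symm
    refine Finset.sum_subset (Finset.range_mono (by omega)) fun s _ hs => ?_
    exact extend_of_le_right _ (by simp at hs; omega)
  have e : ∀ s ∈ Finset.range (n - i), extend (Z + Y) (i + s) (i + s) =
      (extend Z (i + s) (i + s) - extend Z (i + (s + 1)) (i + (s + 1))) + μ (i + s) • f := by
    intro s hs
    rw [Finset.mem_range] at hs
    rw [extend_add, h.extend_diag (by omega)]
    simp only [add_assoc]
    ring
  rw [h1, Finset.sum_congr rfl e, Finset.sum_add_distrib,
    Finset.sum_range_sub' (fun s => extend Z (i + s) (i + s)),
    extend_of_le_right Z (j := i + (n - i)) (by omega), Finset.sum_smul]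
  simp

/-- The value of `cgForm` on gradients that satisfy the relations `HalfData`, up to a multiple of
the product of the functions and a trace. -/
def reducedForm (f : R) (Z Y Z' Y' : Matrix (Fin n) (Fin n) R) (μ : ℕ → ℂ) : R :=
  (∑ i, ∑ j, if i ≤ j then Z i j * Z' j i else 0) +
    (∑ i, ∑ j, if j < i then Y i j * Y' j i else 0) -
    f * ∑ i : Fin n, μ i • extend Z' (i + 1) (i + 1)

/-- Every ray sum in `cgForm` starts on or above the diagonal, so it collapses to one entry of `Z`
or `Z'`. On the diagonal a multiple of `f` is left over, with the tails of `μ` as coefficients. -/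
theorem cgForm_sub_mem (h : HalfData f Z Y μ) (h' : HalfData g Z' Y' μ') :
    cgForm (Z + Y) (Z' + Y') - ((Z * Y').trace + reducedForm f Z Y Z' Y' μ) ∈
      Submodule.span ℂ {f * g} := by
  have e1 : (∑ k : Fin n, ∑ l : Fin n,
      if l ≤ k then raySum (Z + Y) l k * (Z' + Y') k l else 0) =
      (∑ k : Fin n, ∑ l : Fin n, if l ≤ k then Z l k * (Z' + Y') k l else 0) +
        f * ∑ k : Fin n, tail n μ k • (Z' + Y') k k := by
    rw [Finset.mul_sum, ← Finset.sum_add_distrib]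
    refine Finset.sum_congr rfl fun k _ => ?_
    have : f * tail n μ k • (Z' + Y') k k =
        ∑ l : Fin n, if l = k then f * tail n μ k • (Z' + Y') k k else 0 := by simp
    rw [this, ← Finset.sum_add_distrib]
    refine Finset.sum_congr rfl fun l _ => ?_
    rcases lt_trichotomy l k with hl | hl | hl
    · rw [if_pos hl.le, if_pos hl.le, if_neg hl.ne, h.raySum_upper hl, extend_val, add_zero]
    · subst hl
      rw [if_pos le_rfl, if_pos le_rfl, if_pos rfl, h.raySum_diag l.2.le, extend_val]
      simp only [Algebra.smul_def]
      ring
    · rw [if_neg hl.not_ge, if_neg hl.not_ge, if_neg hl.ne', add_zero]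
  have e2 : (∑ i : Fin n, ∑ j : Fin n,
      if j < i then (Z + Y) i j * (raySum (Z' + Y') j i - (Z' + Y') j i) else 0) =
      -∑ i : Fin n, ∑ j : Fin n, if j < i then (Z + Y) i j * Y' j i else 0 := by
    rw [← Finset.sum_neg_distrib]
    refine Finset.sum_congr rfl fun i _ => ?_
    rw [← Finset.sum_neg_distrib]
    refine Finset.sum_congr rfl fun j _ => ?_
    split_ifs with hj
    · rw [h'.raySum_upper hj, extend_val, Matrix.add_apply Z' Y']
      ring
    · simp
  have e3 : (∑ k : Fin n, ∑ l : Fin n, if l ≤ k then Z l k * (Z' + Y') k l else 0) +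
      (∑ i : Fin n, ∑ j : Fin n, if j < i then (Z + Y) i j * Y' j i else 0) =
      (Z * Y').trace + (∑ i, ∑ j, if i ≤ j then Z i j * Z' j i else 0) +
        (∑ i, ∑ j, if j < i then Y i j * Y' j i else 0) := by
    rw [Finset.sum_comm]
    simp only [Matrix.trace, Matrix.diag, Matrix.mul_apply, ← Finset.sum_add_distrib]
    refine Finset.sum_congr rfl fun i _ => Finset.sum_congr rfl fun j _ => ?_
    rcases le_or_gt i j with hij | hij
    · simp only [if_pos hij, if_neg hij.not_gt, Matrix.add_apply]
      ring
    · simp only [if_neg hij.not_ge, if_pos hij, Matrix.add_apply]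
      ring
  -- Summation by parts against the tails of `μ`: the telescoping sum leaves only the corner of
  -- `Z'`, which is a multiple of `g`.
  have e4 : ∑ k : Fin n, tail n μ k • (Z' + Y') k k +
      ∑ i : Fin n, μ i • extend Z' (i + 1) (i + 1) =
      tail n μ 0 • extend Z' 0 0 + (∑ k : Fin n, tail n μ k * μ' k) • g := by
    have : ∀ k : Fin n, tail n μ k • (Z' + Y') k k + μ k • extend Z' (k + 1) (k + 1) =
        (tail n μ k • extend Z' k k - tail n μ (k + 1) • extend Z' (k + 1) (k + 1)) +
          (tail n μ k * μ' k) • g := by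
      intro k
      rw [Matrix.add_apply, h'.diag, extend_val, tail_eq k.2, smul_add, smul_sub, smul_smul,
        add_smul, add_smul]
      simp only [add_mul, add_smul]
      abel
    rw [← Finset.sum_add_distrib, Finset.sum_congr rfl fun k _ => this k, Finset.sum_add_distrib,
      Finset.sum_smul, Fin.sum_univ_eq_sum_range
        (fun k => tail n μ k • extend Z' k k - tail n μ (k + 1) • extend Z' (k + 1) (k + 1)),
      Finset.sum_range_sub' (fun k => tail n μ k • extend Z' k k), extend_of_le_right Z' le_rfl]
    simp
  obtain ⟨ζ, hζ⟩ := h'.corner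
  have e5 : cgForm (Z + Y) (Z' + Y') - ((Z * Y').trace + reducedForm f Z Y Z' Y' μ) =
      (tail n μ 0 * ζ + ∑ k : Fin n, tail n μ k * μ' k) • (f * g) := by
    have e6 : cgForm (Z + Y) (Z' + Y') - ((Z * Y').trace + reducedForm f Z Y Z' Y' μ) =
        f * (∑ k : Fin n, tail n μ k • (Z' + Y') k k +
          ∑ i : Fin n, μ i • extend Z' (i + 1) (i + 1)) := by
      unfold cgForm reducedForm
      rw [e1, e2]
      linear_combination e3
    rw [e6, e4, hζ]
    simp only [Algebra.smul_def, map_add, map_mul]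
    ring
  rw [e5]
  exact Submodule.smul_mem _ _ (Submodule.mem_span_singleton_self _)

theorem sum_diag (h : HalfData f Z Y μ) : ∃ c : ℂ, (Z + Y).trace = c • f := by
  obtain ⟨ζ, hζ⟩ := h.corner
  refine ⟨ζ + ∑ i : Fin n, μ i, ?_⟩
  have : ∀ i : Fin n, (Z + Y) i i = (extend Z i i - extend Z (i + 1) (i + 1)) + μ i • f := by
    intro i
    rw [Matrix.add_apply, h.diag, extend_val]
    ring
  rw [Matrix.trace, Finset.sum_congr rfl fun i _ => (Matrix.diag_apply _ i).trans (this i),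
    Finset.sum_add_distrib,
    Fin.sum_univ_eq_sum_range (fun i => extend Z i i - extend Z (i + 1) (i + 1)),
    Finset.sum_range_sub' (fun i => extend Z i i), extend_of_le_right Z le_rfl, hζ, add_smul,
    Finset.sum_smul, sub_zero]

/-- Summation by parts converts the weights `i` into the trace of `Z`, up to the corner entry; this
is the purpose of the field `trace`. -/
theorem sum_weighted_diag (h : HalfData f Z Y μ) :
    ∃ c : ℂ, ∑ i : Fin n, (i : ℂ) • (Z + Y) i i = c • f := by
  obtain ⟨ζ, hζ⟩ := h.corner
  obtain ⟨τ, hτ⟩ := h.trace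
  have : ∀ i : Fin n, (i : ℂ) • (Z + Y) i i =
      (((i : ℕ) : ℂ) • extend Z i i - ((i + 1 : ℕ) : ℂ) • extend Z (i + 1) (i + 1)) +
        (extend Z (i + 1) (i + 1) - extend Z i i) + Z i i + ((i : ℂ) * μ i) • f := by
    intro i
    rw [Matrix.add_apply, h.diag, extend_val, Nat.cast_add, Nat.cast_one, smul_add, smul_sub,
      smul_smul, add_smul, one_smul]
    ring
  refine ⟨-ζ + τ + ∑ i : Fin n, (i : ℂ) * μ i, ?_⟩
  rw [Finset.sum_congr rfl fun i _ => this i]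
  simp only [Finset.sum_add_distrib]
  rw [Fin.sum_univ_eq_sum_range (fun i => (((i : ℕ) : ℂ) • extend Z i i -
      ((i + 1 : ℕ) : ℂ) • extend Z (i + 1) (i + 1))),
    Finset.sum_range_sub' (fun i => ((i : ℕ) : ℂ) • extend Z i i),
    Fin.sum_univ_eq_sum_range (fun i => extend Z (i + 1) (i + 1) - extend Z i i),
    Finset.sum_range_sub (fun i => extend Z i i), extend_of_le_right Z le_rfl, hζ, add_smul,
    add_smul, Finset.sum_smul]
  rw [show ∑ i, Z i i = τ • f from hτ]
  simp

end HalfData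

end HalfData

/-! ### The Cartan part, and contraction with an R-matrix. -/

section Contraction

variable {n : ℕ}

/-- The diagonal entry `h ↦ h_ii` as a functional on the Cartan subalgebra. -/
def diagEntry (n : ℕ) (i : Fin n) : cartan n →ₗ[ℂ] ℂ where
  toFun h := h.val.val i i
  map_add' _ _ := rfl
  map_smul' _ _ := rfl

theorem diagEntry_apply (i : Fin n) (h : cartan n) : diagEntry n i h = h.val.val i i := rfl

theorem diagEntry_diagElt (hn : n ≠ 0) (i j : Fin n) :
    diagEntry n j (diagElt n hn i) = (if j = i then 1 else 0) - (n : ℂ)⁻¹ := by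
  simp [diagEntry_apply, diagElt]

/-- The coefficient of `E_ii ⊗ E_jj` in an element of `𝔥 ⊗ 𝔥`. -/
def cartanCoeff (n : ℕ) (i j : Fin n) : cartan n ⊗[ℂ] cartan n →ₗ[ℂ] ℂ :=
  TensorProduct.lid ℂ ℂ ∘ₗ TensorProduct.map (diagEntry n i) (diagEntry n j)

theorem cartanCoeff_tmul (i j : Fin n) (x y : cartan n) :
    cartanCoeff n i j (x ⊗ₜ y) = diagEntry n i x * diagEntry n j y := by
  simp [cartanCoeff]

theorem lid_map_simpleRoot_left (a : ℕ) (ha : a + 1 < n) (j : Fin n)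
    (x : cartan n ⊗[ℂ] cartan n) :
    diagEntry n j (TensorProduct.lid ℂ (cartan n) ((simpleRoot n a ha).rTensor (cartan n) x)) =
      cartanCoeff n ⟨a, by omega⟩ j x - cartanCoeff n ⟨a + 1, ha⟩ j x := by
  induction x using TensorProduct.induction_on with
  | zero => simp
  | tmul a b => simp [cartanCoeff_tmul, simpleRoot, diagEntry_apply, sub_mul]
  | add a b ha hb =>
    simp only [map_add, ha, hb]
    ring

theorem rid_map_simpleRoot_right (a : ℕ) (ha : a + 1 < n) (j : Fin n)
    (x : cartan n ⊗[ℂ] cartan n) :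
    diagEntry n j (TensorProduct.rid ℂ (cartan n) ((simpleRoot n a ha).lTensor (cartan n) x)) =
      cartanCoeff n j ⟨a, by omega⟩ x - cartanCoeff n j ⟨a + 1, ha⟩ x := by
  induction x using TensorProduct.induction_on with
  | zero => simp
  | tmul a b =>
    simp [cartanCoeff_tmul, simpleRoot, diagEntry_apply]
    ring
  | add a b ha hb =>
    simp only [map_add, ha, hb]
    ring

theorem lid_map_cartanPairing (hn : n ≠ 0) (i j : Fin n) (x : cartan n ⊗[ℂ] cartan n) :
    diagEntry n j (TensorProduct.lid ℂ (cartan n)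
      ((cartanPairing n (diagElt n hn i)).rTensor (cartan n) x)) = cartanCoeff n i j x := by
  induction x using TensorProduct.induction_on with
  | zero => simp
  | tmul a b =>
    have h : cartanPairing n (diagElt n hn i) a = cartanPairing n a (diagElt n hn i) :=
      Matrix.trace_mul_comm (diagElt n hn i).val.val a.val.val
    rw [cartanCoeff_tmul, LinearMap.rTensor_tmul, TensorProduct.lid_tmul, h,
      cartanPairing_diagElt, map_smul]
    rfl
  | add a b ha hb => simp only [map_add, ha, hb]

theorem cartanCoeff_comm (i j : Fin n) (x : cartan n ⊗[ℂ] cartan n) :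
    cartanCoeff n i j (TensorProduct.comm ℂ _ _ x) = cartanCoeff n j i x := by
  induction x using TensorProduct.induction_on with
  | zero => simp
  | tmul a b => simp [cartanCoeff_tmul, mul_comm]
  | add a b ha hb => simp only [map_add, ha, hb]

/-- The difference between the coefficients of the Cartan part and those of the form that enters
`cgForm`. -/
def residue (n : ℕ) (r₀ : cartan n ⊗[ℂ] cartan n) (i j : Fin n) : ℂ :=
  cartanCoeff n i j r₀ - if j ≤ i then 1 else 0

theorem residue_add_swap (hn : n ≠ 0) {r₀ : cartan n ⊗[ℂ] cartan n} (h : IsCartanPart n r₀)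
    (i j : Fin n) : residue n r₀ i j + residue n r₀ j i = -(n : ℂ)⁻¹ - 1 := by
  have h1 := congrArg (diagEntry n j) (h.symm_eq (diagElt n hn i))
  rw [lid_map_cartanPairing, map_add, cartanCoeff_comm, diagEntry_diagElt] at h1
  unfold residue
  rcases lt_trichotomy i j with hij | hij | hij
  · rw [if_neg hij.ne'] at h1
    rw [if_neg hij.not_ge, if_pos hij.le]
    linear_combination h1
  · subst hij
    rw [if_pos rfl] at h1
    rw [if_pos le_rfl]
    linear_combination h1
  · rw [if_neg hij.ne] at h1
    rw [if_neg hij.not_ge, if_pos hij.le]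
    linear_combination h1

/-- The condition for `γ` compares a first difference in the left index with one in the right index.
`residue_add_swap` moves the latter to the left index, and the jumps of the subtracted indicator of
`j ≤ i` cancel. -/
theorem residue_second_difference (hn : n ≠ 0) {r₀ : cartan n ⊗[ℂ] cartan n}
    (h : IsCartanPart n r₀) (a : ℕ) (ha : a + 1 + 1 < n) (j : Fin n) :
    residue n r₀ ⟨a + 1 + 1, ha⟩ j - residue n r₀ ⟨a + 1, by omega⟩ j =
      residue n r₀ ⟨a + 1, by omega⟩ j - residue n r₀ ⟨a, by omega⟩ j := by
  have h1 := congrArg (diagEntry n j) (h.gamma_eq a ha)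
  rw [map_add, lid_map_simpleRoot_left, rid_map_simpleRoot_right, map_zero] at h1
  have h2 := residue_add_swap hn h ⟨a + 1, by omega⟩ j
  have h3 := residue_add_swap hn h ⟨a + 1 + 1, ha⟩ j
  have h4 : (if j ≤ ⟨a, by omega⟩ then (1 : ℂ) else 0) - (if j ≤ ⟨a + 1, by omega⟩ then 1 else 0) +
      ((if ⟨a + 1, by omega⟩ ≤ j then 1 else 0) - if ⟨a + 1 + 1, ha⟩ ≤ j then 1 else 0) = 0 := by
    simp only [Fin.le_def]
    rcases lt_trichotomy (j : ℕ) (a + 1) with h | h | h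
    · rw [if_pos (by omega), if_pos (by omega), if_neg (by omega), if_neg (by omega)]
      ring
    · rw [if_neg (by omega), if_pos (by omega), if_pos (by omega), if_neg (by omega)]
      ring
    · rw [if_neg (by omega), if_neg (by omega), if_pos (by omega), if_pos (by omega)]
      ring
  simp only [residue] at h2 h3 ⊢
  linear_combination h3 - h2 + h1 - h4

theorem residue_affine_left (hn : 2 ≤ n) {r₀ : cartan n ⊗[ℂ] cartan n} (h : IsCartanPart n r₀)
    (i j : Fin n) : residue n r₀ i j = residue n r₀ ⟨0, by omega⟩ j +
      (i : ℂ) * (residue n r₀ ⟨1, by omega⟩ j - residue n r₀ ⟨0, by omega⟩ j) := by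
  have step : ∀ a : ℕ, ∀ ha : a + 1 < n,
      residue n r₀ ⟨a + 1, ha⟩ j - residue n r₀ ⟨a, by omega⟩ j =
        residue n r₀ ⟨1, by omega⟩ j - residue n r₀ ⟨0, by omega⟩ j := by
    intro a
    induction a with
    | zero => intro _; rfl
    | succ a ih =>
      intro ha
      rw [residue_second_difference (by omega) h a ha j]
      exact ih (by omega)
  obtain ⟨i, hi⟩ := i
  induction i with
  | zero => simp
  | succ a ih =>
    have h1 := step a hi
    have h2 := ih (by omega)
    push_cast
    simp only at h2
    linear_combination h1 + h2

theorem residue_affine_right (hn : 2 ≤ n) {r₀ : cartan n ⊗[ℂ] cartan n} (h : IsCartanPart n r₀)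
    (i j : Fin n) : residue n r₀ i j = residue n r₀ i ⟨0, by omega⟩ +
      (j : ℂ) * (residue n r₀ i ⟨1, by omega⟩ - residue n r₀ i ⟨0, by omega⟩) := by
  have h0 := residue_affine_left hn h j i
  have h1 := residue_add_swap (by omega) h i j
  have h2 := residue_add_swap (by omega) h i ⟨0, by omega⟩
  have h3 := residue_add_swap (by omega) h i ⟨1, by omega⟩
  linear_combination h1 - h0 - h2 - (j : ℂ) * (h3 - h2)

variable {A : Type*} [CommRing A] [Algebra ℂ A] {D : sl n →ₗ[ℂ] Derivation ℂ A A} {f g : A}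
  {P Q : Matrix (Fin n) (Fin n) A}

theorem contraction_tmul (D : sl n →ₗ[ℂ] Derivation ℂ A A) (f g : A) (ξ η : sl n) :
    contraction D f g (ξ ⊗ₜ η) = D ξ f * D η g := by
  simp [contraction]

theorem apply_rootVector (hP : ∀ ξ : sl n, D ξ f = ∑ i, ∑ j, ξ.val i j • P j i) {i j : Fin n}
    (h : i ≠ j) : D (rootVector n i j) f = P j i := by
  rw [hP, rootVector, dif_neg h]
  simp only [LieAlgebra.SpecialLinear.val_single, Matrix.single_apply]
  rw [Finset.sum_eq_single i, Finset.sum_eq_single j]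
  · simp
  · intro b _ hb
    rw [if_neg (by tauto), zero_smul]
  · simp
  · intro b _ hb
    refine Finset.sum_eq_zero fun c _ => ?_
    rw [if_neg (by tauto), zero_smul]
  · simp

theorem apply_cartan (hP : ∀ ξ : sl n, D ξ f = ∑ i, ∑ j, ξ.val i j • P j i) (h : cartan n) :
    D h.val f = ∑ i, diagEntry n i h • P i i := by
  rw [hP]
  refine Finset.sum_congr rfl fun i _ => ?_
  rw [Finset.sum_eq_single i]
  · rfl
  · intro b _ hb
    rw [h.property i b hb.symm, zero_smul]
  · simp

theorem contraction_cartan (hP : ∀ ξ : sl n, D ξ f = ∑ i, ∑ j, ξ.val i j • P j i)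
    (hQ : ∀ ξ : sl n, D ξ g = ∑ i, ∑ j, ξ.val i j • Q j i) (x : cartan n ⊗[ℂ] cartan n) :
    contraction D f g (TensorProduct.map (cartan n).subtype (cartan n).subtype x) =
      ∑ i, ∑ j, cartanCoeff n i j x • (P i i * Q j j) := by
  induction x using TensorProduct.induction_on with
  | zero => simp
  | tmul a b =>
    rw [TensorProduct.map_tmul, contraction_tmul, Submodule.subtype_apply, Submodule.subtype_apply,
      apply_cartan hP, apply_cartan hQ, Finset.sum_mul_sum]
    simp only [cartanCoeff_tmul, smul_mul_smul_comm]
  | add a b ha hb => simp only [map_add, ha, hb, add_smul, Finset.sum_add_distrib]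

/-- The first family of quadruples in `cgForm_eq_sum` splits into three: `l = k` (so `i = j`) is the
diagonal sum, `l = i` (so `j = k`) gives `e_{-α} ⊗ e_α`, and the rest gives `e_{-α} ⊗ e_β` with `α =
(i, j)`, `β = (l, k)` and `β = γ^(i-l) α`. The second family gives the terms `e_β ⊗ e_{-α}`. -/
theorem contraction_rootPart (hP : ∀ ξ : sl n, D ξ f = ∑ i, ∑ j, ξ.val i j • P j i)
    (hQ : ∀ ξ : sl n, D ξ g = ∑ i, ∑ j, ξ.val i j • Q j i) :
    contraction D f g (rootPart n) + ∑ i, ∑ j, (if j ≤ i then P i i * Q j j else 0) =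
      cgForm P Q := by
  classical
  have h1 : ∀ α ∈ posRoots n,
      contraction D f g (rootVector n α.2 α.1 ⊗ₜ[ℂ] rootVector n α.1 α.2) =
        P α.1 α.2 * Q α.2 α.1 := by
    intro α hα
    have hα : α.1 < α.2 := (Finset.mem_filter.mp hα).2
    rw [contraction_tmul, apply_rootVector hP hα.ne', apply_rootVector hQ hα.ne]
  have h2 : ∀ α ∈ posRoots n, ∀ β ∈ (posRoots n).filter (fun β => RootPrec α β),
      contraction D f g (rootVector n α.2 α.1 ⊗ₜ[ℂ] rootVector n β.1 β.2 -
        rootVector n β.1 β.2 ⊗ₜ[ℂ] rootVector n α.2 α.1) =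
      P α.1 α.2 * Q β.2 β.1 - P β.2 β.1 * Q α.1 α.2 := by
    intro α hα β hβ
    have hα : α.1 < α.2 := (Finset.mem_filter.mp hα).2
    have hβ : β.1 < β.2 := (Finset.mem_filter.mp (Finset.mem_filter.mp hβ).1).2
    rw [map_sub, contraction_tmul, contraction_tmul, apply_rootVector hP hα.ne',
      apply_rootVector hQ hβ.ne, apply_rootVector hP hβ.ne, apply_rootVector hQ hα.ne']
  have h3 : ∀ α β : Fin n × Fin n, RootPrec α β ↔
      (β.1 : ℕ) < α.1 ∧ (α.1 : ℕ) + β.2 = α.2 + β.1 := by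
    intro α β
    constructor
    · rintro ⟨m, hm⟩
      omega
    · intro h
      exact ⟨α.1 - β.1, by omega, by omega, by omega⟩
  have e : contraction D f g (rootPart n) =
      (∑ α ∈ posRoots n, P α.1 α.2 * Q α.2 α.1) +
        ∑ α ∈ posRoots n, ∑ β ∈ (posRoots n).filter (fun β => RootPrec α β),
          (P α.1 α.2 * Q β.2 β.1 - P β.2 β.1 * Q α.1 α.2) := by
    unfold rootPart
    rw [map_add, map_sum, map_sum]
    congr 1
    · exact Finset.sum_congr rfl h1
    · refine Finset.sum_congr rfl fun α hα => ?_
      rw [map_sum]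
      refine Finset.sum_congr ?_ fun β hβ => ?_
      · exact Finset.filter_congr_decidable _ _ _
      · exact h2 α hα β (by convert hβ)
  rw [e, cgForm_eq_sum]
  simp only [Finset.sum_sub_distrib]
  have e1 : ∑ α ∈ posRoots n, P α.1 α.2 * Q α.2 α.1 =
      ∑ i : Fin n, ∑ j : Fin n, ∑ k : Fin n, ∑ l : Fin n,
        if i < j ∧ k = j ∧ l = i then P i j * Q k l else 0 := by
    rw [posRoots, Finset.sum_filter, Fintype.sum_prod_type]
    refine Finset.sum_congr rfl fun i _ => Finset.sum_congr rfl fun j _ => ?_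
    simp [ite_and]
  have e2 : ∑ α ∈ posRoots n, ∑ β ∈ (posRoots n).filter (fun β => RootPrec α β),
      P α.1 α.2 * Q β.2 β.1 = ∑ i : Fin n, ∑ j : Fin n, ∑ k : Fin n, ∑ l : Fin n,
        if i < j ∧ l < k ∧ l < i ∧ (i : ℕ) + k = j + l then P i j * Q k l else 0 := by
    simp only [posRoots, Finset.sum_filter, Fintype.sum_prod_type, h3]
    refine Finset.sum_congr rfl fun i _ => Finset.sum_congr rfl fun j _ => ?_
    split_ifs with h
    · rw [Finset.sum_comm]
      refine Finset.sum_congr rfl fun k _ => Finset.sum_congr rfl fun l _ => ?_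
      simp only [Fin.lt_def] at h ⊢
      simp only [h, true_and, ← ite_and]
    · simp [h]
  have e3 : ∑ α ∈ posRoots n, ∑ β ∈ (posRoots n).filter (fun β => RootPrec α β),
      P β.2 β.1 * Q α.1 α.2 = ∑ i : Fin n, ∑ j : Fin n, ∑ k : Fin n, ∑ l : Fin n,
        if (i : ℕ) + k = j + l ∧ j < i ∧ j < k then P i j * Q k l else 0 := by
    simp only [posRoots, Finset.sum_filter, Fintype.sum_prod_type, h3]
    rw [sum_comm_pairs]
    refine Finset.sum_congr rfl fun k _ => Finset.sum_congr rfl fun l _ => ?_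
    split_ifs with h
    · rw [Finset.sum_comm]
      refine Finset.sum_congr rfl fun i _ => Finset.sum_congr rfl fun j _ => ?_
      simp only [Fin.lt_def, ← ite_and] at h ⊢
      exact if_congr (by omega) rfl rfl
    · symm
      refine Finset.sum_eq_zero fun i _ => Finset.sum_eq_zero fun j _ => ?_
      simp only [Fin.lt_def] at h ⊢
      exact if_neg (by omega)
  have e4 : ∑ i, ∑ j, (if j ≤ i then P i i * Q j j else 0) =
      ∑ i : Fin n, ∑ j : Fin n, ∑ k : Fin n, ∑ l : Fin n,
        if j = i ∧ l = k ∧ k ≤ i then P i j * Q k l else 0 := by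
    refine Finset.sum_congr rfl fun i _ => ?_
    simp [ite_and]
  rw [e1, e2, e3, e4, add_sub_assoc', sub_add_eq_add_sub]
  congr 1
  simp only [← Finset.sum_add_distrib]
  refine Finset.sum_congr rfl fun i _ => Finset.sum_congr rfl fun j _ =>
    Finset.sum_congr rfl fun k _ => Finset.sum_congr rfl fun l _ => ?_
  simp only [Fin.lt_def, Fin.le_def, Fin.ext_iff]
  by_cases h : (i : ℕ) + k = j + l ∧ (l : ℕ) ≤ i ∧ (l : ℕ) ≤ k
  · rw [if_pos h]
    by_cases h5 : (l : ℕ) = k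
    · rw [if_neg (by omega), if_neg (by omega), if_pos (by omega), zero_add, zero_add]
    · by_cases h6 : (l : ℕ) = i
      · rw [if_pos (by omega), if_neg (by omega), if_neg (by omega), add_zero, add_zero]
      · rw [if_neg (by omega), if_pos (by omega), if_neg (by omega), add_zero, zero_add]
  · rw [if_neg h, if_neg (by omega), if_neg (by omega), if_neg (by omega), add_zero, add_zero]

/-- The contraction with an R-matrix in terms of the form `cgForm`. -/
theorem contraction_rMatrix (hP : ∀ ξ : sl n, D ξ f = ∑ i, ∑ j, ξ.val i j • P j i)
    (hQ : ∀ ξ : sl n, D ξ g = ∑ i, ∑ j, ξ.val i j • Q j i) (r₀ : cartan n ⊗[ℂ] cartan n) :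
    contraction D f g
        (TensorProduct.map (cartan n).subtype (cartan n).subtype r₀ + rootPart n) =
      cgForm P Q + ∑ i, ∑ j, residue n r₀ i j • (P i i * Q j j) := by
  rw [map_add, contraction_cartan hP hQ, ← contraction_rootPart hP hQ, add_assoc, add_comm]
  congr 1
  simp only [← Finset.sum_add_distrib]
  refine Finset.sum_congr rfl fun i _ => Finset.sum_congr rfl fun j _ => ?_
  rw [residue]
  split_ifs
  · rw [sub_smul, one_smul]
    ring
  · rw [sub_zero, zero_add]

/-- The residual diagonal part is a multiple of `f * g` if the gradients are homogeneous. -/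
theorem sum_residue_mem (hn : 2 ≤ n) {r₀ : cartan n ⊗[ℂ] cartan n} (h : IsCartanPart n r₀)
    (hf : ∃ c : ℂ, P.trace = c • f) (hf' : ∃ c : ℂ, ∑ i : Fin n, (i : ℂ) • P i i = c • f)
    (hg : ∃ c : ℂ, Q.trace = c • g) (hg' : ∃ c : ℂ, ∑ i : Fin n, (i : ℂ) • Q i i = c • g) :
    ∑ i, ∑ j, residue n r₀ i j • (P i i * Q j j) ∈ Submodule.span ℂ {f * g} := by
  obtain ⟨c₁, h₁⟩ := hf
  obtain ⟨c₂, h₂⟩ := hf'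
  obtain ⟨c₃, h₃⟩ := hg
  obtain ⟨c₄, h₄⟩ := hg'
  simp only [Matrix.trace, Matrix.diag] at h₁ h₃
  set z : Fin n := ⟨0, by omega⟩
  set o : Fin n := ⟨1, by omega⟩
  -- An affine function of `j` is determined by its values at `0` and `1`, so a row sum involves
  -- only the trace and the index-weighted trace of `Q`.
  have hrow : ∀ i, ∑ j, residue n r₀ i j • Q j j =
      (residue n r₀ i z * c₃ + (residue n r₀ i o - residue n r₀ i z) * c₄) • g := by
    intro i
    have : ∀ j, residue n r₀ i j • Q j j = residue n r₀ i z • Q j j +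
        (residue n r₀ i o - residue n r₀ i z) • (j : ℂ) • Q j j := by
      intro j
      rw [residue_affine_right hn h i j, smul_smul, ← add_smul]
      congr 1
      ring
    rw [Finset.sum_congr rfl fun j _ => this j, Finset.sum_add_distrib, ← Finset.smul_sum,
      ← Finset.smul_sum, h₃, h₄, smul_smul, smul_smul, ← add_smul]
  have hcol : ∀ j, ∑ i, residue n r₀ i j • P i i =
      (residue n r₀ z j * c₁ + (residue n r₀ o j - residue n r₀ z j) * c₂) • f := by
    intro j
    have : ∀ i, residue n r₀ i j • P i i = residue n r₀ z j • P i i +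
        (residue n r₀ o j - residue n r₀ z j) • (i : ℂ) • P i i := by
      intro i
      rw [residue_affine_left hn h i j, smul_smul, ← add_smul]
      congr 1
      ring
    rw [Finset.sum_congr rfl fun i _ => this i, Finset.sum_add_distrib, ← Finset.smul_sum,
      ← Finset.smul_sum, h₁, h₂, smul_smul, smul_smul, ← add_smul]
  have e : ∑ i, ∑ j, residue n r₀ i j • (P i i * Q j j) =
      (c₃ * (residue n r₀ z z * c₁ + (residue n r₀ o z - residue n r₀ z z) * c₂) +
        c₄ * ((residue n r₀ z o * c₁ + (residue n r₀ o o - residue n r₀ z o) * c₂) -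
          (residue n r₀ z z * c₁ + (residue n r₀ o z - residue n r₀ z z) * c₂))) • (f * g) := by
    have e1 : ∀ i, ∑ j, residue n r₀ i j • (P i i * Q j j) =
        (c₃ • (residue n r₀ i z • P i i) +
          c₄ • (residue n r₀ i o • P i i - residue n r₀ i z • P i i)) * g := by
      intro i
      have : ∀ j, residue n r₀ i j • (P i i * Q j j) = P i i * (residue n r₀ i j • Q j j) :=
        fun j => (mul_smul_comm _ _ _).symm
      rw [Finset.sum_congr rfl fun j _ => this j, ← Finset.mul_sum, hrow]
      simp only [Algebra.smul_def, map_add, map_mul, map_sub]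
      ring
    rw [Finset.sum_congr rfl fun i _ => e1 i, ← Finset.sum_mul, Finset.sum_add_distrib,
      ← Finset.smul_sum, ← Finset.smul_sum, Finset.sum_sub_distrib, hcol, hcol]
    simp only [Algebra.smul_def, map_add, map_mul, map_sub]
    ring
  rw [e]
  exact Submodule.smul_mem _ _ (Submodule.mem_span_singleton_self _)

end Contraction

/-! ### The bracket in terms of gradients; functions with triangular gradients. -/

section Bracket

variable {n : ℕ}

/-- The transposed matrix of partial derivatives. -/
def grad (f : CoordMat n) : Matrix (Fin n) (Fin n) (CoordMat n) :=
  Matrix.of fun j i => MvPolynomial.pderiv (i, j) f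

theorem derivation_sum_apply {ι B : Type*} [CommRing B] [Algebra ℂ B] (s : Finset ι)
    (D : ι → Derivation ℂ B B) (f : B) : (∑ p ∈ s, D p) f = ∑ p ∈ s, D p f := by
  classical
  induction s using Finset.induction_on with
  | empty => simp
  | insert a s ha ih => rw [Finset.sum_insert ha, Finset.sum_insert ha, Derivation.add_apply, ih]

theorem derivation_eq_sum_grad (d : Derivation ℂ (CoordMat n) (CoordMat n)) (f : CoordMat n) :
    d f = ∑ i, ∑ j, grad f j i * d (genericMatrix n i j) := by
  have h : d = ∑ p : Fin n × Fin n, d (MvPolynomial.X p) • MvPolynomial.pderiv p := by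
    apply MvPolynomial.derivation_ext
    intro q
    rw [derivation_sum_apply, Finset.sum_eq_single q]
    · simp
    · intro b _ hb
      simp [MvPolynomial.pderiv_X_of_ne hb.symm]
    · simp
  conv_lhs => rw [h]
  rw [derivation_sum_apply, Fintype.sum_prod_type]
  simp [grad, mul_comm]

theorem leftInvMat_apply (ξ : sl n) (f : CoordMat n) :
    leftInvMat n ξ f = ∑ i, ∑ j, ξ.val i j • (grad f * genericMatrix n) j i := by
  have h : ∀ i j, leftInvMat n ξ (genericMatrix n i j) =
      ∑ k, ξ.val k j • genericMatrix n i k := by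
    intro i j
    refine (MvPolynomial.mkDerivation_X _ _ _).trans ?_
    simp [Matrix.mul_apply, constMatrix, MvPolynomial.smul_eq_C_mul, mul_comm]
  rw [derivation_eq_sum_grad]
  simp only [h, Matrix.mul_apply, Finset.mul_sum, Finset.smul_sum, mul_smul_comm]
  rw [Finset.sum_comm]
  conv_rhs => rw [Finset.sum_comm]
  exact Finset.sum_congr rfl fun j _ => Finset.sum_comm

theorem rightInvMat_apply (ξ : sl n) (f : CoordMat n) :
    rightInvMat n ξ f = ∑ i, ∑ j, ξ.val i j • (genericMatrix n * grad f) j i := by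
  have h : ∀ i j, rightInvMat n ξ (genericMatrix n i j) =
      ∑ k, ξ.val i k • genericMatrix n k j := by
    intro i j
    refine (MvPolynomial.mkDerivation_X _ _ _).trans ?_
    simp [Matrix.mul_apply, constMatrix, MvPolynomial.smul_eq_C_mul]
  rw [derivation_eq_sum_grad]
  simp only [h, Matrix.mul_apply, Finset.mul_sum, Finset.smul_sum, mul_smul_comm]
  refine Finset.sum_congr rfl fun i _ => ?_
  rw [Finset.sum_comm]
  refine Finset.sum_congr rfl fun k _ => Finset.sum_congr rfl fun j _ => ?_
  rw [mul_comm]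

theorem bracketMat_eq (r₀ : cartan n ⊗[ℂ] cartan n) (f g : CoordMat n) :
    bracketMat n (TensorProduct.map (cartan n).subtype (cartan n).subtype r₀ + rootPart n) f g =
      (cgForm (grad f * genericMatrix n) (grad g * genericMatrix n) +
        ∑ i, ∑ j, residue n r₀ i j •
          ((grad f * genericMatrix n) i i * (grad g * genericMatrix n) j j)) -
      (cgForm (genericMatrix n * grad f) (genericMatrix n * grad g) +
        ∑ i, ∑ j, residue n r₀ i j •
          ((genericMatrix n * grad f) i i * (genericMatrix n * grad g) j j)) := by
  rw [bracketMat, contraction_rMatrix (fun ξ => leftInvMat_apply ξ f)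
    (fun ξ => leftInvMat_apply ξ g), contraction_rMatrix (fun ξ => rightInvMat_apply ξ f)
    (fun ξ => rightInvMat_apply ξ g)]

theorem sum_residue_add_swap (hn : n ≠ 0) {r₀ : cartan n ⊗[ℂ] cartan n} (h : IsCartanPart n r₀)
    (P Q : Matrix (Fin n) (Fin n) (CoordMat n)) :
    ∑ i, ∑ j, residue n r₀ i j • (P i i * Q j j) +
      ∑ i, ∑ j, residue n r₀ i j • (Q i i * P j j) =
      (-(n : ℂ)⁻¹ - 1) • (P.trace * Q.trace) := by
  rw [Finset.sum_comm (f := fun i j => residue n r₀ i j • (Q i i * P j j)),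
    ← Finset.sum_add_distrib, Matrix.trace, Matrix.trace, Finset.sum_mul_sum, Finset.smul_sum]
  refine Finset.sum_congr rfl fun i _ => ?_
  rw [← Finset.sum_add_distrib, Finset.smul_sum]
  refine Finset.sum_congr rfl fun j _ => ?_
  rw [mul_comm (Q j j), ← add_smul, residue_add_swap hn h]
  rfl

/-- The symmetric part of the contraction consists of `tr (A B)` and `tr A * tr B`. Both are the
same for `grad f * X`, `grad g * X` as for `X * grad f`, `X * grad g`, hence they cancel between
left and right. -/
theorem bracketMat_swap (hn : n ≠ 0) {r : sl n ⊗[ℂ] sl n} (hr : IsRMatrix n r)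
    (f g : CoordMat n) : bracketMat n r f g = -bracketMat n r g f := by
  obtain ⟨r₀, h₀, rfl⟩ := hr
  rw [bracketMat_eq, bracketMat_eq]
  set X := genericMatrix n
  have h1 := sum_residue_add_swap hn h₀ (grad f * X) (grad g * X)
  have h2 := sum_residue_add_swap hn h₀ (X * grad f) (X * grad g)
  have h3 := cgForm_add_swap (grad f * X) (grad g * X)
  have h4 := cgForm_add_swap (X * grad f) (X * grad g)
  have h5 : (grad f * X).trace = (X * grad f).trace := Matrix.trace_mul_comm _ _
  have h6 : (grad g * X).trace = (X * grad g).trace := Matrix.trace_mul_comm _ _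
  have h7 : (grad f * X * (grad g * X)).trace = (X * grad f * (X * grad g)).trace := by
    rw [← Matrix.mul_assoc, Matrix.trace_mul_comm, ← Matrix.mul_assoc, ← Matrix.mul_assoc,
      Matrix.mul_assoc]
  rw [h5, h6] at h1 h3
  linear_combination h1 - h2 + h3 - h4 + h7

/-- A splitting of the gradient of `f` into two parts that satisfy the relations `HalfData` with
respect to columns and, after the reversal of the order of indices, with respect to rows. -/
structure GradData (f : CoordMat n) (PX PY : Matrix (Fin n) (Fin n) (CoordMat n))
    (μ ν : ℕ → ℂ) : Prop where
  grad_eq : grad f = PX + PY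
  col : HalfData f (PX * genericMatrix n) (PY * genericMatrix n) μ
  row : HalfData f ((genericMatrix n * PY).submatrix Fin.rev Fin.rev)
    ((genericMatrix n * PX).submatrix Fin.rev Fin.rev) ν

theorem trace_submatrix_rev {R : Type*} [CommRing R] (A : Matrix (Fin n) (Fin n) R) :
    (A.submatrix Fin.rev Fin.rev).trace = A.trace :=
  Equiv.sum_comp Fin.revPerm fun i => A i i

variable {f g : CoordMat n} {PX PY QX QY : Matrix (Fin n) (Fin n) (CoordMat n)}
  {μ ν μ' ν' : ℕ → ℂ}

theorem sum_weighted_rev {R : Type*} [CommRing R] [Algebra ℂ R] {f : R}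
    {A : Matrix (Fin n) (Fin n) R} (h : ∃ c : ℂ, A.trace = c • f)
    (h' : ∃ c : ℂ, ∑ i : Fin n, (i : ℂ) • (A.submatrix Fin.rev Fin.rev) i i = c • f) :
    ∃ c : ℂ, ∑ i : Fin n, (i : ℂ) • A i i = c • f := by
  obtain ⟨c, hc⟩ := h
  obtain ⟨d, hd⟩ := h'
  refine ⟨((n : ℂ) - 1) * c - d, ?_⟩
  have hA : ∑ i : Fin n, A i i = c • f := hc
  rw [← Equiv.sum_comp Fin.revPerm] at hd
  rw [sub_smul, ← hd, mul_smul, ← hA, Finset.smul_sum, ← Finset.sum_sub_distrib]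
  refine Finset.sum_congr rfl fun i _ => ?_
  simp only [Fin.revPerm_apply, Matrix.submatrix_apply, Fin.rev_rev, ← sub_smul]
  congr 1
  rw [Fin.val_rev, Nat.cast_sub (by omega)]
  push_cast
  ring

/-- The trace terms of `cgForm_sub_mem` on the two sides are `tr (PX X QY X)` and `tr (X QY X PX)`.
They are equal by cyclicity, so only the reduced forms survive in the bracket. -/
theorem bracketMat_sub_mem (hn : 2 ≤ n) {r : sl n ⊗[ℂ] sl n} (hr : IsRMatrix n r)
    (hf : GradData f PX PY μ ν) (hg : GradData g QX QY μ' ν') :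
    bracketMat n r f g -
      (HalfData.reducedForm f (PX * genericMatrix n) (PY * genericMatrix n)
          (QX * genericMatrix n) (QY * genericMatrix n) μ -
        HalfData.reducedForm g ((genericMatrix n * QY).submatrix Fin.rev Fin.rev)
          ((genericMatrix n * QX).submatrix Fin.rev Fin.rev)
          ((genericMatrix n * PY).submatrix Fin.rev Fin.rev)
          ((genericMatrix n * PX).submatrix Fin.rev Fin.rev) ν') ∈
      Submodule.span ℂ {f * g} := by
  obtain ⟨r₀, h₀, rfl⟩ := hr
  rw [bracketMat_eq]
  set X := genericMatrix n
  have h1 := hf.col.cgForm_sub_mem hg.col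
  -- Here `g` comes first because `cgForm_rev` exchanges the arguments.
  have h2 := hg.row.cgForm_sub_mem hf.row
  rw [← Matrix.add_mul, ← Matrix.add_mul, ← hf.grad_eq, ← hg.grad_eq] at h1
  have sa : ∀ A B : Matrix (Fin n) (Fin n) (CoordMat n),
      A.submatrix Fin.rev Fin.rev + B.submatrix Fin.rev Fin.rev =
        (B + A).submatrix Fin.rev Fin.rev := fun A B => by
    rw [add_comm]
    rfl
  have cf := hf.row.sum_diag
  have cg := hg.row.sum_diag
  have wf := hf.row.sum_weighted_diag
  have wg := hg.row.sum_weighted_diag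
  rw [sa, ← Matrix.mul_add, ← hf.grad_eq] at cf wf
  rw [sa, ← Matrix.mul_add, ← hg.grad_eq] at cg wg
  rw [trace_submatrix_rev] at cf cg
  rw [sa, sa, ← Matrix.mul_add, ← Matrix.mul_add, ← hf.grad_eq, ← hg.grad_eq, cgForm_rev,
    mul_comm g f] at h2
  have cf' := hf.col.sum_diag
  have cg' := hg.col.sum_diag
  have wf' := hf.col.sum_weighted_diag
  have wg' := hg.col.sum_weighted_diag
  rw [← Matrix.add_mul, ← hf.grad_eq] at cf' wf'
  rw [← Matrix.add_mul, ← hg.grad_eq] at cg' wg'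
  have h3 := sum_residue_mem hn h₀ cf' wf' cg' wg'
  have h4 := sum_residue_mem hn h₀ cf (sum_weighted_rev cf wf) cg (sum_weighted_rev cg wg)
  have h5 : ((X * QY).submatrix Fin.rev Fin.rev * (X * PX).submatrix Fin.rev Fin.rev).trace =
      (PX * X * (QY * X)).trace := by
    have : (X * QY).submatrix Fin.rev Fin.rev * (X * PX).submatrix Fin.rev Fin.rev =
        (X * QY * (X * PX)).submatrix Fin.rev Fin.rev :=
      Matrix.submatrix_mul_equiv (X * QY) (X * PX) _ Fin.revPerm _
    rw [this, trace_submatrix_rev, ← Matrix.mul_assoc, Matrix.trace_mul_comm]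
    simp only [Matrix.mul_assoc]
  rw [h5] at h2
  have h6 := Submodule.sub_mem _ (Submodule.add_mem _ h1 h3) (Submodule.add_mem _ h2 h4)
  convert h6 using 1
  ring

/-- A function whose gradient data have trivial second part has log-canonical bracket with every
function with gradient data. -/
theorem bracketMat_mem_of_triangular (hn : 2 ≤ n) {r : sl n ⊗[ℂ] sl n} (hr : IsRMatrix n r)
    (hf : GradData f PX 0 μ ν) (hf' : ∀ i j, i < j → (PX * genericMatrix n) i j = 0)
    (hg : GradData g QX QY μ' ν') : bracketMat n r f g ∈ Submodule.span ℂ {f * g} := by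
  have h1 := bracketMat_sub_mem hn hr hf hg
  set X := genericMatrix n
  have hcol := hf.col
  have hrow := hf.row
  rw [Matrix.zero_mul] at hcol
  rw [Matrix.mul_zero] at hrow
  change HalfData f 0 _ ν at hrow
  obtain ⟨ζ, hζ⟩ := hcol.corner
  obtain ⟨ζ', hζ'⟩ := hg.col.corner
  have z0 : ∀ i j, extend (0 : Matrix (Fin n) (Fin n) (CoordMat n)) i j = 0 := by
    intro i j
    simp [extend]
  have h2 : HalfData.reducedForm f (PX * X) (0 * X) (QX * X) (QY * X) μ =
      (ζ * ζ') • (f * g) := by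
    unfold HalfData.reducedForm
    have e1 : ∑ i, ∑ j, (if i ≤ j then (PX * X) i j * (QX * X) j i else 0) =
        ∑ i : Fin n, extend (PX * X) i i * extend (QX * X) i i := by
      refine Finset.sum_congr rfl fun i _ => ?_
      rw [Finset.sum_eq_single i, if_pos le_rfl, extend_val, extend_val]
      · intro j _ hj
        split_ifs with hij
        · rw [hf' i j (lt_of_le_of_ne hij hj.symm), zero_mul]
        · rfl
      · simp
    -- As the second part is zero, `diag` identifies `μ i • f` with the next diagonal entry of `PX *
    -- X`. The difference from `e1` telescopes to the product of the two corners.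
    have e2 : f * ∑ i : Fin n, μ i • extend (QX * X) (i + 1) (i + 1) =
        ∑ i : Fin n, extend (PX * X) (i + 1) (i + 1) * extend (QX * X) (i + 1) (i + 1) := by
      rw [Finset.mul_sum]
      refine Finset.sum_congr rfl fun i _ => ?_
      have := hcol.diag i
      rw [Matrix.zero_apply, eq_comm, sub_eq_zero] at this
      rw [← this, mul_smul_comm, smul_mul_assoc]
    rw [e1, e2, Matrix.zero_mul]
    have e3 := Finset.sum_range_sub'
      (fun i => extend (PX * X) i i * extend (QX * X) i i) n
    rw [← Fin.sum_univ_eq_sum_range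
      (fun i => extend (PX * X) i i * extend (QX * X) i i -
        extend (PX * X) (i + 1) (i + 1) * extend (QX * X) (i + 1) (i + 1)),
      Finset.sum_sub_distrib, extend_of_le_right (PX * X) le_rfl, hζ, hζ', zero_mul, sub_zero,
      smul_mul_smul_comm] at e3
    simpa using e3
  have h3 : HalfData.reducedForm g ((X * QY).submatrix Fin.rev Fin.rev)
      ((X * QX).submatrix Fin.rev Fin.rev) ((X * 0).submatrix Fin.rev Fin.rev)
      ((X * PX).submatrix Fin.rev Fin.rev) ν' = 0 := by
    -- In the row data of `f` the first part is zero, so `upper` says that the reversed `X * PX` is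
    -- lower triangular.
    have e : ∀ i j : Fin n, j < i → ((X * PX).submatrix Fin.rev Fin.rev) j i = 0 := by
      intro i j hij
      rw [hrow.upper j i hij, z0, neg_zero]
    unfold HalfData.reducedForm
    rw [Matrix.mul_zero, show (0 : Matrix (Fin n) (Fin n) (CoordMat n)).submatrix
      Fin.rev Fin.rev = 0 from rfl]
    have e1 : ∑ i, ∑ j, (if j < i then (X * QX).submatrix Fin.rev Fin.rev i j *
        (X * PX).submatrix Fin.rev Fin.rev j i else 0) = 0 := by
      refine Finset.sum_eq_zero fun i _ => Finset.sum_eq_zero fun j _ => ?_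
      split_ifs with hij
      · rw [e i j hij, mul_zero]
      · rfl
    rw [e1]
    simp [z0]
  rw [h2, h3, sub_zero] at h1
  have h4 := Submodule.add_mem _ h1
    (Submodule.smul_mem _ (ζ * ζ') (Submodule.mem_span_singleton_self (f * g)))
  rwa [sub_add_cancel] at h4

theorem restrictSL_bracketMat (r : sl n ⊗[ℂ] sl n) (f g : CoordMat n) :
    bracketSL n r (restrictSL n f) (restrictSL n g) = restrictSL n (bracketMat n r f g) := by
  rw [bracketSL, bracketMat, map_sub]
  congr 1 <;>
  · induction r using TensorProduct.induction_on with
    | zero => simp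
    | tmul a b => simp [contraction_tmul, leftInvSL, rightInvSL]
    | add a b ha hb => simp only [map_add, ha, hb]

end Bracket

/-! ### Gradients of minors through the adjugate. -/

section WindowGradient

variable {R : Type*} [CommRing R] {ρ κ : Type*} [DecidableEq ρ] [DecidableEq κ] {p : ℕ}

/-- The gradient of the minor of `U` in the rows `re` and the columns `ce` with respect to the
(transposed) entries of `U`. -/
def windowGrad (U : Matrix ρ κ R) (re : Fin p → ρ) (ce : Fin p → κ) : Matrix κ ρ R :=
  Matrix.of fun c r => ∑ s, ∑ t,
    if ce s = c ∧ re t = r then (U.submatrix re ce).adjugate s t else 0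

variable (U : Matrix ρ κ R) {re : Fin p → ρ} {ce : Fin p → κ}

theorem windowGrad_of_col_notMem {c : κ} (h : c ∉ Set.range ce) (r : ρ) :
    windowGrad U re ce c r = 0 := by
  rw [windowGrad, Matrix.of_apply]
  refine Finset.sum_eq_zero fun s _ => Finset.sum_eq_zero fun _ _ => if_neg ?_
  exact fun h' => h ⟨s, h'.1⟩

theorem windowGrad_of_row_notMem (c : κ) {r : ρ} (h : r ∉ Set.range re) :
    windowGrad U re ce c r = 0 := by
  rw [windowGrad, Matrix.of_apply]
  refine Finset.sum_eq_zero fun _ _ => Finset.sum_eq_zero fun t _ => if_neg ?_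
  exact fun h' => h ⟨t, h'.2⟩

variable [Fintype ρ] [Fintype κ]

theorem sum_sum_windowGrad_mul (v : κ → ρ → R) :
    ∑ c, ∑ r, windowGrad U re ce c r * v c r =
      ∑ s, ∑ t, (U.submatrix re ce).adjugate s t * v (ce s) (re t) := by
  simp only [windowGrad, Matrix.of_apply, Finset.sum_mul, ite_mul, zero_mul]
  calc _ = ∑ c, ∑ s, ∑ t, ∑ r, if ce s = c ∧ re t = r then
        (U.submatrix re ce).adjugate s t * v c r else 0 := by
        refine Finset.sum_congr rfl fun c _ => ?_
        rw [Finset.sum_comm]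
        exact Finset.sum_congr rfl fun s _ => Finset.sum_comm
    _ = ∑ s, ∑ t, ∑ c, ∑ r, if ce s = c ∧ re t = r then
        (U.submatrix re ce).adjugate s t * v c r else 0 := by
        rw [Finset.sum_comm]
        exact Finset.sum_congr rfl fun s _ => Finset.sum_comm
    _ = _ := by
        refine Finset.sum_congr rfl fun s _ => Finset.sum_congr rfl fun t _ => ?_
        simp [ite_and]

theorem sum_windowGrad_mul (c : κ) (v : ρ → R) :
    ∑ r, windowGrad U re ce c r * v r =
      ∑ s, if ce s = c then ∑ t, (U.submatrix re ce).adjugate s t * v (re t) else 0 := by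
  have := sum_sum_windowGrad_mul U (re := re) (ce := ce) fun c' r => if c' = c then v r else 0
  simp only [mul_ite, mul_zero] at this
  rw [Finset.sum_eq_single c] at this
  · simp only [if_pos] at this
    rw [this]
    refine Finset.sum_congr rfl fun s _ => ?_
    split_ifs <;> simp
  · intro b _ hb
    simp [hb]
  · simp

theorem sum_mul_windowGrad (r : ρ) (v : κ → R) :
    ∑ c, v c * windowGrad U re ce c r =
      ∑ t, if re t = r then ∑ s, v (ce s) * (U.submatrix re ce).adjugate s t else 0 := by
  have := sum_sum_windowGrad_mul U (re := re) (ce := ce) fun c r' => if r' = r then v c else 0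
  simp only [mul_ite, mul_zero, Finset.sum_ite_eq', Finset.mem_univ, if_true] at this
  simp only [mul_comm (v _)]
  rw [this, Finset.sum_comm]
  refine Finset.sum_congr rfl fun s _ => ?_
  split_ifs <;> simp

/-- This is `adjugate A * A = det A • 1`, the effect of replacing one column of the minor by
another. Only the entries of `v` in the rows of the minor matter, so `v` may come from a different
matrix; this is used for shifted windows. -/
theorem sum_windowGrad_mul_of_col (c : κ) (v : ρ → R) (s : Fin p)
    (hv : ∀ t, v (re t) = U (re t) (ce s)) :
    ∑ r, windowGrad U re ce c r * v r = if c = ce s then (U.submatrix re ce).det else 0 := by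
  have h : ∀ s', ∑ t, (U.submatrix re ce).adjugate s' t * v (re t) =
      if s' = s then (U.submatrix re ce).det else 0 := by
    intro s'
    have := congrFun (congrFun (U.submatrix re ce).adjugate_mul s') s
    rw [Matrix.mul_apply] at this
    simp only [hv]
    refine this.trans ?_
    simp [Matrix.one_apply]
  rw [sum_windowGrad_mul]
  simp only [h]
  rw [Finset.sum_eq_single s]
  · simp [eq_comm]
  · intro b _ hb
    simp [hb]
  · simp

theorem sum_mul_windowGrad_of_row (r : ρ) (v : κ → R) (t : Fin p)
    (hv : ∀ s, v (ce s) = U (re t) (ce s)) :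
    ∑ c, v c * windowGrad U re ce c r = if r = re t then (U.submatrix re ce).det else 0 := by
  have h : ∀ t', ∑ s, v (ce s) * (U.submatrix re ce).adjugate s t' =
      if t' = t then (U.submatrix re ce).det else 0 := by
    intro t'
    have := congrFun (congrFun (U.submatrix re ce).mul_adjugate t) t'
    rw [Matrix.mul_apply] at this
    simp only [hv]
    refine this.trans ?_
    simp [Matrix.one_apply, eq_comm]
  rw [sum_mul_windowGrad]
  simp only [h]
  rw [Finset.sum_eq_single t]
  · simp [eq_comm]
  · intro b _ hb
    simp [hb]
  · simp

theorem sum_mul_windowGrad_of_zero (r : ρ) (v : κ → R) (hv : ∀ s, v (ce s) = 0) :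
    ∑ c, v c * windowGrad U re ce c r = 0 := by
  rw [sum_mul_windowGrad]
  simp [hv]

theorem derivation_minor [Algebra ℂ R] (d : Derivation ℂ R R) :
    d (U.submatrix re ce).det = ∑ c, ∑ r, windowGrad U re ce c r * d (U r c) := by
  rw [sum_sum_windowGrad_mul U fun c r => d (U r c), derivation_det]
  refine Finset.sum_congr rfl fun s _ => ?_
  rw [← Matrix.cramer_apply, Matrix.cramer_eq_adjugate_mulVec]
  rfl

end WindowGradient

/-! ### Shifted windows of the block Toeplitz matrix. -/

section Blocks

variable {R : Type*} [CommRing R] {k m : ℕ}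

/-- The block of the bi-infinite block matrix with blocks `cy` on the diagonal and `cx` next to it
at the distance `δ` from the diagonal. -/
def blockEntry (cx cy : Matrix (Fin m) (Fin (m + 2)) R) (δ : ℤ) (i : Fin m) (j : Fin (m + 2)) : R :=
  if δ = 0 then cy i j else if δ = 1 then cx i j else 0

/-- The window of the bi-infinite block matrix with columns shifted by `d` blocks. -/
def shiftedU (k : ℕ) (cx cy : Matrix (Fin m) (Fin (m + 2)) R) (d : ℤ) :
    Matrix (Fin k × Fin m) (Fin (k + 1) × Fin (m + 2)) R :=
  Matrix.of fun r c => blockEntry cx cy (((c.1 : ℕ) : ℤ) + d - ((r.1 : ℕ) : ℤ)) r.2 c.2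

/-- The columns that precede the end of a window; `ε = 0` for `φ` and `ε = 1` for `ψ`. -/
def IsEnd (k ε : ℕ) (b : ℤ) (j : ℕ) : Prop := b < k ∨ (b = k ∧ j < ε)

/-- The rows and columns of the minor `φ` (if `ε = 0`) or `ψ` (if `ε = 1`). -/
structure EndWindow (k m ε : ℕ) {p : ℕ} (re : Fin p → Fin k × Fin m)
    (ce : Fin p → Fin (k + 1) × Fin (m + 2)) : Prop where
  le_one : ε ≤ 1
  row_mem : ∀ t (r : Fin k × Fin m),
    ((re t).1 < r.1 ∨ ((re t).1 = r.1 ∧ (re t).2 < r.2)) → r ∈ Set.range re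
  col_end : ∀ s, IsEnd k ε ((ce s).1 : ℕ) (ce s).2
  col_mem : ∀ s (c : Fin (k + 1) × Fin (m + 2)),
    ((ce s).1 < c.1 ∨ ((ce s).1 = c.1 ∧ (ce s).2 < c.2)) → IsEnd k ε (c.1 : ℕ) c.2 →
      c ∈ Set.range ce

open Classical in
/-- The indicator of the range of a map. -/
def rangeInd {α β : Type*} (e : α → β) (b : β) : ℂ := if b ∈ Set.range e then 1 else 0

namespace EndWindow

variable {ε p : ℕ} {re : Fin p → Fin k × Fin m}
  {ce : Fin p → Fin (k + 1) × Fin (m + 2)}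
  (cx cy : Matrix (Fin m) (Fin (m + 2)) R)

theorem grad_mul_shiftedU_of_notMem (d : ℤ) {c : Fin (k + 1) × Fin (m + 2)}
    (hc : c ∉ Set.range ce) (c' : Fin (k + 1) × Fin (m + 2)) :
    (windowGrad (shiftedU k cx cy 0) re ce * shiftedU k cx cy d) c c' = 0 := by
  rw [Matrix.mul_apply]
  exact Finset.sum_eq_zero fun r _ => by rw [windowGrad_of_col_notMem _ hc, zero_mul]

theorem shiftedU_mul_grad_of_notMem (d : ℤ) {r : Fin k × Fin m}
    (hr : r ∉ Set.range re) (r' : Fin k × Fin m) :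
    (shiftedU k cx cy d * windowGrad (shiftedU k cx cy 0) re ce) r' r = 0 := by
  rw [Matrix.mul_apply]
  exact Finset.sum_eq_zero fun c _ => by rw [windowGrad_of_row_notMem _ _ hr, mul_zero]

/-- The shift turns column `c'` into the column of `U` in block `c'.1 + d`, here a column after `c`
but before the end of the window. If `c` belongs to the minor, so does that column, and the minor
with a repeated column vanishes. -/
theorem grad_mul_shiftedU_eq_zero (w : EndWindow k m ε re ce)
    {d : ℤ} {c c' : Fin (k + 1) × Fin (m + 2)}
    (h : ((c.1 : ℕ) : ℤ) < (c'.1 : ℕ) + d ∨ (((c.1 : ℕ) : ℤ) = (c'.1 : ℕ) + d ∧ c.2 < c'.2))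
    (he : IsEnd k ε ((c'.1 : ℕ) + d) c'.2) :
    (windowGrad (shiftedU k cx cy 0) re ce * shiftedU k cx cy d) c c' = 0 := by
  by_cases hc : c ∈ Set.range ce
  · obtain ⟨s, rfl⟩ := hc
    have hk : ((c'.1 : ℕ) + d).toNat < k + 1 := by
      rcases he with he | he <;> omega
    have hd : ((((c'.1 : ℕ) + d).toNat : ℕ) : ℤ) = (c'.1 : ℕ) + d := Int.toNat_of_nonneg (by omega)
    obtain ⟨s', hs'⟩ := w.col_mem s (⟨((c'.1 : ℕ) + d).toNat, hk⟩, c'.2) (by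
      simp only [Fin.lt_def, Fin.ext_iff] at h ⊢
      omega) (by rw [hd]; exact he)
    rw [Matrix.mul_apply, sum_windowGrad_mul_of_col _ _ _ s', if_neg]
    · rw [hs']
      intro h'
      rw [h'] at h
      simp only [hd, lt_irrefl, and_false, or_self] at h
    · intro t
      rw [hs']
      simp only [shiftedU, Matrix.of_apply, hd, add_zero]
  · exact grad_mul_shiftedU_of_notMem cx cy d hc c'

theorem grad_mul_shiftedU_diag [Algebra ℂ R] {d : ℤ} {c c' : Fin (k + 1) × Fin (m + 2)}
    (h : ((c.1 : ℕ) : ℤ) = (c'.1 : ℕ) + d) (h' : c.2 = c'.2) :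
    (windowGrad (shiftedU k cx cy 0) re ce * shiftedU k cx cy d) c c' =
      rangeInd ce c • ((shiftedU k cx cy 0).submatrix re ce).det := by
  by_cases hc : c ∈ Set.range ce
  · obtain ⟨s, rfl⟩ := hc
    rw [Matrix.mul_apply, sum_windowGrad_mul_of_col _ _ _ s, if_pos rfl,
      rangeInd, if_pos ⟨s, rfl⟩, one_smul]
    intro t
    simp only [shiftedU, Matrix.of_apply, h, h', add_zero]
  · rw [grad_mul_shiftedU_of_notMem cx cy d hc c', rangeInd, if_neg hc, zero_smul]

/-- The rows of the minor form a final segment of all rows, so a later row of `U` repeats one of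
them. Rows below the last block row vanish on the columns of the minor, so no analogue of `IsEnd` is
needed. -/
theorem shiftedU_mul_grad_eq_zero (w : EndWindow k m ε re ce)
    (hcy : ∀ i, cy i 0 = 0) {d : ℤ} {r r' : Fin k × Fin m}
    (h : ((r.1 : ℕ) : ℤ) < (r'.1 : ℕ) - d ∨ (((r.1 : ℕ) : ℤ) = (r'.1 : ℕ) - d ∧ r.2 < r'.2)) :
    (shiftedU k cx cy d * windowGrad (shiftedU k cx cy 0) re ce) r' r = 0 := by
  by_cases hr : r ∈ Set.range re
  · obtain ⟨t, rfl⟩ := hr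
    rw [Matrix.mul_apply]
    by_cases hk : ((r'.1 : ℕ) : ℤ) - d < k
    · have hd : ((((r'.1 : ℕ) - d : ℤ).toNat : ℕ) : ℤ) = (r'.1 : ℕ) - d :=
        Int.toNat_of_nonneg (by omega)
      obtain ⟨t', ht'⟩ := w.row_mem t (⟨((r'.1 : ℕ) - d : ℤ).toNat, by omega⟩, r'.2) (by
        simp only [Fin.lt_def, Fin.ext_iff] at h ⊢
        omega)
      rw [sum_mul_windowGrad_of_row _ _ _ t', if_neg]
      · rw [ht']
        intro h'
        rw [h'] at h
        simp only [hd, lt_irrefl, and_false, or_self] at h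
      · intro s
        rw [ht']
        simp only [shiftedU, Matrix.of_apply, hd]
        congr 1
        ring
    · apply sum_mul_windowGrad_of_zero
      intro s
      have he := w.col_end s
      have h1 := w.le_one
      simp only [shiftedU, Matrix.of_apply, blockEntry]
      rcases he with he | he
      · rw [if_neg (by omega), if_neg (by omega)]
      -- The only column that a window can have in the last block is its first one, where `cy` is
      -- zero.
      · have h0 : (ce s).2 = 0 := Fin.ext (by rw [Fin.val_zero]; omega)
        rw [h0, hcy, if_neg (c := _ = (1 : ℤ)) (by omega), ite_self]
  · exact shiftedU_mul_grad_of_notMem cx cy d hr r'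

theorem shiftedU_mul_grad_diag [Algebra ℂ R] {d : ℤ} {r r' : Fin k × Fin m}
    (h : ((r.1 : ℕ) : ℤ) = (r'.1 : ℕ) - d) (h' : r.2 = r'.2) :
    (shiftedU k cx cy d * windowGrad (shiftedU k cx cy 0) re ce) r' r =
      rangeInd re r • ((shiftedU k cx cy 0).submatrix re ce).det := by
  by_cases hr : r ∈ Set.range re
  · obtain ⟨t, rfl⟩ := hr
    rw [Matrix.mul_apply, sum_mul_windowGrad_of_row _ _ _ t, if_pos rfl,
      rangeInd, if_pos ⟨t, rfl⟩, one_smul]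
    intro s
    simp only [shiftedU, Matrix.of_apply, h']
    congr 1
    omega
  · rw [shiftedU_mul_grad_of_notMem cx cy d hr r', rangeInd, if_neg hr, zero_smul]

end EndWindow

end Blocks

/-! ### Gradients with respect to the two blocks. -/

section BlockSums

variable {R : Type*} [CommRing R] {k m : ℕ}

/-- The part of the gradient that comes from the blocks next to the diagonal. -/
def gradX (G : Matrix (Fin (k + 1) × Fin (m + 2)) (Fin k × Fin m) R) :
    Matrix (Fin (m + 2)) (Fin m) R :=
  Matrix.of fun j i => ∑ a : Fin k, G (a.succ, j) (a, i)

/-- The part of the gradient that comes from the diagonal blocks. -/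
def gradY (G : Matrix (Fin (k + 1) × Fin (m + 2)) (Fin k × Fin m) R) :
    Matrix (Fin (m + 2)) (Fin m) R :=
  Matrix.of fun j i => ∑ a : Fin k, G (a.castSucc, j) (a, i)

variable (cx cy : Matrix (Fin m) (Fin (m + 2)) R)

theorem sum_mul_blockEntry (φ : Fin (k + 1) → R) (a : Fin k) (i : Fin m) (j : Fin (m + 2)) :
    ∑ b, φ b * blockEntry cx cy (((b : ℕ) : ℤ) + 0 - ((a : ℕ) : ℤ)) i j =
      φ a.castSucc * cy i j + φ a.succ * cx i j := by
  have h : ∀ b : Fin (k + 1), φ b * blockEntry cx cy (((b : ℕ) : ℤ) + 0 - ((a : ℕ) : ℤ)) i j =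
      (if b = a.castSucc then φ b * cy i j else 0) +
        if b = a.succ then φ b * cx i j else 0 := by
    intro b
    simp only [blockEntry, Fin.ext_iff, Fin.val_castSucc, Fin.val_succ]
    by_cases h0 : (b : ℕ) = a
    · rw [if_pos (by omega), if_pos h0, if_neg (by omega), add_zero]
    · by_cases h1 : (b : ℕ) = a + 1
      · rw [if_neg (by omega), if_pos (by omega), if_neg h0, if_pos h1, zero_add]
      · rw [if_neg (by omega), if_neg (by omega), if_neg h0, if_neg h1, mul_zero, add_zero]
  rw [Finset.sum_congr rfl fun b _ => h b, Finset.sum_add_distrib]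
  simp

theorem gradX_mul_add_gradY_mul (G : Matrix (Fin (k + 1) × Fin (m + 2)) (Fin k × Fin m) R)
    (j j' : Fin (m + 2)) : (gradX G * cx) j j' + (gradY G * cy) j j' =
      ∑ b, (G * shiftedU k cx cy 0) (b, j) (b, j') := by
  simp only [Matrix.mul_apply, gradX, gradY, Matrix.of_apply, shiftedU, Fintype.sum_prod_type]
  rw [Finset.sum_comm]
  have h : ∀ a : Fin k, ∑ b : Fin (k + 1), ∑ i : Fin m, G (b, j) (a, i) *
      blockEntry cx cy (((b : ℕ) : ℤ) + 0 - ((a : ℕ) : ℤ)) i j' =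
      ∑ i : Fin m, (G (a.castSucc, j) (a, i) * cy i j' + G (a.succ, j) (a, i) * cx i j') := by
    intro a
    rw [Finset.sum_comm]
    exact Finset.sum_congr rfl fun i _ =>
      sum_mul_blockEntry cx cy (fun b => G (b, j) (a, i)) a i j'
  rw [Finset.sum_congr rfl fun a _ => h a, Finset.sum_comm, ← Finset.sum_add_distrib]
  refine Finset.sum_congr rfl fun i _ => ?_
  rw [Finset.sum_add_distrib, Finset.sum_mul, Finset.sum_mul, add_comm]

theorem mul_gradX_add_mul_gradY (G : Matrix (Fin (k + 1) × Fin (m + 2)) (Fin k × Fin m) R)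
    (i i' : Fin m) : (cx * gradX G) i i' + (cy * gradY G) i i' =
      ∑ a, (shiftedU k cx cy 0 * G) (a, i) (a, i') := by
  simp only [Matrix.mul_apply, gradX, gradY, Matrix.of_apply, shiftedU, Fintype.sum_prod_type]
  have h : ∀ a : Fin k, ∑ b : Fin (k + 1), ∑ j : Fin (m + 2),
      blockEntry cx cy (((b : ℕ) : ℤ) + 0 - ((a : ℕ) : ℤ)) i j * G (b, j) (a, i') =
      ∑ j : Fin (m + 2), (cy i j * G (a.castSucc, j) (a, i') + cx i j * G (a.succ, j) (a, i')) := by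
    intro a
    rw [Finset.sum_comm]
    refine Finset.sum_congr rfl fun j _ => ?_
    have := sum_mul_blockEntry cx cy (fun b => G (b, j) (a, i')) a i j
    simp only [mul_comm (G _ _)] at this
    exact this
  rw [Finset.sum_congr rfl fun a _ => h a, Finset.sum_comm, ← Finset.sum_add_distrib]
  refine Finset.sum_congr rfl fun j _ => ?_
  rw [Finset.sum_add_distrib, Finset.mul_sum, Finset.mul_sum, add_comm]

/-- Scaling `cx` by `t` while keeping `cy` amounts to multiplying block column `b` by `t ^ b` and
block row `a` by `t ^ (-a)`; this is the infinitesimal form. -/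
theorem trace_gradX_mul (G : Matrix (Fin (k + 1) × Fin (m + 2)) (Fin k × Fin m) R) :
    (gradX G * cx).trace =
      ∑ c : Fin (k + 1) × Fin (m + 2), ((c.1 : ℕ) : R) * (G * shiftedU k cx cy 0) c c -
        ∑ r : Fin k × Fin m, ((r.1 : ℕ) : R) * (shiftedU k cx cy 0 * G) r r := by
  have e1 : ∑ c : Fin (k + 1) × Fin (m + 2), ((c.1 : ℕ) : R) * (G * shiftedU k cx cy 0) c c =
      ∑ a : Fin k, ∑ i : Fin m, ∑ j : Fin (m + 2), ∑ b : Fin (k + 1),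
        ((b : ℕ) : R) * G (b, j) (a, i) *
          blockEntry cx cy (((b : ℕ) : ℤ) + 0 - ((a : ℕ) : ℤ)) i j := by
    simp only [Matrix.mul_apply, shiftedU, Matrix.of_apply, Finset.mul_sum, ← mul_assoc]
    rw [Finset.sum_comm, Fintype.sum_prod_type]
    refine Finset.sum_congr rfl fun a _ => Finset.sum_congr rfl fun i _ => ?_
    rw [Fintype.sum_prod_type, Finset.sum_comm]
  have e2 : ∑ r : Fin k × Fin m, ((r.1 : ℕ) : R) * (shiftedU k cx cy 0 * G) r r =
      ∑ a : Fin k, ∑ i : Fin m, ∑ j : Fin (m + 2), ∑ b : Fin (k + 1),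
        ((a : ℕ) : R) * G (b, j) (a, i) *
          blockEntry cx cy (((b : ℕ) : ℤ) + 0 - ((a : ℕ) : ℤ)) i j := by
    simp only [Matrix.mul_apply, shiftedU, Matrix.of_apply, Finset.mul_sum]
    rw [Fintype.sum_prod_type]
    refine Finset.sum_congr rfl fun a _ => Finset.sum_congr rfl fun i _ => ?_
    rw [Fintype.sum_prod_type, Finset.sum_comm]
    refine Finset.sum_congr rfl fun j _ => Finset.sum_congr rfl fun b _ => ?_
    ring
  have e3 : (gradX G * cx).trace =
      ∑ a : Fin k, ∑ i : Fin m, ∑ j : Fin (m + 2), G (a.succ, j) (a, i) * cx i j := by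
    simp only [Matrix.trace, Matrix.diag_apply, Matrix.mul_apply, gradX, Matrix.of_apply,
      Finset.sum_mul]
    rw [Finset.sum_comm, Finset.sum_comm' (t' := Finset.univ) (s' := fun _ => Finset.univ)
      (by simp)]
    rw [Finset.sum_comm]
    refine (Finset.sum_congr rfl fun i _ => Finset.sum_comm).trans ?_
    rw [Finset.sum_comm]
  rw [e1, e2, e3]
  simp only [← Finset.sum_sub_distrib]
  refine Finset.sum_congr rfl fun a _ => Finset.sum_congr rfl fun i _ =>
    Finset.sum_congr rfl fun j _ => ?_
  rw [Finset.sum_sub_distrib,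
    sum_mul_blockEntry cx cy (fun b => ((b : ℕ) : R) * G (b, j) (a, i)) a i j,
    sum_mul_blockEntry cx cy (fun b => ((a : ℕ) : R) * G (b, j) (a, i)) a i j]
  simp only [Fin.val_castSucc, Fin.val_succ]
  push_cast
  ring

end BlockSums

/-! ### From gradients in the blocks to gradients in `X`. -/

section Parts

variable {R : Type*} [CommRing R] {m : ℕ}

/-- The blocks `cx = [X_{[2,n]} 0]` and `cy = [0 X_{[1,n-1]}]` of a matrix `X`. -/
structure IsBlockPair (X : Matrix (Fin (m + 1)) (Fin (m + 1)) R)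
    (cx cy : Matrix (Fin m) (Fin (m + 2)) R) : Prop where
  x_castSucc : ∀ i j, cx i (Fin.castSucc j) = X i.succ j
  x_last : ∀ i, cx i (Fin.last (m + 1)) = 0
  y_succ : ∀ i j, cy i (Fin.succ j) = X i.castSucc j
  y_zero : ∀ i, cy i 0 = 0

/-- The gradient with respect to `X` from the gradient with respect to the block `[X_{[2,n]} 0]`. -/
def partX (F : Matrix (Fin (m + 2)) (Fin m) R) : Matrix (Fin (m + 1)) (Fin (m + 1)) R :=
  Matrix.of fun j i => Fin.cases 0 (fun i' => F j.castSucc i') i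

/-- The gradient with respect to `X` from the gradient with respect to the block
`[0 X_{[1,n-1]}]`. -/
def partY (F : Matrix (Fin (m + 2)) (Fin m) R) : Matrix (Fin (m + 1)) (Fin (m + 1)) R :=
  Matrix.of fun j i => Fin.lastCases 0 (fun i' => F j.succ i') i

namespace IsBlockPair

variable {X : Matrix (Fin (m + 1)) (Fin (m + 1)) R} {cx cy : Matrix (Fin m) (Fin (m + 2)) R}
  (F : Matrix (Fin (m + 2)) (Fin m) R)

theorem partX_mul (h : IsBlockPair X cx cy) (j j' : Fin (m + 1)) :
    (partX F * X) j j' = (F * cx) j.castSucc j'.castSucc := by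
  simp [Matrix.mul_apply, Fin.sum_univ_succ (n := m), partX, h.x_castSucc]

theorem partY_mul (h : IsBlockPair X cx cy) (j j' : Fin (m + 1)) :
    (partY F * X) j j' = (F * cy) j.succ j'.succ := by
  simp [Matrix.mul_apply, Fin.sum_univ_castSucc (n := m), partY, h.y_succ]

theorem mul_partX_succ (h : IsBlockPair X cx cy) (i i' : Fin m) :
    (X * partX F) i.succ i'.succ = (cx * F) i i' := by
  simp [Matrix.mul_apply, Fin.sum_univ_castSucc (n := m + 1), partX, h.x_castSucc, h.x_last]

theorem mul_partX_zero (r : Fin (m + 1)) : (X * partX F) r 0 = 0 := by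
  simp [Matrix.mul_apply, partX]

theorem mul_partY_castSucc (h : IsBlockPair X cx cy) (i i' : Fin m) :
    (X * partY F) i.castSucc i'.castSucc = (cy * F) i i' := by
  simp [Matrix.mul_apply, Fin.sum_univ_succ (n := m + 1), partY, h.y_succ, h.y_zero]

theorem mul_partY_last (r : Fin (m + 1)) : (X * partY F) r (Fin.last m) = 0 := by
  simp [Matrix.mul_apply, partY]

theorem mul_cx_last (h : IsBlockPair X cx cy) (j : Fin (m + 2)) :
    (F * cx) j (Fin.last (m + 1)) = 0 := by
  simp [Matrix.mul_apply, h.x_last]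

theorem mul_cy_zero (h : IsBlockPair X cx cy) (j : Fin (m + 2)) : (F * cy) j 0 = 0 := by
  simp [Matrix.mul_apply, h.y_zero]

theorem trace_partX_mul (h : IsBlockPair X cx cy) : (partX F * X).trace = (F * cx).trace := by
  simp [Matrix.trace, h.partX_mul, Fin.sum_univ_castSucc (n := m + 1), h.mul_cx_last]

theorem trace_partY_mul (h : IsBlockPair X cx cy) : (partY F * X).trace = (F * cy).trace := by
  simp [Matrix.trace, h.partY_mul, Fin.sum_univ_succ (n := m + 1), h.mul_cy_zero]

/-- `partX F * X` is the top left corner of `F * cx`, while `partY F * X` is the bottom right corner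
of `F * cy`; this offset is the shift in `HalfData`. At the last `j` the value is zero on both sides
because the last column of `cx` is zero. -/
theorem extend_partX_mul (h : IsBlockPair X cx cy) {i j : Fin (m + 1)} (hij : i ≤ j) :
    extend (partX F * X) (i + 1) (j + 1) = (F * cx) i.succ j.succ := by
  induction j using Fin.lastCases with
  | last =>
    rw [Fin.succ_last, h.mul_cx_last]
    exact extend_of_le_right _ le_rfl
  | cast j =>
    have hi : (i : ℕ) < m := lt_of_le_of_lt hij j.2
    obtain ⟨i, rfl⟩ : ∃ i' : Fin m, i = i'.castSucc := ⟨⟨i, hi⟩, rfl⟩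
    rw [Fin.succ_castSucc, Fin.succ_castSucc, ← h.partX_mul]
    exact extend_val _ i.succ j.succ

theorem extend_rev_mul_partY (h : IsBlockPair X cx cy) {i j : Fin m} :
    extend ((X * partY F).submatrix Fin.rev Fin.rev) ((i : ℕ) + 1) ((j : ℕ) + 1) =
      (cy * F) i.rev j.rev := by
  have := extend_val ((X * partY F).submatrix Fin.rev Fin.rev) i.succ j.succ
  rw [Matrix.submatrix_apply, Fin.rev_succ, Fin.rev_succ, h.mul_partY_castSucc] at this
  exact this

end IsBlockPair

end Parts

/-! ### The telescoping relations for the minors of `U`. -/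

section WindowData

variable {R : Type*} [CommRing R] {k m ε p : ℕ}
  {X : Matrix (Fin (m + 1)) (Fin (m + 1)) R} {cx cy : Matrix (Fin m) (Fin (m + 2)) R}
  {re : Fin p → Fin k × Fin m} {ce : Fin p → Fin (k + 1) × Fin (m + 2)}

/-- The minor of the block matrix with the rows `re` and the columns `ce`. -/
def blockMinor (cx cy : Matrix (Fin m) (Fin (m + 2)) R) (re : Fin p → Fin k × Fin m)
    (ce : Fin p → Fin (k + 1) × Fin (m + 2)) : R :=
  ((shiftedU k cx cy 0).submatrix re ce).det

/-- The gradient of `blockMinor`. -/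
def blockGrad (cx cy : Matrix (Fin m) (Fin (m + 2)) R) (re : Fin p → Fin k × Fin m)
    (ce : Fin p → Fin (k + 1) × Fin (m + 2)) :
    Matrix (Fin (k + 1) × Fin (m + 2)) (Fin k × Fin m) R :=
  windowGrad (shiftedU k cx cy 0) re ce

/-- The number of columns of a window in a given position inside a block. -/
def colMult (ce : Fin p → Fin (k + 1) × Fin (m + 2)) (j : Fin (m + 2)) : ℂ :=
  ∑ b, rangeInd ce (b, j)

/-- The number of rows of a window in a given position inside a block. -/
def rowMult (re : Fin p → Fin k × Fin m) (i : Fin m) : ℂ := ∑ a, rangeInd re (a, i)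

namespace EndWindow

/-- Each summand replaces a column by a later one in the same block. The value `j = 0` is excluded
because a window of type `ψ` contains the first column of the last block but none to its right. -/
theorem col_upper (w : EndWindow k m ε re ce) {j j' : Fin (m + 2)} (h0 : j ≠ 0) (h : j < j') :
    (gradX (blockGrad cx cy re ce) * cx) j j' + (gradY (blockGrad cx cy re ce) * cy) j j' = 0 := by
  rw [gradX_mul_add_gradY_mul]
  refine Finset.sum_eq_zero fun b _ => ?_
  by_cases hb : (b : ℕ) < k
  · exact w.grad_mul_shiftedU_eq_zero cx cy (Or.inr ⟨by simp, h⟩) (Or.inl (by simpa using hb))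
  · refine grad_mul_shiftedU_of_notMem cx cy 0 ?_ _
    rintro ⟨s, hs⟩
    have he := w.col_end s
    rw [hs] at he
    have h1 := w.le_one
    have h2 : (j : ℕ) ≠ 0 := fun h => h0 (Fin.ext h)
    rcases he with he | he <;> simp only at he <;> omega

theorem row_lower (w : EndWindow k m ε re ce) (hcy : ∀ i, cy i 0 = 0) {i i' : Fin m}
    (h : i' < i) :
    (cx * gradX (blockGrad cx cy re ce)) i i' + (cy * gradY (blockGrad cx cy re ce)) i i' = 0 := by
  rw [mul_gradX_add_mul_gradY]
  exact Finset.sum_eq_zero fun a _ =>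
    w.shiftedU_mul_grad_eq_zero cx cy hcy (Or.inr ⟨by simp, h⟩)

variable [Algebra ℂ R]

theorem col_diag (j : Fin (m + 2)) :
    (gradX (blockGrad cx cy re ce) * cx) j j + (gradY (blockGrad cx cy re ce) * cy) j j =
      colMult ce j • blockMinor cx cy re ce := by
  rw [gradX_mul_add_gradY_mul, colMult, Finset.sum_smul]
  exact Finset.sum_congr rfl fun b _ => grad_mul_shiftedU_diag cx cy (by simp) rfl

theorem row_diag (i : Fin m) :
    (cx * gradX (blockGrad cx cy re ce)) i i + (cy * gradY (blockGrad cx cy re ce)) i i =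
      rowMult re i • blockMinor cx cy re ce := by
  rw [mul_gradX_add_mul_gradY, rowMult, Finset.sum_smul]
  exact Finset.sum_congr rfl fun b _ => shiftedU_mul_grad_diag cx cy (by simp) rfl

theorem trace_gradX : ∃ τ : ℂ,
    (gradX (blockGrad cx cy re ce) * cx).trace = τ • blockMinor cx cy re ce := by
  refine ⟨∑ c : Fin (k + 1) × Fin (m + 2), ((c.1 : ℕ) : ℂ) * rangeInd ce c -
    ∑ r : Fin k × Fin m, ((r.1 : ℕ) : ℂ) * rangeInd re r, ?_⟩
  rw [trace_gradX_mul cx cy, sub_smul, Finset.sum_smul, Finset.sum_smul]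
  congr 1
  · refine Finset.sum_congr rfl fun c _ => ?_
    rw [blockGrad, grad_mul_shiftedU_diag cx cy (by simp) rfl, mul_smul, Nat.cast_smul_eq_nsmul,
      nsmul_eq_mul]
    rfl
  · refine Finset.sum_congr rfl fun c _ => ?_
    rw [blockGrad, shiftedU_mul_grad_diag cx cy (by simp) rfl, mul_smul, Nat.cast_smul_eq_nsmul,
      nsmul_eq_mul]
    rfl

theorem trace_gradY : ∃ τ : ℂ,
    (gradY (blockGrad cx cy re ce) * cy).trace = τ • blockMinor cx cy re ce := by
  obtain ⟨τ, hτ⟩ := trace_gradX (cx := cx) (cy := cy) (re := re) (ce := ce)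
  refine ⟨∑ j, colMult ce j - τ, ?_⟩
  rw [sub_smul, ← hτ, Finset.sum_smul, Matrix.trace, Matrix.trace, ← Finset.sum_sub_distrib]
  refine Finset.sum_congr rfl fun j _ => ?_
  rw [← col_diag]
  simp

/-- The multiplicities of columns, with indices shifted as in `HalfData`. -/
def colWeight (ce : Fin p → Fin (k + 1) × Fin (m + 2)) (i : ℕ) : ℂ :=
  if h : i < m + 1 then colMult ce (Fin.succ ⟨i, h⟩) else 0

/-- The multiplicities of rows, in the reversed order. -/
def rowWeight (re : Fin p → Fin k × Fin m) (i : ℕ) : ℂ :=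
  if h : i < m then rowMult re (Fin.rev ⟨i, h⟩) else 0

theorem colWeight_val (i : Fin (m + 1)) : colWeight ce i = colMult ce i.succ := by
  rw [colWeight, dif_pos i.2]

theorem rowWeight_val (i : Fin m) : rowWeight re (i : ℕ) = rowMult re i.rev := by
  rw [rowWeight, dif_pos i.2]

theorem rowWeight_self : rowWeight re m = 0 := by
  simp [rowWeight]

theorem halfData_col (w : EndWindow k m ε re ce) (h : IsBlockPair X cx cy) :
    HalfData (blockMinor cx cy re ce) (partX (gradX (blockGrad cx cy re ce)) * X)
      (partY (gradY (blockGrad cx cy re ce)) * X) (colWeight ce) where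
  upper i j hij := by
    rw [h.extend_partX_mul _ hij.le, h.partY_mul, eq_neg_iff_add_eq_zero, add_comm]
    exact w.col_upper (Fin.succ_ne_zero i) (Fin.succ_lt_succ_iff.mpr hij)
  diag i := by
    rw [h.extend_partX_mul _ le_rfl, h.partY_mul, colWeight_val, ← col_diag (cx := cx) (cy := cy)
      (re := re)]
    ring
  corner := by
    refine ⟨colMult ce 0, ?_⟩
    have e := extend_val (partX (gradX (blockGrad cx cy re ce)) * X) 0 0
    rw [← col_diag, h.mul_cy_zero, add_zero]
    exact e.trans (h.partX_mul _ 0 0)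
  trace := by
    rw [h.trace_partX_mul]
    exact trace_gradX

theorem halfData_row (w : EndWindow k m ε re ce) (h : IsBlockPair X cx cy) :
    HalfData (blockMinor cx cy re ce)
      ((X * partY (gradY (blockGrad cx cy re ce))).submatrix Fin.rev Fin.rev)
      ((X * partX (gradX (blockGrad cx cy re ce))).submatrix Fin.rev Fin.rev)
      (rowWeight re) where
  upper i j hij := by
    induction j using Fin.lastCases with
    | last =>
      rw [Matrix.submatrix_apply, Fin.rev_last, IsBlockPair.mul_partX_zero,
        extend_of_le_right _ (by simp), neg_zero]
    | cast j =>
      have hi : (i : ℕ) < m := lt_of_lt_of_le (Fin.lt_def.mp hij) j.2.le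
      obtain ⟨i, rfl⟩ : ∃ i' : Fin m, i = i'.castSucc := ⟨⟨i, hi⟩, rfl⟩
      simp only [Fin.val_castSucc]
      rw [h.extend_rev_mul_partY, Matrix.submatrix_apply, Fin.rev_castSucc, Fin.rev_castSucc,
        h.mul_partX_succ, eq_neg_iff_add_eq_zero]
      exact w.row_lower h.y_zero (Fin.rev_lt_rev.mpr hij)
  diag i := by
    induction i using Fin.lastCases with
    | last =>
      rw [Matrix.submatrix_apply, Fin.rev_last, IsBlockPair.mul_partX_zero,
        extend_of_le_right _ (by simp), Fin.val_last, rowWeight_self, zero_smul, sub_zero]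
    | cast i =>
      simp only [Fin.val_castSucc]
      rw [h.extend_rev_mul_partY, Matrix.submatrix_apply, Fin.rev_castSucc, h.mul_partX_succ,
        rowWeight_val, ← row_diag (cx := cx) (cy := cy) (ce := ce)]
      ring
  corner := by
    -- The reversal moves the last column, where `X * partY` vanishes, to the corner.
    refine ⟨0, ?_⟩
    have e := extend_val
      ((X * partY (gradY (blockGrad cx cy re ce))).submatrix Fin.rev Fin.rev) 0 0
    rw [Matrix.submatrix_apply, Fin.rev_zero, IsBlockPair.mul_partY_last] at e
    rw [zero_smul]
    exact e
  trace := by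
    rw [trace_submatrix_rev, Matrix.trace_mul_comm, h.trace_partY_mul]
    exact trace_gradY

end EndWindow

end WindowData

/-! ### Reduced forms of two windows as mixed traces. -/

namespace EndWindow

variable {R : Type*} [CommRing R] [Algebra ℂ R] {k m ε p ε' p' : ℕ}
  {X : Matrix (Fin (m + 1)) (Fin (m + 1)) R} {cx cy : Matrix (Fin m) (Fin (m + 2)) R}
  {re : Fin p → Fin k × Fin m} {ce : Fin p → Fin (k + 1) × Fin (m + 2)}
  {re' : Fin p' → Fin k × Fin m} {ce' : Fin p' → Fin (k + 1) × Fin (m + 2)}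

/-- The contribution to the bracket of the first column of the last block. -/
def boundaryTerm (cx cy : Matrix (Fin m) (Fin (m + 2)) R) (re : Fin p → Fin k × Fin m)
    (ce : Fin p → Fin (k + 1) × Fin (m + 2)) (re' : Fin p' → Fin k × Fin m)
    (ce' : Fin p' → Fin (k + 1) × Fin (m + 2)) : R :=
  ∑ j : Fin (m + 1),
    ((gradX (blockGrad cx cy re ce) * cx) 0 j.succ +
      (gradY (blockGrad cx cy re ce) * cy) 0 j.succ) *
        (gradX (blockGrad cx cy re' ce') * cx) j.succ 0

theorem reducedForm_col_sub_mem (w : EndWindow k m ε re ce) (w' : EndWindow k m ε' re' ce')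
    (h : IsBlockPair X cx cy) :
    HalfData.reducedForm (blockMinor cx cy re ce)
        (partX (gradX (blockGrad cx cy re ce)) * X) (partY (gradY (blockGrad cx cy re ce)) * X)
        (partX (gradX (blockGrad cx cy re' ce')) * X)
        (partY (gradY (blockGrad cx cy re' ce')) * X) (colWeight ce) -
      (boundaryTerm cx cy re ce re' ce' -
        (gradY (blockGrad cx cy re ce) * cy * (gradX (blockGrad cx cy re' ce') * cx)).trace) ∈
      Submodule.span ℂ {blockMinor cx cy re ce * blockMinor cx cy re' ce'} := by
  set f := blockMinor cx cy re ce
  set g := blockMinor cx cy re' ce'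
  have hu := fun j j' h0 hj => w.col_upper (cx := cx) (cy := cy) (j := j) (j' := j') h0 hj
  have hu' := fun j j' h0 hj => w'.col_upper (cx := cx) (cy := cy) (j := j) (j' := j') h0 hj
  have hd := col_diag (cx := cx) (cy := cy) (re := re) (ce := ce)
  have hd' := col_diag (cx := cx) (cy := cy) (re := re') (ce := ce')
  unfold HalfData.reducedForm boundaryTerm
  simp only [h.partX_mul, h.partY_mul, h.extend_partX_mul _ le_rfl, colWeight_val]
  have z := h.mul_cx_last (gradX (blockGrad cx cy re ce))
  have z' := h.mul_cx_last (gradX (blockGrad cx cy re' ce'))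
  have y := h.mul_cy_zero (gradY (blockGrad cx cy re ce))
  have y' := h.mul_cy_zero (gradY (blockGrad cx cy re' ce'))
  generalize gradX (blockGrad cx cy re ce) * cx = F at *
  generalize gradX (blockGrad cx cy re' ce') * cx = H at *
  generalize gradY (blockGrad cx cy re ce) * cy = F' at *
  generalize gradY (blockGrad cx cy re' ce') * cy = H' at *
  have e1 : ∑ i : Fin (m + 1), ∑ j : Fin (m + 1), (if i ≤ j then
      F i.castSucc j.castSucc * H j.castSucc i.castSucc else 0) =
      ∑ c, ∑ c', if c ≤ c' then F c c' * H c' c else 0 := by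
    simp [Fin.sum_univ_castSucc (n := m + 1), z]
  have e2 : ∑ i : Fin (m + 1), ∑ j : Fin (m + 1), (if j < i then
      F' i.succ j.succ * H' j.succ i.succ else 0) =
      ∑ c, ∑ c', if c' < c then F' c c' * H' c' c else 0 := by
    simp [Fin.sum_univ_succ (n := m + 1), y]
  -- Below the diagonal of `F'` one has `H' c' c = -H c' c` by `col_upper`, unless `c' = 0`; there
  -- `F'` has a zero column.
  have e3 : (∑ c, ∑ c', if c ≤ c' then F c c' * H c' c else 0) +
      (∑ c, ∑ c', if c' < c then F' c c' * H' c' c else 0) + (F' * H).trace =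
      ∑ c, ∑ c', if c ≤ c' then (F c c' + F' c c') * H c' c else 0 := by
    simp only [Matrix.trace, Matrix.diag_apply, Matrix.mul_apply, ← Finset.sum_add_distrib]
    refine Finset.sum_congr rfl fun c _ => Finset.sum_congr rfl fun c' _ => ?_
    rcases le_or_gt c c' with hc | hc
    · rw [if_pos hc, if_pos hc, if_neg hc.not_gt]
      ring
    · rw [if_neg hc.not_ge, if_neg hc.not_ge, if_pos hc]
      by_cases h0 : c' = 0
      · rw [h0, y]
        ring
      · linear_combination F' c c' * hu' c' c h0 hc
  -- By `col_upper`, a row other than row `0` contributes only its diagonal term. Row `0` produces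
  -- the boundary term and a multiple of `f * g`.
  have e4 : (∑ c, ∑ c', if c ≤ c' then (F c c' + F' c c') * H c' c else 0) =
      ∑ c', (F 0 c' + F' 0 c') * H c' 0 +
        ∑ i : Fin (m + 1), (colMult ce i.succ • f) * H i.succ i.succ := by
    rw [Fin.sum_univ_succ]
    refine congrArg₂ (· + ·) (by simp) (Finset.sum_congr rfl fun i _ => ?_)
    rw [Finset.sum_eq_single i.succ, if_pos le_rfl, hd]
    · intro c' _ hc'
      split_ifs with hi
      · rw [hu i.succ c' (Fin.succ_ne_zero i) (lt_of_le_of_ne hi hc'.symm), zero_mul]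
      · rfl
    · simp
  have e5 : H 0 0 = colMult ce' 0 • g := by
    rw [← hd', y', add_zero]
  have e6 : f * ∑ i : Fin (m + 1), colMult ce i.succ • H i.succ i.succ =
      ∑ i : Fin (m + 1), (colMult ce i.succ • f) * H i.succ i.succ := by
    rw [Finset.mul_sum]
    exact Finset.sum_congr rfl fun i _ => by rw [mul_smul_comm, smul_mul_assoc]
  have e7 : (F 0 0 + F' 0 0) * H 0 0 = (colMult ce 0 * colMult ce' 0) • (f * g) := by
    rw [hd, e5, smul_mul_smul_comm]
  rw [Fin.sum_univ_succ (fun c' => (F 0 c' + F' 0 c') * H c' 0), e7] at e4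
  rw [e1, e2, e6]
  convert Submodule.smul_mem _ (colMult ce 0 * colMult ce' 0)
    (Submodule.mem_span_singleton_self (f * g)) using 1
  linear_combination e3 + e4

/-- The argument is parallel to the one for columns. Since `row_lower` has no exceptional row, there
is no boundary term and no correction by a multiple of the product. -/
theorem reducedForm_row (w : EndWindow k m ε re ce) (w' : EndWindow k m ε' re' ce')
    (h : IsBlockPair X cx cy) :
    HalfData.reducedForm (blockMinor cx cy re' ce')
      ((X * partY (gradY (blockGrad cx cy re' ce'))).submatrix Fin.rev Fin.rev)
      ((X * partX (gradX (blockGrad cx cy re' ce'))).submatrix Fin.rev Fin.rev)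
      ((X * partY (gradY (blockGrad cx cy re ce))).submatrix Fin.rev Fin.rev)
      ((X * partX (gradX (blockGrad cx cy re ce))).submatrix Fin.rev Fin.rev) (rowWeight re') =
    -(cx * gradX (blockGrad cx cy re' ce') * (cy * gradY (blockGrad cx cy re ce))).trace := by
  have hl := fun i i' hi => w.row_lower (cx := cx) (cy := cy) h.y_zero (i := i) (i' := i') hi
  have hl' := fun i i' hi => w'.row_lower (cx := cx) (cy := cy) h.y_zero (i := i) (i' := i') hi
  have hd' := row_diag (cx := cx) (cy := cy) (re := re') (ce := ce')
  have e3 : ∑ i : Fin (m + 1), rowWeight re' i •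
      extend ((X * partY (gradY (blockGrad cx cy re ce))).submatrix Fin.rev Fin.rev)
        (i + 1) (i + 1) =
      ∑ i : Fin m, rowMult re' i • (cy * gradY (blockGrad cx cy re ce)) i i := by
    rw [Fin.sum_univ_castSucc, Fin.val_last, rowWeight_self, zero_smul, add_zero,
      ← Equiv.sum_comp Fin.revPerm]
    refine Finset.sum_congr rfl fun i _ => ?_
    rw [Fin.val_castSucc, h.extend_rev_mul_partY, rowWeight_val, Fin.revPerm_apply, Fin.rev_rev]
  have revsum : ∀ {n : ℕ} (A : Fin n → Fin n → R), ∑ i, ∑ j, A i j =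
      ∑ i, ∑ j, A (Fin.rev i) (Fin.rev j) := by
    intro n A
    rw [← Equiv.sum_comp Fin.revPerm]
    exact Finset.sum_congr rfl fun i _ => (Equiv.sum_comp Fin.revPerm _).symm
  unfold HalfData.reducedForm
  rw [e3, revsum, revsum (fun i j => if j < i then _ else _)]
  simp only [Matrix.submatrix_apply, Fin.rev_rev, Fin.rev_le_rev, Fin.rev_lt_rev]
  have e1 : ∑ i, ∑ j, (if j ≤ i then (X * partY (gradY (blockGrad cx cy re' ce'))) i j *
        (X * partY (gradY (blockGrad cx cy re ce))) j i else 0) =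
      ∑ i : Fin m, ∑ j : Fin m, if j ≤ i then (cy * gradY (blockGrad cx cy re' ce')) i j *
        (cy * gradY (blockGrad cx cy re ce)) j i else 0 := by
    simp [Fin.sum_univ_castSucc (n := m), IsBlockPair.mul_partY_last, h.mul_partY_castSucc]
  have e2 : ∑ i, ∑ j, (if i < j then (X * partX (gradX (blockGrad cx cy re' ce'))) i j *
        (X * partX (gradX (blockGrad cx cy re ce))) j i else 0) =
      ∑ i : Fin m, ∑ j : Fin m, if i < j then (cx * gradX (blockGrad cx cy re' ce')) i j *
        (cx * gradX (blockGrad cx cy re ce)) j i else 0 := by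
    simp [Fin.sum_univ_succ (n := m), IsBlockPair.mul_partX_zero, h.mul_partX_succ]
  rw [e1, e2]
  have e4 : blockMinor cx cy re' ce' *
      ∑ i : Fin m, rowMult re' i • (cy * gradY (blockGrad cx cy re ce)) i i =
      ∑ i : Fin m, ∑ j : Fin m, if i = j then (rowMult re' i • blockMinor cx cy re' ce') *
        (cy * gradY (blockGrad cx cy re ce)) i i else 0 := by
    simp [Finset.mul_sum]
  rw [e4, eq_neg_iff_add_eq_zero]
  simp only [Matrix.trace, Matrix.diag_apply]
  simp only [Matrix.mul_apply (M := cx * gradX (blockGrad cx cy re' ce')),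
    ← Finset.sum_add_distrib, ← Finset.sum_sub_distrib]
  refine Finset.sum_eq_zero fun i _ => Finset.sum_eq_zero fun j _ => ?_
  rcases lt_trichotomy i j with hij | hij | hij
  · rw [if_neg hij.not_ge, if_pos hij, if_neg hij.ne]
    linear_combination (cx * gradX (blockGrad cx cy re' ce')) i j * hl j i hij
  · subst hij
    rw [if_pos le_rfl, if_neg (lt_irrefl i), if_pos rfl, ← hd']
    ring
  · rw [if_pos hij.le, if_neg hij.not_gt, if_neg hij.ne']
    linear_combination (cy * gradY (blockGrad cx cy re ce)) j i * hl' i j hij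

end EndWindow

/-! ### The trace identity for shifted windows. -/

section ShiftIdentity

variable {R : Type*} [CommRing R] {k m : ℕ} (cx cy : Matrix (Fin m) (Fin (m + 2)) R)
  (G G' : Matrix (Fin (k + 1) × Fin (m + 2)) (Fin k × Fin m) R)

theorem trace_gradY_mul_gradX (A B : Matrix (Fin m) (Fin (m + 2)) R) :
    (gradY G * A * (gradX G' * B)).trace =
      ∑ c : Fin (k + 1) × Fin (m + 2), ∑ c' : Fin (k + 1) × Fin (m + 2),
        ∑ r : Fin k × Fin m, ∑ r' : Fin k × Fin m,
          if c.1 = r.1.castSucc ∧ c'.1 = r'.1.succ then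
            G c r * G' c' r' * (A r.2 c'.2 * B r'.2 c.2) else 0 := by
  have h1 : ∀ j j', (gradY G * A) j j' = ∑ b : Fin (k + 1), ∑ r : Fin k × Fin m,
      if b = r.1.castSucc then G (b, j) r * A r.2 j' else 0 := by
    intro j j'
    rw [Finset.sum_comm]
    simp only [Finset.sum_ite_eq', Finset.mem_univ, if_true, Matrix.mul_apply, gradY,
      Matrix.of_apply, Finset.sum_mul, Fintype.sum_prod_type]
    exact Finset.sum_comm
  have h2 : ∀ j j', (gradX G' * B) j j' = ∑ b : Fin (k + 1), ∑ r : Fin k × Fin m,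
      if b = r.1.succ then G' (b, j) r * B r.2 j' else 0 := by
    intro j j'
    rw [Finset.sum_comm]
    simp only [Finset.sum_ite_eq', Finset.mem_univ, if_true, Matrix.mul_apply, gradX,
      Matrix.of_apply, Finset.sum_mul, Fintype.sum_prod_type]
    exact Finset.sum_comm
  have h3 : ∀ T : Fin (k + 1) × Fin (m + 2) → Fin (k + 1) × Fin (m + 2) → R,
      ∑ c, ∑ c', T c c' = ∑ j, ∑ j', ∑ b, ∑ b', T (b, j) (b', j') := by
    intro T
    simp only [Fintype.sum_prod_type]
    rw [Finset.sum_comm]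
    refine Finset.sum_congr rfl fun j _ => ?_
    rw [Finset.sum_comm' (t' := Finset.univ) (s' := fun _ => Finset.univ) (by simp)]
    rw [Finset.sum_comm]
    refine (Finset.sum_congr rfl fun b _ => Finset.sum_comm).trans ?_
    exact Finset.sum_comm
  rw [h3, Matrix.trace]
  refine Finset.sum_congr rfl fun j _ => ?_
  rw [Matrix.diag_apply, Matrix.mul_apply]
  refine Finset.sum_congr rfl fun j' _ => ?_
  rw [h1, h2, Finset.sum_mul_sum]
  refine Finset.sum_congr rfl fun b _ => Finset.sum_congr rfl fun b' _ => ?_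
  rw [Finset.sum_mul_sum]
  refine Finset.sum_congr rfl fun r _ => Finset.sum_congr rfl fun r' _ => ?_
  rw [ite_and]
  split_ifs
  · ring
  · ring
  · ring
  · ring

/-- The sum over pairs of columns in increasing blocks. -/
def colSumLT (d : ℤ) : R :=
  ∑ c : Fin (k + 1) × Fin (m + 2), ∑ c' : Fin (k + 1) × Fin (m + 2),
    if ((c.1 : ℕ) : ℤ) < (c'.1 : ℕ) + d then
      (G * shiftedU k cx cy d) c c' * (G' * shiftedU k cx cy (-d)) c' c else 0

/-- The sum over pairs of columns in weakly decreasing blocks. -/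
def colSumGE (d : ℤ) : R :=
  ∑ c : Fin (k + 1) × Fin (m + 2), ∑ c' : Fin (k + 1) × Fin (m + 2),
    if ((c.1 : ℕ) : ℤ) < (c'.1 : ℕ) + d then 0 else
      (G * shiftedU k cx cy d) c c' * (G' * shiftedU k cx cy (-d)) c' c

/-- The sum over pairs of rows in increasing blocks. -/
def rowSumLT (d : ℤ) : R :=
  ∑ r : Fin k × Fin m, ∑ r' : Fin k × Fin m,
    if ((r'.1 : ℕ) : ℤ) + d < (r.1 : ℕ) then
      (shiftedU k cx cy (-d) * G) r' r * (shiftedU k cx cy d * G') r r' else 0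

/-- The sum over pairs of rows in weakly decreasing blocks. -/
def rowSumGE (d : ℤ) : R :=
  ∑ r : Fin k × Fin m, ∑ r' : Fin k × Fin m,
    if ((r'.1 : ℕ) : ℤ) + d < (r.1 : ℕ) then 0 else
      (shiftedU k cx cy (-d) * G) r' r * (shiftedU k cx cy d * G') r r'

theorem colSum_eq_rowSum (d : ℤ) :
    colSumLT cx cy G G' d + colSumGE cx cy G G' d =
      rowSumLT cx cy G G' d + rowSumGE cx cy G G' d := by
  have h1 : colSumLT cx cy G G' d + colSumGE cx cy G G' d =
      (G * shiftedU k cx cy d * (G' * shiftedU k cx cy (-d))).trace := by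
    unfold colSumLT colSumGE
    simp only [Matrix.trace, Matrix.diag_apply,
      Matrix.mul_apply (M := G * shiftedU k cx cy d), ← Finset.sum_add_distrib]
    refine Finset.sum_congr rfl fun c _ => Finset.sum_congr rfl fun c' _ => ?_
    split_ifs <;> simp
  have h2 : rowSumLT cx cy G G' d + rowSumGE cx cy G G' d =
      (shiftedU k cx cy d * G' * (shiftedU k cx cy (-d) * G)).trace := by
    unfold rowSumLT rowSumGE
    simp only [Matrix.trace, Matrix.diag_apply,
      Matrix.mul_apply (M := shiftedU k cx cy d * G'), ← Finset.sum_add_distrib]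
    refine Finset.sum_congr rfl fun c _ => Finset.sum_congr rfl fun c' _ => ?_
    split_ifs <;> simp [mul_comm]
  rw [h1, h2, Matrix.mul_assoc G, Matrix.trace_mul_comm]
  simp only [Matrix.mul_assoc]

/-- A nonzero product fixes each column block, after its shift, as that of the row or the next one.
For two blocks of the same kind, the orders of columns and of rows agree. For blocks of different
kinds they disagree for one value of `d` only, with opposite signs in the two cases. -/
theorem shiftedU_mul_shiftedU (d : ℤ) (c c' : Fin (k + 1) × Fin (m + 2)) (r r' : Fin k × Fin m) :
    (if ((c.1 : ℕ) : ℤ) < (c'.1 : ℕ) + d then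
        shiftedU k cx cy d r c' * shiftedU k cx cy (-d) r' c else 0) -
      (if ((r'.1 : ℕ) : ℤ) + d < (r.1 : ℕ) then
        shiftedU k cx cy d r c' * shiftedU k cx cy (-d) r' c else 0) =
      (if c.1 = r.1.castSucc ∧ c'.1 = r'.1.succ then
        (if d = (r.1 : ℕ) - (r'.1 : ℕ) then cx r.2 c'.2 * cy r'.2 c.2 else 0) else 0) -
      (if c.1 = r.1.castSucc ∧ c'.1 = r'.1.succ then
        (if d = (r.1 : ℕ) - (r'.1 : ℕ) - 1 then cy r.2 c'.2 * cx r'.2 c.2 else 0) else 0) := by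
  simp only [Fin.ext_iff, Fin.val_castSucc, Fin.val_succ, shiftedU, Matrix.of_apply, blockEntry]
  by_cases h1 : ((c'.1 : ℕ) : ℤ) + d - ((r.1 : ℕ) : ℤ) = 0
  · by_cases h2 : ((c.1 : ℕ) : ℤ) + -d - ((r'.1 : ℕ) : ℤ) = 0
    · have hiff : ((c.1 : ℕ) : ℤ) < (c'.1 : ℕ) + d ↔ ((r'.1 : ℕ) : ℤ) + d < (r.1 : ℕ) := by
        omega
      rw [if_pos h1, if_pos h2]
      simp only [hiff, sub_self]
      split_ifs <;> first | omega | ring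
    · by_cases h3 : ((c.1 : ℕ) : ℤ) + -d - ((r'.1 : ℕ) : ℤ) = 1
      · rw [if_pos h1, if_neg h2, if_pos h3]
        split_ifs <;> first | omega | ring
      · rw [if_neg h2, if_neg h3]
        split_ifs <;> first | omega | ring
  · by_cases h1' : ((c'.1 : ℕ) : ℤ) + d - ((r.1 : ℕ) : ℤ) = 1
    · rw [if_neg h1, if_pos h1']
      by_cases h2 : ((c.1 : ℕ) : ℤ) + -d - ((r'.1 : ℕ) : ℤ) = 0
      · rw [if_pos h2]
        split_ifs <;> first | omega | ring
      · rw [if_neg h2]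
        split_ifs <;> first | omega | ring
    · rw [if_neg h1, if_neg h1']
      split_ifs <;> first | omega | ring

theorem colSumLT_sub_rowSumLT (d : ℤ) :
    colSumLT cx cy G G' d - rowSumLT cx cy G G' d =
      ∑ c : Fin (k + 1) × Fin (m + 2), ∑ c' : Fin (k + 1) × Fin (m + 2),
        ∑ r : Fin k × Fin m, ∑ r' : Fin k × Fin m, G c r * G' c' r' *
      ((if c.1 = r.1.castSucc ∧ c'.1 = r'.1.succ then
        (if d = (r.1 : ℕ) - (r'.1 : ℕ) then cx r.2 c'.2 * cy r'.2 c.2 else 0) else 0) -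
      (if c.1 = r.1.castSucc ∧ c'.1 = r'.1.succ then
        (if d = (r.1 : ℕ) - (r'.1 : ℕ) - 1 then cy r.2 c'.2 * cx r'.2 c.2 else 0) else 0)) := by
  have h1 : colSumLT cx cy G G' d = ∑ c : Fin (k + 1) × Fin (m + 2),
      ∑ c' : Fin (k + 1) × Fin (m + 2), ∑ r : Fin k × Fin m, ∑ r' : Fin k × Fin m,
        G c r * G' c' r' * (if ((c.1 : ℕ) : ℤ) < (c'.1 : ℕ) + d then
          shiftedU k cx cy d r c' * shiftedU k cx cy (-d) r' c else 0) := by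
    refine Finset.sum_congr rfl fun c _ => Finset.sum_congr rfl fun c' _ => ?_
    split_ifs
    · rw [Matrix.mul_apply, Matrix.mul_apply, Finset.sum_mul_sum]
      refine Finset.sum_congr rfl fun r _ => Finset.sum_congr rfl fun r' _ => ?_
      ring
    · simp
  have h2 : rowSumLT cx cy G G' d = ∑ c : Fin (k + 1) × Fin (m + 2),
      ∑ c' : Fin (k + 1) × Fin (m + 2), ∑ r : Fin k × Fin m, ∑ r' : Fin k × Fin m,
        G c r * G' c' r' * (if ((r'.1 : ℕ) : ℤ) + d < (r.1 : ℕ) then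
          shiftedU k cx cy d r c' * shiftedU k cx cy (-d) r' c else 0) := by
    refine Eq.trans ?_ (sum_comm_pairs _)
    refine Finset.sum_congr rfl fun r _ => Finset.sum_congr rfl fun r' _ => ?_
    split_ifs
    · rw [Matrix.mul_apply, Matrix.mul_apply, Finset.sum_mul_sum]
      refine Finset.sum_congr rfl fun c _ => Finset.sum_congr rfl fun c' _ => ?_
      ring
    · simp
  rw [h1, h2]
  simp only [← Finset.sum_sub_distrib, ← mul_sub, shiftedU_mul_shiftedU]

theorem sum_colSumLT_sub_rowSumLT :
    ∑ d ∈ Finset.Icc (-((k : ℤ) + 1)) (k + 1),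
      (colSumLT cx cy G G' d - rowSumLT cx cy G G' d) =
      (gradY G * cx * (gradX G' * cy)).trace - (gradY G * cy * (gradX G' * cx)).trace := by
  simp only [colSumLT_sub_rowSumLT, trace_gradY_mul_gradX, ← Finset.sum_sub_distrib]
  rw [Finset.sum_comm]
  refine Finset.sum_congr rfl fun c _ => ?_
  rw [Finset.sum_comm]
  refine Finset.sum_congr rfl fun c' _ => ?_
  rw [Finset.sum_comm]
  refine Finset.sum_congr rfl fun r _ => ?_
  rw [Finset.sum_comm]
  refine Finset.sum_congr rfl fun r' _ => ?_
  rw [← Finset.mul_sum, Finset.sum_sub_distrib]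
  have hr := r.1.2
  have hr' := r'.1.2
  split_ifs
  -- For given row blocks each sum over `d` has one nonzero term, and the range of `d` is wide
  -- enough to contain both values.
  · rw [Finset.sum_ite_eq', Finset.sum_ite_eq', if_pos, if_pos]
    · ring
    · rw [Finset.mem_Icc]
      omega
    · rw [Finset.mem_Icc]
      omega
  · simp

theorem mul_shiftedU_congr {d d' : ℤ} (c : Fin (k + 1) × Fin (m + 2))
    {c₁ c₂ : Fin (k + 1) × Fin (m + 2)} (h : ((c₁.1 : ℕ) : ℤ) + d = (c₂.1 : ℕ) + d')
    (h' : c₁.2 = c₂.2) :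
    (G * shiftedU k cx cy d) c c₁ = (G * shiftedU k cx cy d') c c₂ := by
  simp only [Matrix.mul_apply, shiftedU, Matrix.of_apply, h, h']

end ShiftIdentity

/-! ### Evaluation of the shifted sums for two windows. -/

namespace EndWindow

variable {R : Type*} [CommRing R] {k m ε p ε' p' : ℕ}
  {X : Matrix (Fin (m + 1)) (Fin (m + 1)) R} {cx cy : Matrix (Fin m) (Fin (m + 2)) R}
  {re : Fin p → Fin k × Fin m} {ce : Fin p → Fin (k + 1) × Fin (m + 2)}
  {re' : Fin p' → Fin k × Fin m} {ce' : Fin p' → Fin (k + 1) × Fin (m + 2)}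

theorem rowSumLT_eq_zero (w' : EndWindow k m ε' re' ce') (hcy : ∀ i, cy i 0 = 0) (d : ℤ)
    (G : Matrix (Fin (k + 1) × Fin (m + 2)) (Fin k × Fin m) R) :
    rowSumLT cx cy G (blockGrad cx cy re' ce') d = 0 := by
  refine Finset.sum_eq_zero fun r _ => Finset.sum_eq_zero fun r' _ => ?_
  split_ifs with h
  · rw [blockGrad, w'.shiftedU_mul_grad_eq_zero cx cy hcy (Or.inl (by omega)), mul_zero]
  · rfl

/-- A column of the second window, shifted back by `-d` blocks, still precedes the end of the first
one because `ε' ≤ ε`. It then repeats a column of the first minor. -/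
theorem colSumLT_eq_zero (w : EndWindow k m ε re ce) (w' : EndWindow k m ε' re' ce')
    (hε : ε' ≤ ε) {d : ℤ} (hd : d ≤ 0) :
    colSumLT cx cy (blockGrad cx cy re ce) (blockGrad cx cy re' ce') d = 0 := by
  refine Finset.sum_eq_zero fun c _ => Finset.sum_eq_zero fun c' _ => ?_
  split_ifs with h
  · by_cases hc : c' ∈ Set.range ce'
    · obtain ⟨s, rfl⟩ := hc
      have he := w'.col_end s
      rw [blockGrad, w.grad_mul_shiftedU_eq_zero cx cy (Or.inl h), zero_mul]
      unfold IsEnd at he ⊢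
      omega
    · rw [blockGrad, blockGrad, grad_mul_shiftedU_of_notMem cx cy _ hc, mul_zero]
  · rfl

/-- The part of `colSumGE` that comes from the first column of the last block. -/
def boundarySum (k : ℕ) (cx cy : Matrix (Fin m) (Fin (m + 2)) R)
    (G G' : Matrix (Fin (k + 1) × Fin (m + 2)) (Fin k × Fin m) R) (d : ℤ) : R :=
  ∑ c : Fin (k + 1) × Fin (m + 2), ∑ c' : Fin (k + 1) × Fin (m + 2),
    if c = (Fin.last k, 0) ∧ ((c'.1 : ℕ) : ℤ) + d = k ∧ c'.2 ≠ 0 then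
      (G * shiftedU k cx cy d) c c' * (G' * shiftedU k cx cy (-d)) c' c else 0

/-- The condition `c'.1 + d = k` determines `d` from `c'.1`, and `1 ≤ d` means that `c'` is not in
the last block. Summing over `d` thus restores the sum over blocks in `gradX`. -/
theorem sum_boundarySum (w : EndWindow k m ε re ce) (w' : EndWindow k m ε' re' ce')
    (hcy : ∀ i, cy i 0 = 0) :
    ∑ d ∈ Finset.Icc (-((k : ℤ) + 1)) (k + 1), (if 1 ≤ d then
      boundarySum k cx cy (blockGrad cx cy re ce) (blockGrad cx cy re' ce') d else 0) =
      boundaryTerm cx cy re ce re' ce' := by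
  set V := shiftedU k cx cy 0
  have e1 : ∀ d, boundarySum k cx cy (blockGrad cx cy re ce) (blockGrad cx cy re' ce') d =
      ∑ c' : Fin (k + 1) × Fin (m + 2), if ((c'.1 : ℕ) : ℤ) + d = k ∧ c'.2 ≠ 0 then
        (blockGrad cx cy re ce * V) (Fin.last k, 0) (Fin.last k, c'.2) *
          (blockGrad cx cy re' ce' * V) c' (c'.1, 0) else 0 := by
    intro d
    unfold boundarySum
    rw [Finset.sum_eq_single (Fin.last k, 0)]
    · refine Finset.sum_congr rfl fun c' _ => ?_
      simp only [true_and]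
      split_ifs with h
      · rw [mul_shiftedU_congr cx cy _ (d := d) (d' := 0) _ (c₁ := c')
          (c₂ := (Fin.last k, c'.2)) (by simpa using h.1) rfl,
          mul_shiftedU_congr cx cy _ (d := -d) (d' := 0) _ (c₁ := (Fin.last k, 0))
          (c₂ := (c'.1, 0)) (by have := h.1; simp only [Fin.val_last]; omega) rfl]
      · rfl
    · intro b _ hb
      simp [hb]
    · simp
  have e2 : ∀ c' : Fin (k + 1) × Fin (m + 2), ∀ x : R,
      ∑ d ∈ Finset.Icc (-((k : ℤ) + 1)) (k + 1),
        (if 1 ≤ d then (if ((c'.1 : ℕ) : ℤ) + d = k ∧ c'.2 ≠ 0 then x else 0) else 0) =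
        if (c'.1 : ℕ) < k ∧ c'.2 ≠ 0 then x else 0 := by
    intro c' x
    rw [Finset.sum_eq_single ((k : ℤ) - (c'.1 : ℕ))]
    · rw [← ite_and]
      refine if_congr ?_ rfl rfl
      constructor
      · rintro ⟨h1, h2, h3⟩
        exact ⟨by omega, h3⟩
      · rintro ⟨h1, h3⟩
        exact ⟨by omega, by omega, h3⟩
    · intro b _ hb
      split_ifs with h1 h2
      · exact absurd (by omega) hb
      · rfl
      · rfl
    · intro hm
      rw [Finset.mem_Icc] at hm
      have := c'.1.2
      exact absurd ⟨by omega, by omega⟩ hm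
  have e3 : ∀ j : Fin (m + 1), (gradX (blockGrad cx cy re ce) * cx) 0 j.succ +
      (gradY (blockGrad cx cy re ce) * cy) 0 j.succ =
      (blockGrad cx cy re ce * V) (Fin.last k, 0) (Fin.last k, j.succ) := by
    intro j
    rw [gradX_mul_add_gradY_mul, Finset.sum_eq_single (Fin.last k)]
    · intro b _ hb
      have hb' : (b : ℕ) < k := lt_of_le_of_ne (Nat.lt_succ_iff.mp b.2) fun h => hb (Fin.ext h)
      exact w.grad_mul_shiftedU_eq_zero cx cy (Or.inr ⟨by simp, Fin.succ_pos j⟩)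
        (Or.inl (by simpa using hb'))
    · simp
  have e4 : ∀ j : Fin (m + 1), (gradX (blockGrad cx cy re' ce') * cx) j.succ 0 =
      ∑ b : Fin (k + 1), if (b : ℕ) < k then
        (blockGrad cx cy re' ce' * V) (b, j.succ) (b, 0) else 0 := by
    intro j
    have h0 : (gradY (blockGrad cx cy re' ce') * cy) j.succ 0 = 0 := by
      simp [Matrix.mul_apply, hcy]
    have h2 := gradX_mul_add_gradY_mul cx cy (blockGrad cx cy re' ce') j.succ 0
    rw [h0, add_zero] at h2
    rw [h2]
    refine Finset.sum_congr rfl fun b _ => ?_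
    split_ifs with hb
    · rfl
    · refine grad_mul_shiftedU_of_notMem cx cy 0 ?_ _
      rintro ⟨s, hs⟩
      have he := w'.col_end s
      rw [hs] at he
      have h1 := w'.le_one
      have h2 := Fin.val_succ j
      unfold IsEnd at he
      simp only at he
      omega
  have e5 : ∀ d : ℤ, (if 1 ≤ d then
      boundarySum k cx cy (blockGrad cx cy re ce) (blockGrad cx cy re' ce') d else 0) =
      ∑ c' : Fin (k + 1) × Fin (m + 2), if 1 ≤ d then
        (if ((c'.1 : ℕ) : ℤ) + d = k ∧ c'.2 ≠ 0 then
        (blockGrad cx cy re ce * V) (Fin.last k, 0) (Fin.last k, c'.2) *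
          (blockGrad cx cy re' ce' * V) c' (c'.1, 0) else 0) else 0 := by
    intro d
    rw [e1]
    split_ifs <;> simp
  rw [Finset.sum_congr rfl fun d _ => e5 d, Finset.sum_comm,
    Finset.sum_congr rfl fun c' _ => e2 c' _, Fintype.sum_prod_type, Finset.sum_comm]
  unfold boundaryTerm
  rw [Fin.sum_univ_succ]
  simp only [e3, e4, Finset.mul_sum, mul_ite, mul_zero]
  simp [Fin.succ_ne_zero]

variable [Algebra ℂ R]

theorem rowSumGE_mem (w : EndWindow k m ε re ce) (w' : EndWindow k m ε' re' ce')
    (hcy : ∀ i, cy i 0 = 0) (d : ℤ) :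
    rowSumGE cx cy (blockGrad cx cy re ce) (blockGrad cx cy re' ce') d ∈
      Submodule.span ℂ {blockMinor cx cy re ce * blockMinor cx cy re' ce'} := by
  refine Submodule.sum_mem _ fun r _ => Submodule.sum_mem _ fun r' _ => ?_
  split_ifs with h
  · exact Submodule.zero_mem _
  · unfold blockGrad
    by_cases h1 : ((r.1 : ℕ) : ℤ) < (r'.1 : ℕ) - -d ∨
        (((r.1 : ℕ) : ℤ) = (r'.1 : ℕ) - -d ∧ r.2 < r'.2)
    · rw [w.shiftedU_mul_grad_eq_zero cx cy hcy h1, zero_mul]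
      exact Submodule.zero_mem _
    · by_cases h2 : r'.2 < r.2
      · rw [w'.shiftedU_mul_grad_eq_zero cx cy hcy (Or.inr ⟨by omega, h2⟩), mul_zero]
        exact Submodule.zero_mem _
      · have h3 : r.2 = r'.2 := by
          rw [Fin.lt_def] at h1 h2
          exact Fin.ext (by omega)
        rw [shiftedU_mul_grad_diag cx cy (by omega) h3,
          shiftedU_mul_grad_diag cx cy (by omega) h3.symm, smul_mul_smul_comm]
        exact Submodule.smul_mem _ _ (Submodule.mem_span_singleton_self _)

/-- If the shifted `c'` comes before `c`, the second factor vanishes: as `1 ≤ d`, column `c` is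
moved out of the last block. If it comes after `c` in the same block, the first factor vanishes,
except for the boundary pairs. At equal positions both factors are multiples of the minors. -/
theorem colSumGE_sub_mem (w : EndWindow k m ε re ce) (w' : EndWindow k m ε' re' ce')
    {d : ℤ} (hd : 1 ≤ d) :
    colSumGE cx cy (blockGrad cx cy re ce) (blockGrad cx cy re' ce') d -
      boundarySum k cx cy (blockGrad cx cy re ce) (blockGrad cx cy re' ce') d ∈
      Submodule.span ℂ {blockMinor cx cy re ce * blockMinor cx cy re' ce'} := by
  unfold colSumGE boundarySum
  simp only [← Finset.sum_sub_distrib]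
  refine Submodule.sum_mem _ fun c _ => Submodule.sum_mem _ fun c' _ => ?_
  by_cases hb : c = (Fin.last k, 0) ∧ ((c'.1 : ℕ) : ℤ) + d = k ∧ c'.2 ≠ 0
  · rw [if_pos hb, if_neg, sub_self]
    · exact Submodule.zero_mem _
    · rw [hb.1, hb.2.1]
      simp
  rw [if_neg hb, sub_zero]
  split_ifs with h
  · exact Submodule.zero_mem _
  unfold blockGrad
  by_cases hc : c ∈ Set.range ce
  swap
  · rw [grad_mul_shiftedU_of_notMem cx cy _ hc, zero_mul]
    exact Submodule.zero_mem _
  have hck := c.1.2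
  by_cases h1 : ((c'.1 : ℕ) : ℤ) < (c.1 : ℕ) + -d ∨
      (((c'.1 : ℕ) : ℤ) = (c.1 : ℕ) + -d ∧ c'.2 < c.2)
  · rw [w'.grad_mul_shiftedU_eq_zero cx cy h1 (Or.inl (by omega)), mul_zero]
    exact Submodule.zero_mem _
  · by_cases h2 : c.2 < c'.2
    · by_cases hk : (c.1 : ℕ) < k
      · rw [w.grad_mul_shiftedU_eq_zero cx cy (Or.inr ⟨by omega, h2⟩) (Or.inl (by omega)),
          zero_mul]
        exact Submodule.zero_mem _
      · obtain ⟨s, rfl⟩ := hc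
        have he := w.col_end s
        have h1' := w.le_one
        unfold IsEnd at he
        rw [Fin.lt_def] at h2
        refine absurd ⟨Prod.ext (Fin.ext ?_) (Fin.ext ?_), ?_, ?_⟩ hb
        · rw [Fin.val_last]
          omega
        · rw [Fin.val_zero]
          omega
        · omega
        · intro h0
          rw [h0, Fin.val_zero] at h2
          omega
    · have h3 : c.2 = c'.2 := by
        rw [Fin.lt_def] at h1 h2
        exact Fin.ext (by omega)
      rw [grad_mul_shiftedU_diag cx cy (by omega) h3,
        grad_mul_shiftedU_diag cx cy (by omega) h3.symm, smul_mul_smul_comm]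
      exact Submodule.smul_mem _ _ (Submodule.mem_span_singleton_self _)

/-- The difference of traces is the sum of `colSumLT` over all `d`, because `rowSumLT` vanishes. For
`d ≤ 0` the summand is zero; for `1 ≤ d` it equals `rowSumGE - colSumGE`, which is `-boundarySum`
modulo the product of the minors. -/
theorem trace_sub_trace_add_boundaryTerm_mem (w : EndWindow k m ε re ce)
    (w' : EndWindow k m ε' re' ce') (hε : ε' ≤ ε) (hcy : ∀ i, cy i 0 = 0) :
    (gradY (blockGrad cx cy re ce) * cx * (gradX (blockGrad cx cy re' ce') * cy)).trace -
      (gradY (blockGrad cx cy re ce) * cy * (gradX (blockGrad cx cy re' ce') * cx)).trace +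
      boundaryTerm cx cy re ce re' ce' ∈
      Submodule.span ℂ {blockMinor cx cy re ce * blockMinor cx cy re' ce'} := by
  rw [← sum_boundarySum w w' hcy, ← sum_colSumLT_sub_rowSumLT, ← Finset.sum_add_distrib]
  refine Submodule.sum_mem _ fun d _ => ?_
  rw [w'.rowSumLT_eq_zero hcy, sub_zero]
  split_ifs with hd
  · have h1 := colSum_eq_rowSum cx cy (blockGrad cx cy re ce) (blockGrad cx cy re' ce') d
    rw [w'.rowSumLT_eq_zero hcy, zero_add] at h1
    have h2 := Submodule.sub_mem _ (rowSumGE_mem (cx := cx) w w' hcy d)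
      (colSumGE_sub_mem w w' hd)
    convert h2 using 1
    linear_combination h1
  · rw [colSumLT_eq_zero w w' hε (by omega), zero_add]
    exact Submodule.zero_mem _

end EndWindow

/-! ### Log-canonicity for two minors of `U`. -/

section WindowBracket

variable {k m ε p ε' p' : ℕ}
  {cx cy : Matrix (Fin m) (Fin (m + 2)) (CoordMat (m + 1))}
  {re : Fin p → Fin k × Fin m} {ce : Fin p → Fin (k + 1) × Fin (m + 2)}
  {re' : Fin p' → Fin k × Fin m} {ce' : Fin p' → Fin (k + 1) × Fin (m + 2)}

theorem derivation_blockMinor {R : Type*} [CommRing R] [Algebra ℂ R] (d : Derivation ℂ R R)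
    {X : Matrix (Fin (m + 1)) (Fin (m + 1)) R} {cx cy : Matrix (Fin m) (Fin (m + 2)) R}
    (h : IsBlockPair X cx cy) :
    d (blockMinor cx cy re ce) = ((partX (gradX (blockGrad cx cy re ce)) +
      partY (gradY (blockGrad cx cy re ce))) * X.map d).trace := by
  -- A derivation applied entrywise keeps the shape of the blocks, so the trace formulas for `partX`
  -- and `partY` apply to the differentiated matrices.
  have h' : IsBlockPair (X.map d) (cx.map d) (cy.map d) :=
    { x_castSucc := fun i j => congrArg d (h.x_castSucc i j)
      x_last := fun i => (congrArg d (h.x_last i)).trans (map_zero d)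
      y_succ := fun i j => congrArg d (h.y_succ i j)
      y_zero := fun i => (congrArg d (h.y_zero i)).trans (map_zero d) }
  rw [Matrix.add_mul, Matrix.trace_add, h'.trace_partX_mul, h'.trace_partY_mul, Matrix.trace,
    Matrix.trace, ← Finset.sum_add_distrib]
  simp only [Matrix.diag_apply, gradX_mul_add_gradY_mul]
  rw [Finset.sum_comm, blockMinor, derivation_minor, Fintype.sum_prod_type]
  refine Finset.sum_congr rfl fun b _ => Finset.sum_congr rfl fun j _ => ?_
  rw [Matrix.mul_apply]
  refine Finset.sum_congr rfl fun r _ => ?_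
  simp only [blockGrad, shiftedU, blockEntry, Matrix.of_apply, Matrix.map_apply]
  split_ifs <;> simp

theorem pderiv_genericMatrix (n : ℕ) (i j : Fin n) :
    (genericMatrix n).map (MvPolynomial.pderiv (R := ℂ) (i, j)) = Matrix.single i j 1 := by
  ext1 a b
  have h : (genericMatrix n).map (MvPolynomial.pderiv (R := ℂ) (i, j)) a b =
      MvPolynomial.pderiv (i, j) (MvPolynomial.X (a, b)) := rfl
  rw [h, MvPolynomial.pderiv_X, Pi.single_apply, Matrix.single_apply]
  exact if_congr (by rw [Prod.ext_iff, eq_comm, @eq_comm _ j]) rfl rfl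

theorem EndWindow.gradData (w : EndWindow k m ε re ce)
    (h : IsBlockPair (genericMatrix (m + 1)) cx cy) :
    GradData (blockMinor cx cy re ce) (partX (gradX (blockGrad cx cy re ce)))
      (partY (gradY (blockGrad cx cy re ce))) (EndWindow.colWeight ce)
      (EndWindow.rowWeight re) where
  grad_eq := by
    ext1 j i
    rw [grad, Matrix.of_apply, derivation_blockMinor _ h]
    erw [pderiv_genericMatrix]
    rw [Matrix.trace_mul_single, MulOpposite.op_one, one_smul]
  col := w.halfData_col h
  row := w.halfData_row h

theorem EndWindow.bracketMat_mem (hm : 1 ≤ m) {r : sl (m + 1) ⊗[ℂ] sl (m + 1)}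
    (hr : IsRMatrix (m + 1) r) (w : EndWindow k m ε re ce) (w' : EndWindow k m ε' re' ce')
    (hε : ε' ≤ ε) (h : IsBlockPair (genericMatrix (m + 1)) cx cy) :
    bracketMat (m + 1) r (blockMinor cx cy re ce) (blockMinor cx cy re' ce') ∈
      Submodule.span ℂ {blockMinor cx cy re ce * blockMinor cx cy re' ce'} := by
  have h1 := bracketMat_sub_mem (by omega) hr (w.gradData h) (w'.gradData h)
  have h2 := w.reducedForm_col_sub_mem w' h
  have h3 := w.reducedForm_row w' h
  have h4 := w.trace_sub_trace_add_boundaryTerm_mem (cx := cx) w' hε h.y_zero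
  have h5 : (cx * gradX (blockGrad cx cy re' ce') * (cy * gradY (blockGrad cx cy re ce))).trace =
      (gradY (blockGrad cx cy re ce) * cx * (gradX (blockGrad cx cy re' ce') * cy)).trace := by
    rw [← Matrix.mul_assoc, Matrix.trace_mul_comm]
    simp only [Matrix.mul_assoc]
  rw [h3, h5] at h1
  have h6 := Submodule.add_mem _ (Submodule.add_mem _ h1 h2) h4
  convert h6 using 1
  ring

end WindowBracket

/-! ### Trailing principal minors of `X`. -/

section Theta

variable {n p : ℕ} {e : Fin p → Fin n}

theorem windowGrad_mul_of_le {R : Type*} [CommRing R] [Algebra ℂ R]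
    (X : Matrix (Fin n) (Fin n) R) (he : ∀ s c, e s ≤ c → c ∈ Set.range e) {c c' : Fin n}
    (h : c ≤ c') : (windowGrad X e e * X) c c' =
      if c = c' then rangeInd e c • (X.submatrix e e).det else 0 := by
  rw [Matrix.mul_apply]
  by_cases hc : c ∈ Set.range e
  · obtain ⟨s, rfl⟩ := hc
    obtain ⟨s', rfl⟩ := he s c' h
    rw [sum_windowGrad_mul_of_col X (re := e) (ce := e) (e s) (fun r => X r (e s')) s'
      (fun _ => rfl), rangeInd, if_pos (Set.mem_range_self s), one_smul]
  · rw [rangeInd, if_neg hc, zero_smul, ite_self]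
    exact Finset.sum_eq_zero fun r _ => by rw [windowGrad_of_col_notMem _ hc, zero_mul]

theorem mul_windowGrad_of_le {R : Type*} [CommRing R] [Algebra ℂ R]
    (X : Matrix (Fin n) (Fin n) R) (he : ∀ s c, e s ≤ c → c ∈ Set.range e) {r r' : Fin n}
    (h : r ≤ r') : (X * windowGrad X e e) r' r =
      if r = r' then rangeInd e r • (X.submatrix e e).det else 0 := by
  rw [Matrix.mul_apply]
  by_cases hr : r ∈ Set.range e
  · obtain ⟨s, rfl⟩ := hr
    obtain ⟨s', rfl⟩ := he s r' h
    rw [sum_mul_windowGrad_of_row X (re := e) (ce := e) (e s) (fun c => X (e s') c) s'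
      (fun _ => rfl), rangeInd, if_pos (Set.mem_range_self s), one_smul]
  · rw [rangeInd, if_neg hr, zero_smul, ite_self]
    exact Finset.sum_eq_zero fun c _ => by rw [windowGrad_of_row_notMem _ _ hr, mul_zero]

theorem grad_submatrix_det : grad ((genericMatrix n).submatrix e e).det =
    windowGrad (genericMatrix n) e e := by
  ext1 j i
  rw [grad, Matrix.of_apply, derivation_minor]
  have h : ∀ c r, MvPolynomial.pderiv (R := ℂ) (i, j) (genericMatrix n r c) =
      Matrix.single i j 1 r c := fun c r => congrFun (congrFun (pderiv_genericMatrix n i j) r) c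
  simp only [h]
  rw [Finset.sum_eq_single j, Finset.sum_eq_single i]
  · simp
  · intro b _ hb
    rw [Matrix.single_apply, if_neg (by tauto), mul_zero]
  · simp
  · intro b _ hb
    refine Finset.sum_eq_zero fun a _ => ?_
    rw [Matrix.single_apply, if_neg (by tauto), mul_zero]
  · simp

/-- The indices of the minor form a final segment, so `grad f * X` is lower and `X * grad f` upper
triangular, with multiples of `f` on the diagonals. With zero second part this is what `HalfData`
requires; the index `i + 1` in the column weights is its diagonal shift. -/
theorem gradData_submatrix_det (hn : 0 < n) (he : ∀ s c, e s ≤ c → c ∈ Set.range e) :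
    GradData ((genericMatrix n).submatrix e e).det (windowGrad (genericMatrix n) e e) 0
      (fun i => if h : i + 1 < n then rangeInd e ⟨i + 1, h⟩ else 0)
      (fun i => if h : i < n then rangeInd e (Fin.rev ⟨i, h⟩) else 0) where
  grad_eq := by rw [grad_submatrix_det, add_zero]
  col :=
    { upper := by
        intro i j hij
        rw [Matrix.zero_mul, Matrix.zero_apply, zero_eq_neg]
        by_cases hj : (j : ℕ) + 1 < n
        · have hi : (i : ℕ) + 1 < n := by
            rw [Fin.lt_def] at hij
            omega
          refine (extend_val _ ⟨i + 1, hi⟩ ⟨j + 1, hj⟩).trans ?_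
          rw [windowGrad_mul_of_le _ he (by rw [Fin.le_def]; exact Nat.succ_le_succ hij.le),
            if_neg]
          rw [Fin.ext_iff]
          exact fun h => hij.ne (Fin.ext (Nat.succ.inj h))
        · exact extend_of_le_right _ (by omega)
      diag := by
        intro i
        rw [Matrix.zero_mul, Matrix.zero_apply, eq_comm, sub_eq_zero]
        by_cases hi : (i : ℕ) + 1 < n
        · rw [dif_pos hi]
          refine Eq.symm ((extend_val _ ⟨i + 1, hi⟩ ⟨i + 1, hi⟩).trans ?_)
          rw [windowGrad_mul_of_le _ he le_rfl, if_pos rfl]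
        · rw [dif_neg hi, zero_smul, extend_of_le_right _ (by omega)]
      corner := by
        refine ⟨rangeInd e ⟨0, hn⟩, (extend_val _ ⟨0, hn⟩ ⟨0, hn⟩).trans ?_⟩
        rw [windowGrad_mul_of_le _ he le_rfl, if_pos rfl]
      trace := by
        refine ⟨∑ i, rangeInd e i, ?_⟩
        rw [Finset.sum_smul]
        refine Finset.sum_congr rfl fun i _ => ?_
        rw [Matrix.diag_apply, windowGrad_mul_of_le _ he le_rfl, if_pos rfl] }
  row :=
    { upper := by
        intro i j hij
        rw [Matrix.mul_zero, Matrix.submatrix_apply,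
          mul_windowGrad_of_le _ he (Fin.rev_le_rev.mpr hij.le), if_neg]
        · simp [extend]
        · exact fun h => hij.ne' (Fin.rev_injective h)
      diag := by
        intro i
        rw [Matrix.mul_zero, Matrix.submatrix_apply, mul_windowGrad_of_le _ he le_rfl,
          if_pos rfl, dif_pos i.2]
        simp [extend]
      corner := ⟨0, by simp [extend]⟩
      trace := ⟨0, by simp⟩ }

end Theta

/-! ### The members of the family, and conclusion. -/

section Members

theorem isBlockPair_cal {R : Type*} [CommRing R] {m : ℕ}
    (X : Matrix (Fin (m + 1)) (Fin (m + 1)) R) :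
    IsBlockPair X (calX X : Matrix (Fin m) (Fin (m + 2)) R)
      (calY X : Matrix (Fin m) (Fin (m + 2)) R) where
  x_castSucc i j := by
    simp only [calX, Matrix.of_apply, Fin.val_castSucc, dif_pos j.2]
    rfl
  x_last i := by
    simp [calX]
  y_succ i j := by
    simp [calY]
    rfl
  y_zero i := by
    simp [calY]

theorem finProdFinEquiv_lt {a b : ℕ} {x y : Fin a × Fin b}
    (h : x.1 < y.1 ∨ (x.1 = y.1 ∧ x.2 < y.2)) :
    (finProdFinEquiv x : ℕ) < finProdFinEquiv y := by
  simp only [finProdFinEquiv_apply_val]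
  rcases h with h | ⟨h, h'⟩
  · have h1 : (x.1 : ℕ) + 1 ≤ y.1 := h
    have h2 := Nat.mul_le_mul_left b h1
    have h3 := x.2.2
    rw [Nat.mul_add, Nat.mul_one] at h2
    omega
  · rw [h]
    have : (x.2 : ℕ) < y.2 := h'
    omega

/-- Consecutive numbering is the lexicographic order on pairs (block, position), so an interval of
numbers that reaches the end is a final segment of pairs. -/
theorem endWindow_interval {k m ε a b p : ℕ} (hε : ε ≤ 1) (ha : a + p = k * m)
    (hb : b + p = k * (m + 2) + ε) :
    EndWindow k m ε
      (fun s : Fin p => (finProdFinEquiv.symm (⟨a + s, by omega⟩ : Fin (k * m))))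
      (fun s : Fin p => (finProdFinEquiv.symm (⟨b + s, by
        rw [Nat.add_mul, Nat.one_mul]
        omega⟩ : Fin ((k + 1) * (m + 2))))) where
  le_one := hε
  row_mem t r h := by
    have h1 := finProdFinEquiv_lt h
    rw [Equiv.apply_symm_apply] at h1
    simp only at h1
    have h2 := (finProdFinEquiv r).2
    refine ⟨⟨finProdFinEquiv r - a, by omega⟩, ?_⟩
    rw [Equiv.symm_apply_eq, Fin.ext_iff]
    simp only
    omega
  col_end s := by
    set c : Fin (k + 1) × Fin (m + 2) := finProdFinEquiv.symm _ with hc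
    have h1 : (finProdFinEquiv c : ℕ) = b + s := by
      rw [hc, Equiv.apply_symm_apply]
    rw [finProdFinEquiv_apply_val] at h1
    have h2 := c.1.2
    have h3 := s.2
    unfold IsEnd
    by_cases h4 : (c.1 : ℕ) < k
    · exact Or.inl (by omega)
    · have h5 : (c.1 : ℕ) = k := by omega
      rw [h5, Nat.mul_comm] at h1
      exact Or.inr ⟨by omega, by omega⟩
  col_mem s c h he := by
    have h1 := finProdFinEquiv_lt h
    rw [Equiv.apply_symm_apply] at h1
    simp only at h1
    have h2 : (finProdFinEquiv c : ℕ) < k * (m + 2) + ε := by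
      rw [finProdFinEquiv_apply_val]
      have h3 := c.2.2
      rcases he with he | ⟨he, he'⟩
      · have h4 := Nat.mul_le_mul_left (m + 2) (show (c.1 : ℕ) + 1 ≤ k by omega)
        rw [Nat.mul_add, Nat.mul_one, Nat.mul_comm (m + 2) k] at h4
        omega
      · rw [show (c.1 : ℕ) = k by omega, Nat.mul_comm]
        omega
    refine ⟨⟨finProdFinEquiv c - b, by omega⟩, ?_⟩
    rw [Equiv.symm_apply_eq, Fin.ext_iff]
    simp only
    omega

theorem minor_matU {R : Type*} [CommRing R] {m : ℕ} (X : Matrix (Fin (m + 1)) (Fin (m + 1)) R)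
    (a b p : ℕ) (ha : a + p ≤ NOf (m + 1)) (hb : b + p ≤ (kOf (m + 1) + 1) * (m + 1 + 1)) :
    minor (matU X X) a b p ha hb =
      blockMinor (k := kOf (m + 1)) (calX X : Matrix (Fin m) (Fin (m + 2)) R)
        (calY X : Matrix (Fin m) (Fin (m + 2)) R)
        (fun s : Fin p => finProdFinEquiv.symm
          (⟨a + s, lt_of_lt_of_le (Nat.add_lt_add_left s.2 a) ha⟩ : Fin (kOf (m + 1) * m)))
        (fun s : Fin p => finProdFinEquiv.symm
          (⟨b + s, lt_of_lt_of_le (Nat.add_lt_add_left s.2 b) hb⟩ :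
            Fin ((kOf (m + 1) + 1) * (m + 2)))) := by
  have h : (blockU X X : Matrix (Fin (kOf (m + 1)) × Fin m)
      (Fin (kOf (m + 1) + 1) × Fin (m + 2)) R) =
      shiftedU (kOf (m + 1)) (calX X : Matrix (Fin m) (Fin (m + 2)) R)
        (calY X : Matrix (Fin m) (Fin (m + 2)) R) 0 := by
    ext r c
    simp only [blockU, shiftedU, blockEntry, Matrix.of_apply]
    refine if_congr (by omega) rfl (if_congr (by omega) rfl rfl)
  unfold blockMinor
  rw [← h]
  rfl

/-- The two kinds of elements of the family. -/
inductive MemberKind (m : ℕ) (f : CoordMat (m + 1)) : Prop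
  | corner (PX : Matrix (Fin (m + 1)) (Fin (m + 1)) (CoordMat (m + 1))) (μ ν : ℕ → ℂ)
      (h : GradData f PX 0 μ ν)
      (h' : ∀ i j, i < j → (PX * genericMatrix (m + 1)) i j = 0)
  | window (ε p : ℕ) (re : Fin p → Fin (kOf (m + 1)) × Fin m)
      (ce : Fin p → Fin (kOf (m + 1) + 1) × Fin (m + 2))
      (w : EndWindow (kOf (m + 1)) m ε re ce)
      (h : f = blockMinor (calX (genericMatrix (m + 1)) : Matrix (Fin m) (Fin (m + 2)) _)
        (calY (genericMatrix (m + 1)) : Matrix (Fin m) (Fin (m + 2)) _) re ce)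

theorem memberKind_of_isMember {m : ℕ} {f : CoordMat (m + 1)} (hf : IsMember (m + 1) f) :
    MemberKind m f := by
  cases hf with
  | theta i h1 h2 =>
    have he : ∀ (s : Fin i) (c : Fin (m + 1)),
        (⟨m + 1 - i + s, by omega⟩ : Fin (m + 1)) ≤ c →
          c ∈ Set.range fun s : Fin i => (⟨m + 1 - i + s, by omega⟩ : Fin (m + 1)) := by
      intro s c hc
      rw [Fin.le_def] at hc
      simp only at hc
      refine ⟨⟨c - (m + 1 - i), by omega⟩, Fin.ext ?_⟩
      simp only
      omega
    refine MemberKind.corner _ _ _ (gradData_submatrix_det (Nat.succ_pos m) he) ?_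
    intro a b hab
    rw [windowGrad_mul_of_le _ he hab.le, if_neg hab.ne]
  | phi p h1 h2 =>
    have hN : NOf (m + 1) = kOf (m + 1) * m := rfl
    have hle := NOf_le (m + 1)
    have hk : kOf (m + 1) * (m + 1 + 1) = kOf (m + 1) * (m + 2) := rfl
    exact MemberKind.window 0 p _ _ (endWindow_interval (by omega) (by omega) (by omega))
      (minor_matU _ _ _ _ _ _)
  | psi q h1 h2 =>
    have h3 := h2.trans (MOf_le (m + 1))
    have hN : NOf (m + 1) = kOf (m + 1) * m := rfl
    have hle := NOf_le (m + 1)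
    have hk : kOf (m + 1) * (m + 1 + 1) = kOf (m + 1) * (m + 2) := rfl
    exact MemberKind.window 1 q _ _ (endWindow_interval (by omega) (by omega) (by omega))
      (minor_matU _ _ _ _ _ _)

theorem bracketMat_mem_of_isMember {n : ℕ} (hn : 2 ≤ n) {r : sl n ⊗[ℂ] sl n}
    (hr : IsRMatrix n r) {f g : CoordMat n} (hf : IsMember n f) (hg : IsMember n g) :
    bracketMat n r f g ∈ Submodule.span ℂ {f * g} := by
  obtain ⟨m, rfl⟩ : ∃ m, n = m + 1 := ⟨n - 1, by omega⟩
  have swap : ∀ f g, bracketMat (m + 1) r g f ∈ Submodule.span ℂ {g * f} →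
      bracketMat (m + 1) r f g ∈ Submodule.span ℂ {f * g} := by
    intro f g h
    rw [bracketMat_swap (by omega) hr, mul_comm]
    exact Submodule.neg_mem _ h
  have hb := isBlockPair_cal (genericMatrix (m + 1))
  rcases memberKind_of_isMember hf with ⟨PX, μ, ν, h, h'⟩ | ⟨ε, p, re, ce, w, rfl⟩
  · rcases memberKind_of_isMember hg with ⟨QX, μ', ν', h₂, -⟩ | ⟨ε', p', re', ce', w', rfl⟩
    · exact bracketMat_mem_of_triangular hn hr h h' h₂
    · exact bracketMat_mem_of_triangular hn hr h h' (w'.gradData hb)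
  · rcases memberKind_of_isMember hg with ⟨QX, μ', ν', h₂, h₂'⟩ | ⟨ε', p', re', ce', w', rfl⟩
    · exact swap _ _ (bracketMat_mem_of_triangular hn hr h₂ h₂' (w.gradData hb))
    -- The estimate for two windows needs the first to end no earlier than the second; antisymmetry
    -- covers the other order.
    · rcases le_total ε' ε with hε | hε
      · exact w.bracketMat_mem (by omega) hr w' hε hb
      · exact swap _ _ (w'.bracketMat_mem (by omega) hr w hε hb)

end Members

end

end CremmerGervais

theorem theorem3p2 (n : ℕ) (hn : 2 ≤ n)
    (r : TensorProduct ℂ (CremmerGervais.sl n) (CremmerGervais.sl n))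
    (hr : CremmerGervais.IsRMatrix n r) :
    CremmerGervais.IsLogCanonical (CremmerGervais.bracketSL n r)
        (CremmerGervais.restrictSL n '' CremmerGervais.family n) ∧
      CremmerGervais.IsLogCanonical (CremmerGervais.bracketMat n r)
        (CremmerGervais.family n) := by
  have h : CremmerGervais.IsLogCanonical (CremmerGervais.bracketMat n r)
      (CremmerGervais.family n) := by
    intro f hf g hg
    obtain ⟨ω, hω⟩ := Submodule.mem_span_singleton.mp
      (CremmerGervais.bracketMat_mem_of_isMember hn hr hf hg)
    exact ⟨ω, hω.symm⟩
  -- Restriction to `SL_n` intertwines the two brackets, so the same constants serve there.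
  refine ⟨?_, h⟩
  rintro _ ⟨f, hf, rfl⟩ _ ⟨g, hg, rfl⟩
  obtain ⟨ω, hω⟩ := h f hf g hg
  refine ⟨ω, ?_⟩
  rw [CremmerGervais.restrictSL_bracketMat, hω, map_smul, map_mul]
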